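/- A two-dimensional equilateral isotropic random walk with $n$ steps is a sequence $0=X_0,X_1,\ldots,X_n$ of points of $\mathbf{R}^2$ whose steps $X_k-X_{k-1}$ are independent and uniformly distributed on the unit circle. The corresponding random polygon is this walk conditioned on the event $X_n=X_0$; since this event has probability zero, its law is understood as the weak limit, as $\varepsilon\downarrow 0$, of the laws of the walk conditioned on $|X_n-X_0|<\varepsilon$. The number of self-intersections is the number of pairs $1\le k<l\le n$ with $l-k\ge 2$ (for polygons also $l-k\ne n-1$) such that the segments $[X_{k-1},X_k]$ and $[X_{l-1},X_l]$ intersect at a point interior to both. Let $K_n$ and $K'_n$ be the numbers of self-intersections of the $n$-step walk and of the $n$-step polygon, respectively. For all sufficiently large $n$ the law of the $n$-step polygon exists, and as $n\to\infty$ $$\mathrm{Ex}[K'_n]=\frac{2}{\pi^2}\,n\log n+O(n).$$ The same estimate holds for walks: $\mathrm{Ex}[K_n]=\frac{2}{\pi^2}\,n\log n+O(n)$. -/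

import Mathlib

open MeasureTheory Filter Topology

noncomputable section

namespace PlanarWalk

/-- The law of one step: unit length, direction uniformly distributed. The plane is `ℂ`. -/
def stepLaw : Measure ℂ :=
  (ProbabilityTheory.cond volume (Set.Ioc (-Real.pi) Real.pi)).map
    (fun θ : ℝ => Complex.exp (θ * Complex.I))

/-- The path `0 = X 0, X 1, …, X n` whose `n` successive steps are `s 0, …, s (n - 1)`. -/
def path {n : ℕ} (s : Fin n → ℂ) : Fin (n + 1) → ℂ :=
  fun k => ∑ j : Fin n with j.castSucc < k, s j

/-- The law of the `n`-step equilateral isotropic random walk `(X 0, …, X n)` in the plane. -/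
def walkLaw (n : ℕ) : Measure (Fin (n + 1) → ℂ) :=
  (Measure.pi (fun _ : Fin n => stepLaw)).map path

/-- `μ` is the law of the `n`-step equilateral isotropic random polygon, that is, of the walk
conditioned on the null event `X n = X 0`: it is the weak limit, as `ε` decreases to `0`, of the
law of the walk conditioned on the event `dist (X n) (X 0) < ε`. (When all these events have
probability `0`, the conditioned measures are `0`, and no probability measure is a limit.) -/
def IsPolygonLaw (n : ℕ) (μ : ProbabilityMeasure (Fin (n + 1) → ℂ)) : Prop :=
  ∀ g : BoundedContinuousFunction (Fin (n + 1) → ℂ) ℝ,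
    Tendsto
      (fun ε : ℝ => ∫ X, g X ∂(ProbabilityTheory.cond (walkLaw n)
        {X : Fin (n + 1) → ℂ | dist (X (Fin.last n)) (X 0) < ε}))
      (𝓝[>] 0) (𝓝 (∫ X, g X ∂(μ : Measure (Fin (n + 1) → ℂ))))

/-- The `k`-th and `l`-th segments of the path meet at an interior point of each of them. -/
def Cross {n : ℕ} (X : Fin (n + 1) → ℂ) (k l : Fin n) : Prop :=
  (openSegment ℝ (X k.castSucc) (X k.succ) ∩ openSegment ℝ (X l.castSucc) (X l.succ)).Nonempty

/-- The number of self-intersections of a walk: pairs `k < l` of segments with `l - k ≥ 2`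
that cross. -/
def walkCrossings {n : ℕ} (X : Fin (n + 1) → ℂ) : ℕ :=
  Set.ncard {p : Fin n × Fin n | (p.1 : ℕ) + 2 ≤ p.2 ∧ Cross X p.1 p.2}

/-- The number of self-intersections of a polygon: pairs `k < l` of segments with `l - k ≥ 2`
and `l - k ≠ n - 1` that cross. -/
def polygonCrossings {n : ℕ} (X : Fin (n + 1) → ℂ) : ℕ :=
  Set.ncard {p : Fin n × Fin n |
    (p.1 : ℕ) + 2 ≤ p.2 ∧ (p.2 : ℕ) + 1 ≠ p.1 + n ∧ Cross X p.1 p.2}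

end PlanarWalk

end

noncomputable section

namespace PlanarWalk

open scoped FourierTransform ENNReal

/-! By linearity, the expected number of self-intersections is the sum of the crossing probabilities
of the pairs of nonadjacent sides. Let `u`, `v` be two sides with `a ≥ 1` sides between them and `x`
the displacement from the end of the first to the start of the second. The sides cross exactly when
`-x` lies in the open parallelogram spanned by `u` and `v`. Its area is `|det(u, v)|`, with mean `2
/ π` over independent directions. For the walk, `x` is an independent sum of `a` steps, with density
`1 / (π a) * (1 + O(1 / a))` near the origin, so the crossing probability is `2 / (π² a) + O(1 /
a²)`. Since `n - 1 - a` pairs have `a` sides between them, the harmonic series gives the main term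
and the errors sum to `O(n)`.

The density estimate is a local limit theorem with rate (`exists_local_limit`). The characteristic
function of a step is the Bessel function `J₀(|ξ|)`; its `N`-th power is compared with a Gaussian
under the Fourier integral, with a common bound of order `(1 + c N r²)⁻⁴`.

For the polygon, the walk must also close up. Given the two sides and the gap, the other `b = n - 2
- a` steps bring the endpoint within `ε` of the origin with probability about `ε² / b`, and an
unconditioned near return has probability about `ε² / n`. The factor `ε²` cancels, and the crossing
probability becomes `2 / π² * n / (a b)` up to relative errors `O(1 / a + 1 / b)`, that is `2 / π² *
(1 / a + 1 / b) + O(1 / a² + 1 / b²)`. Summed over the polygon pairs, `1 / a + 1 / b` gives exactly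
`n` times the harmonic number of `n - 3`.

Crossing is not a continuous event. Hence the estimates for positive `ε` are stated as two-sided
comparisons with a fixed finite measure on configurations `((u, v), x)`, valid on all measurable
subsets of an open set and uniform in `ε`; such comparisons survive weak limits
(`exists_polygon_cross_bounds`). The polygon law exists because the characteristic functions of the
conditioned step laws converge, as ratios of densities at the origin, and these laws live on one
compact set (`exists_isPolygonLaw`). -/

/-! ### The law of one step -/

instance : IsProbabilityMeasure
    (ProbabilityTheory.cond (volume : Measure ℝ) (Set.Ioc (-Real.pi) Real.pi)) := by
  apply ProbabilityTheory.cond_isProbabilityMeasure_of_finite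
  · simp [Real.volume_Ioc, Real.pi_pos]
  · simp [Real.volume_Ioc]

theorem continuous_exp_ofReal_mul_I : Continuous fun θ : ℝ => Complex.exp (θ * Complex.I) := by
  fun_prop

instance : IsProbabilityMeasure stepLaw :=
  Measure.isProbabilityMeasure_map continuous_exp_ofReal_mul_I.aemeasurable

theorem integral_stepLaw {E : Type*} [NormedAddCommGroup E] [NormedSpace ℝ E] {f : ℂ → E}
    (hf : StronglyMeasurable f) :
    ∫ z, f z ∂stepLaw
      = (2 * Real.pi)⁻¹ • ∫ θ in (-Real.pi)..Real.pi, f (Complex.exp (θ * Complex.I)) := by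
  rw [stepLaw, integral_map continuous_exp_ofReal_mul_I.aemeasurable hf.aestronglyMeasurable,
    ProbabilityTheory.cond, integral_smul_measure,
    intervalIntegral.integral_of_le (by linarith [Real.pi_pos])]
  congr 1
  rw [Real.volume_Ioc, ENNReal.toReal_inv, ENNReal.toReal_ofReal (by linarith [Real.pi_pos])]
  ring

theorem ae_stepLaw_norm_eq_one : ∀ᵐ z ∂stepLaw, ‖z‖ = 1 := by
  rw [stepLaw, ae_map_iff continuous_exp_ofReal_mul_I.aemeasurable
    (measurableSet_eq_fun measurable_norm measurable_const)]
  exact Eventually.of_forall fun θ => Complex.norm_exp_ofReal_mul_I θ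

/-! ### The Bessel function: behaviour at zero, decay, strict bound -/

/-- The Bessel function `J₀`, as the characteristic function of a step in polar coordinates. -/
def besselJ (r : ℝ) : ℝ :=
  (2 * Real.pi)⁻¹ * ∫ θ in (-Real.pi)..Real.pi, Real.cos (r * Real.cos θ)

theorem inner_exp_ofReal_mul_I (θ : ℝ) (ξ : ℂ) :
    inner ℝ (Complex.exp (θ * Complex.I)) ξ = ‖ξ‖ * Real.cos (θ - ξ.arg) := by
  conv_lhs => rw [← Complex.norm_mul_exp_arg_mul_I ξ]
  rw [Complex.inner, ← Complex.exp_conj]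
  simp only [map_mul, Complex.conj_ofReal, Complex.conj_I]
  rw [mul_assoc, ← Complex.exp_add, Complex.re_ofReal_mul]
  congr 1
  rw [show (ξ.arg : ℂ) * Complex.I + θ * -Complex.I = ((ξ.arg - θ : ℝ) : ℂ) * Complex.I by
    push_cast; ring, Complex.exp_ofReal_mul_I_re, ← Real.cos_neg]
  ring_nf

theorem integral_shift_of_periodic {E : Type*} [NormedAddCommGroup E] [NormedSpace ℝ E]
    {f : ℝ → E} (hf : Function.Periodic f (2 * Real.pi)) (c : ℝ) :
    ∫ θ in (-Real.pi)..Real.pi, f (θ + c) = ∫ θ in (-Real.pi)..Real.pi, f θ := by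
  rw [intervalIntegral.integral_comp_add_right]
  have h := hf.intervalIntegral_add_eq (-Real.pi + c) (-Real.pi)
  convert h using 2 <;> ring

theorem charFun_stepLaw (ξ : ℂ) : charFun stepLaw ξ = besselJ ‖ξ‖ := by
  have hm : StronglyMeasurable fun z : ℂ => Complex.exp ((inner ℝ z ξ : ℝ) * Complex.I) :=
    Continuous.stronglyMeasurable (by fun_prop)
  rw [charFun_apply, integral_stepLaw hm, besselJ]
  simp_rw [inner_exp_ofReal_mul_I, sub_eq_add_neg]
  set r := ‖ξ‖
  let e : ℝ → ℂ := fun θ => Complex.exp ((r * Real.cos θ : ℝ) * Complex.I)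
  have he : Function.Periodic e (2 * Real.pi) := fun θ => by
    simp only [e, Real.cos_add_two_pi]
  have hc : Continuous e := by fun_prop
  rw [integral_shift_of_periodic (f := e) he]
  -- Shifting the angle by `π` changes the sign of the cosine, so the imaginary part averages to
  -- zero.
  have h2 : ∫ θ in (-Real.pi)..Real.pi, Complex.exp (-(r * Real.cos θ : ℝ) * Complex.I)
      = ∫ θ in (-Real.pi)..Real.pi, e θ := by
    rw [← integral_shift_of_periodic he Real.pi]
    simp only [e, Real.cos_add_pi]
    push_cast
    simp only [mul_neg]
  have h3 : ((∫ θ in (-Real.pi)..Real.pi, Real.cos (r * Real.cos θ) : ℝ) : ℂ)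
      = ∫ θ in (-Real.pi)..Real.pi, e θ := by
    rw [← intervalIntegral.integral_ofReal]
    have : ∀ θ : ℝ, ((Real.cos (r * Real.cos θ) : ℝ) : ℂ)
        = (1 / 2 : ℂ) * (e θ + Complex.exp (-(r * Real.cos θ : ℝ) * Complex.I)) := fun θ => by
      rw [Complex.ofReal_cos, Complex.cos]
      simp only [e]
      ring
    simp_rw [this]
    rw [intervalIntegral.integral_const_mul, intervalIntegral.integral_add
      (hc.intervalIntegrable _ _) (Continuous.intervalIntegrable (by fun_prop) _ _), h2]
    ring
  rw [Complex.ofReal_mul, h3, Complex.real_smul]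

theorem continuous_besselJ : Continuous besselJ := by
  unfold besselJ
  refine continuous_const.mul ?_
  exact intervalIntegral.continuous_parametric_intervalIntegral_of_continuous'
    (f := fun r θ : ℝ => Real.cos (r * Real.cos θ)) (by fun_prop) _ _

theorem abs_besselJ_le_one (r : ℝ) : |besselJ r| ≤ 1 := by
  have h := intervalIntegral.norm_integral_le_of_norm_le_const (a := -Real.pi) (b := Real.pi)
    (C := 1) (f := fun θ => Real.cos (r * Real.cos θ)) (fun θ _ => Real.abs_cos_le_one _)
  rw [besselJ, abs_mul, abs_of_pos (by positivity), inv_mul_le_iff₀ (by positivity)]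
  rw [Real.norm_eq_abs] at h
  refine h.trans (le_of_eq ?_)
  rw [abs_of_pos] <;> linarith [Real.pi_pos]

theorem abs_cos_sub_le (x : ℝ) : |Real.cos x - (1 - x ^ 2 / 2)| ≤ 3 * x ^ 4 := by
  by_cases hx : |x| ≤ 1
  · refine (Real.cos_bound hx).trans ?_
    rw [pow_abs, abs_of_nonneg (by positivity)]
    nlinarith [show 0 ≤ x ^ 4 by positivity]
  · have h1 : 1 ≤ x ^ 2 := by
      rw [← sq_abs]; nlinarith
    rw [abs_le]
    constructor <;> nlinarith [Real.cos_le_one x, Real.neg_one_le_cos x]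

theorem abs_besselJ_sub_le (r : ℝ) : |besselJ r - (1 - r ^ 2 / 4)| ≤ 3 * r ^ 4 := by
  have h0 : ∫ θ in (-Real.pi)..Real.pi, (1 - (r * Real.cos θ) ^ 2 / 2)
      = 2 * Real.pi * (1 - r ^ 2 / 4) := by
    have : ∀ θ : ℝ, 1 - (r * Real.cos θ) ^ 2 / 2 = 1 - r ^ 2 / 2 * Real.cos θ ^ 2 := fun θ => by
      ring
    simp_rw [this]
    rw [intervalIntegral.integral_sub (by simp) (Continuous.intervalIntegrable (by fun_prop) _ _),
      intervalIntegral.integral_const_mul, integral_cos_sq]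
    simp
    ring
  have h1 : besselJ r - (1 - r ^ 2 / 4) = (2 * Real.pi)⁻¹ *
      ∫ θ in (-Real.pi)..Real.pi, (Real.cos (r * Real.cos θ) - (1 - (r * Real.cos θ) ^ 2 / 2)) := by
    rw [intervalIntegral.integral_sub (Continuous.intervalIntegrable (by fun_prop) _ _)
      (Continuous.intervalIntegrable (by fun_prop) _ _), h0, besselJ]
    field_simp
  have h := intervalIntegral.norm_integral_le_of_norm_le_const (a := -Real.pi) (b := Real.pi)
    (C := 3 * r ^ 4)
    (f := fun θ => Real.cos (r * Real.cos θ) - (1 - (r * Real.cos θ) ^ 2 / 2)) (fun θ _ => by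
      refine (abs_cos_sub_le _).trans ?_
      rw [mul_pow]
      have : Real.cos θ ^ 4 ≤ 1 := by
        have := Real.cos_sq_le_one θ
        nlinarith [sq_nonneg (Real.cos θ)]
      nlinarith [show 0 ≤ r ^ 4 by positivity])
  rw [h1, abs_mul, abs_of_pos (by positivity), inv_mul_le_iff₀ (by positivity)]
  rw [Real.norm_eq_abs] at h
  refine h.trans (le_of_eq ?_)
  rw [abs_of_pos (by linarith [Real.pi_pos])]
  ring

theorem abs_besselJ_sub_exp_le (r : ℝ) : |besselJ r - Real.exp (-r ^ 2 / 4)| ≤ 4 * r ^ 4 := by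
  have h1 := abs_besselJ_sub_le r
  have h2 : |Real.exp (-r ^ 2 / 4) - (1 - r ^ 2 / 4)| ≤ r ^ 4 := by
    by_cases hr : r ^ 2 / 4 ≤ 1
    · have := Real.abs_exp_sub_one_sub_id_le (x := -r ^ 2 / 4) (by
        rw [abs_le]; constructor <;> nlinarith [sq_nonneg r])
      rw [show Real.exp (-r ^ 2 / 4) - (1 - r ^ 2 / 4)
        = Real.exp (-r ^ 2 / 4) - 1 - -r ^ 2 / 4 by ring]
      nlinarith [show 0 ≤ r ^ 4 by positivity]
    · have e1 : Real.exp (-r ^ 2 / 4) ≤ 1 := Real.exp_le_one_iff.2 (by nlinarith)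
      have e2 := Real.exp_pos (-r ^ 2 / 4)
      rw [abs_le]
      constructor <;> nlinarith
  calc _ = |(besselJ r - (1 - r ^ 2 / 4)) - (Real.exp (-r ^ 2 / 4) - (1 - r ^ 2 / 4))| := by
        ring_nf
    _ ≤ _ := abs_sub _ _
    _ ≤ _ := by linarith

theorem besselJ_eq_pi_inv_mul (r : ℝ) :
    besselJ r = Real.pi⁻¹ * ∫ θ in (0)..Real.pi, Real.cos (r * Real.cos θ) := by
  have hc : Continuous fun θ : ℝ => Real.cos (r * Real.cos θ) := by fun_prop
  rw [besselJ, ← intervalIntegral.integral_add_adjacent_intervals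
    (hc.intervalIntegrable (-Real.pi) 0) (hc.intervalIntegrable 0 Real.pi)]
  have : ∫ θ in (-Real.pi)..0, Real.cos (r * Real.cos θ)
      = ∫ θ in (0)..Real.pi, Real.cos (r * Real.cos θ) := by
    have h := intervalIntegral.integral_comp_sub_right (a := 0) (b := Real.pi)
      (fun θ => Real.cos (r * Real.cos θ)) Real.pi
    simp only [zero_sub, sub_self] at h
    rw [← h]
    simp [Real.cos_sub_pi]
  rw [this]
  field_simp
  ring

/-- Integration by parts away from the stationary points `0` and `π`. With `F = -sin (r cos θ) / (r
sin θ)` the derivative is the integrand plus a remainder `G`. The two boundary values account for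
the `2` in the constant, and `G` on an interval of length at most `π` for the `π`. -/
theorem abs_integral_cos_mul_cos_le {r δ : ℝ} (hr : 0 < r) (hδ : 0 < δ) (hδ' : δ ≤ Real.pi / 2) :
    |∫ θ in δ..(Real.pi - δ), Real.cos (r * Real.cos θ)|
      ≤ (2 + Real.pi) / (r * Real.sin δ ^ 2) := by
  have hs : 0 < Real.sin δ := Real.sin_pos_of_pos_of_lt_pi hδ (by linarith [Real.pi_pos])
  have hs1 : Real.sin δ ≤ 1 := Real.sin_le_one δ
  have hle : δ ≤ Real.pi - δ := by linarith
  have hsin : ∀ θ ∈ Set.Icc δ (Real.pi - δ), Real.sin δ ≤ Real.sin θ := by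
    intro θ hθ
    by_cases h : θ ≤ Real.pi / 2
    · exact Real.sin_le_sin_of_le_of_le_pi_div_two (by linarith) h hθ.1
    · rw [← Real.sin_pi_sub θ]
      exact Real.sin_le_sin_of_le_of_le_pi_div_two (by linarith) (by linarith) (by linarith [hθ.2])
  have hpos : ∀ θ ∈ Set.Icc δ (Real.pi - δ), 0 < Real.sin θ := fun θ hθ => hs.trans_le (hsin θ hθ)
  let F : ℝ → ℝ := fun θ => -Real.sin (r * Real.cos θ) / (r * Real.sin θ)
  let G : ℝ → ℝ := fun θ => Real.sin (r * Real.cos θ) * Real.cos θ / (r * Real.sin θ ^ 2)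
  have hG : ContinuousOn G (Set.uIcc δ (Real.pi - δ)) := by
    rw [Set.uIcc_of_le hle]
    refine ContinuousOn.div (by fun_prop) (by fun_prop) fun θ hθ => ?_
    have := hpos θ hθ
    positivity
  have hd : ∀ θ ∈ Set.uIcc δ (Real.pi - δ),
      HasDerivAt F (Real.cos (r * Real.cos θ) + G θ) θ := by
    intro θ hθ
    rw [Set.uIcc_of_le hle] at hθ
    have hp := hpos θ hθ
    have h1 : HasDerivAt (fun θ => -Real.sin (r * Real.cos θ))
        (-(Real.cos (r * Real.cos θ) * (r * -Real.sin θ))) θ :=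
      (((Real.hasDerivAt_cos θ).const_mul r).sin).neg
    have h2 : HasDerivAt (fun θ => r * Real.sin θ) (r * Real.cos θ) θ :=
      (Real.hasDerivAt_sin θ).const_mul r
    refine (h1.div h2 (by positivity)).congr_deriv ?_
    simp only [G]
    field_simp
    ring
  have hcont : Continuous fun θ => Real.cos (r * Real.cos θ) := by fun_prop
  have hFTC := intervalIntegral.integral_eq_sub_of_hasDerivAt hd
    ((hcont.continuousOn.add hG).intervalIntegrable)
  rw [intervalIntegral.integral_add (hcont.intervalIntegrable _ _) hG.intervalIntegrable] at hFTC
  have hF : ∀ θ ∈ Set.Icc δ (Real.pi - δ), |F θ| ≤ 1 / (r * Real.sin δ ^ 2) := by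
    intro θ hθ
    have hp := hpos θ hθ
    simp only [F]
    rw [abs_div, abs_neg, abs_of_pos (show 0 < r * Real.sin θ by positivity)]
    have := Real.abs_sin_le_one (r * Real.cos θ)
    have h3 := hsin θ hθ
    gcongr
    nlinarith
  have hGb := intervalIntegral.norm_integral_le_of_norm_le_const (a := δ) (b := Real.pi - δ)
    (C := 1 / (r * Real.sin δ ^ 2)) (f := G) (fun θ hθ => by
      rw [Set.uIoc_of_le hle] at hθ
      have hθ' : θ ∈ Set.Icc δ (Real.pi - δ) := ⟨hθ.1.le, hθ.2⟩
      have hp := hpos θ hθ'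
      simp only [G]
      rw [Real.norm_eq_abs, abs_div, abs_mul, abs_of_pos (show 0 < r * Real.sin θ ^ 2 by positivity)]
      have h1 := Real.abs_sin_le_one (r * Real.cos θ)
      have h2 := Real.abs_cos_le_one θ
      have h3 := hsin θ hθ'
      gcongr
      nlinarith [abs_nonneg (Real.cos θ)])
  rw [Real.norm_eq_abs, abs_of_nonneg (show 0 ≤ Real.pi - δ - δ by linarith)] at hGb
  have hK : 0 ≤ 1 / (r * Real.sin δ ^ 2) := by positivity
  have hGb' : |∫ θ in δ..(Real.pi - δ), G θ| ≤ 1 / (r * Real.sin δ ^ 2) * Real.pi :=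
    hGb.trans (by gcongr; linarith)
  have e1 := hF δ ⟨le_rfl, hle⟩
  have e2 := hF (Real.pi - δ) ⟨hle, le_rfl⟩
  have : (2 + Real.pi) / (r * Real.sin δ ^ 2) = 1 / (r * Real.sin δ ^ 2) + 1 / (r * Real.sin δ ^ 2)
    + 1 / (r * Real.sin δ ^ 2) * Real.pi := by ring
  rw [this]
  rw [abs_le] at *
  constructor <;> linarith [e1.1, e1.2, e2.1, e2.2, hGb'.1, hGb'.2]

/-- Decay of order `r ^ (-1 / 3)`, written with `r = t ^ 3` to avoid roots. It is weaker than the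
true order `r ^ (-1 / 2)` but sufficient. Cutting at distance `δ = 1 / t` from the stationary points
costs `δ` at each end, and the middle contributes at most `24 δ`. -/
theorem abs_besselJ_cube_mul_le {t : ℝ} (ht : 1 ≤ t) : |besselJ (t ^ 3)| * t ≤ 26 := by
  have ht0 : 0 < t := by linarith
  set δ := t⁻¹ with hδ
  have hδ0 : 0 < δ := by positivity
  have hδ1 : δ ≤ 1 := inv_le_one_of_one_le₀ ht
  have hpi := Real.pi_gt_three
  have hpi4 := Real.pi_le_four
  have hs : δ / 2 ≤ Real.sin δ := by
    have := Real.mul_le_sin hδ0.le (by linarith)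
    refine le_trans ?_ this
    rw [div_mul_eq_mul_div, div_le_div_iff₀ (by norm_num) (by positivity)]
    nlinarith
  have h1 := abs_integral_cos_mul_cos_le (r := t ^ 3) (by positivity) hδ0 (by linarith)
  have hb : (2 + Real.pi) / (t ^ 3 * Real.sin δ ^ 2) ≤ 24 * δ := by
    rw [div_le_iff₀ (by have : 0 < Real.sin δ := by linarith
                        positivity)]
    have : (δ / 2) ^ 2 ≤ Real.sin δ ^ 2 := by gcongr
    calc 2 + Real.pi ≤ 6 := by linarith
      _ = 24 * δ * (t ^ 3 * (δ / 2) ^ 2) := by rw [hδ]; field_simp; norm_num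
      _ ≤ _ := by gcongr
  have hc : Continuous fun θ : ℝ => Real.cos (t ^ 3 * Real.cos θ) := by fun_prop
  have hsmall : ∀ a b : ℝ, |∫ θ in a..b, Real.cos (t ^ 3 * Real.cos θ)| ≤ |b - a| := fun a b => by
    have := intervalIntegral.norm_integral_le_of_norm_le_const (a := a) (b := b)
      (C := 1) (f := fun θ => Real.cos (t ^ 3 * Real.cos θ)) (fun θ _ => Real.abs_cos_le_one _)
    simpa using this
  have h2 := hsmall 0 δ
  have h3 := hsmall (Real.pi - δ) Real.pi
  rw [sub_zero, abs_of_pos hδ0] at h2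
  rw [sub_sub_cancel, abs_of_pos hδ0] at h3
  have hsplit : ∫ θ in (0)..Real.pi, Real.cos (t ^ 3 * Real.cos θ)
      = (∫ θ in (0)..δ, Real.cos (t ^ 3 * Real.cos θ))
        + (∫ θ in δ..(Real.pi - δ), Real.cos (t ^ 3 * Real.cos θ))
        + ∫ θ in (Real.pi - δ)..Real.pi, Real.cos (t ^ 3 * Real.cos θ) := by
    rw [intervalIntegral.integral_add_adjacent_intervals (hc.intervalIntegrable _ _)
      (hc.intervalIntegrable _ _), intervalIntegral.integral_add_adjacent_intervals
      (hc.intervalIntegrable _ _) (hc.intervalIntegrable _ _)]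
  have h4 : |∫ θ in (0)..Real.pi, Real.cos (t ^ 3 * Real.cos θ)| ≤ 26 * δ := by
    rw [hsplit]
    refine (abs_add_le _ _).trans ?_
    have := abs_add_le (∫ θ in (0)..δ, Real.cos (t ^ 3 * Real.cos θ))
      (∫ θ in δ..(Real.pi - δ), Real.cos (t ^ 3 * Real.cos θ))
    linarith
  rw [besselJ_eq_pi_inv_mul, abs_mul, abs_of_pos (by positivity)]
  have h5 : Real.pi⁻¹ ≤ 1 := inv_le_one_of_one_le₀ (by linarith)
  calc _ ≤ 1 * (26 * δ) * t := by gcongr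
    _ = 26 := by rw [hδ]; field_simp

theorem abs_besselJ_lt_one {r : ℝ} (hr : 0 < r) : |besselJ r| < 1 := by
  have hc : Continuous fun θ : ℝ => Real.cos (r * Real.cos θ) := by fun_prop
  have hpi := Real.pi_pos
  rw [besselJ_eq_pi_inv_mul, abs_mul, abs_of_pos (by positivity), inv_mul_lt_iff₀ (by positivity),
    abs_lt]
  constructor
  · have := intervalIntegral.integral_lt_integral_of_continuousOn_of_le_of_exists_lt
      (f := fun _ => (-1 : ℝ)) (g := fun θ => Real.cos (r * Real.cos θ)) hpi
      continuousOn_const hc.continuousOn (fun θ _ => Real.neg_one_le_cos _)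
      ⟨Real.pi / 2, ⟨by linarith, by linarith⟩, by simp⟩
    simpa using this
  · have := intervalIntegral.integral_lt_integral_of_continuousOn_of_le_of_exists_lt
      (f := fun θ => Real.cos (r * Real.cos θ)) (g := fun _ => (1 : ℝ)) hpi
      hc.continuousOn continuousOn_const (fun θ _ => Real.cos_le_one _)
      -- At this angle `r cos θ = r / (1 + r)` is positive and at most `1`, so its cosine is
      -- strictly less than `1`.
      ⟨Real.arccos (1 / (1 + r)), ⟨Real.arccos_nonneg _, Real.arccos_le_pi _⟩, by
        have h1 : 1 / (1 + r) ≤ 1 := by rw [div_le_one (by linarith)]; linarith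
        have h2 : 0 < 1 / (1 + r) := by positivity
        rw [Real.cos_arccos (by linarith) h1]
        have h3 : r * (1 / (1 + r)) ≤ 1 := by
          rw [mul_one_div, div_le_one (by linarith)]; linarith
        refine lt_of_le_of_ne (Real.cos_le_one _) fun h => ?_
        have := (Real.cos_eq_one_iff_of_lt_of_lt (by nlinarith) (by nlinarith [Real.pi_gt_three])).1 h
        have : 0 < r * (1 / (1 + r)) := by positivity
        linarith⟩
    simpa using this

/-- Sixth powers turn the decay `r ^ (-1 / 3)` into `r ^ (-2)`. Near zero the Taylor expansion gives
`|J₀| ≤ exp (-r² / 8)`, on a compact range the maximum of `|J₀|` is below `1`, and beyond it the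
decay takes over. Each entry of the minimum defining `a` serves one of these ranges. -/
theorem exists_one_add_mul_sq_mul_besselJ_pow_le :
    ∃ a : ℝ, 0 < a ∧ a ≤ 3 / 4 ∧ ∀ r : ℝ, 0 ≤ r → (1 + a * r ^ 2) * |besselJ r| ^ 6 ≤ 1 := by
  obtain ⟨K, hK⟩ : ∃ K : ℝ, K = 26 ^ 3 := ⟨_, rfl⟩
  have hfar : ∀ r : ℝ, 1 ≤ r → |besselJ r| ^ 6 * r ^ 2 ≤ K ^ 2 := by
    intro r hr
    have hr0 : 0 ≤ r := by linarith
    have h := abs_besselJ_cube_mul_le (t := r ^ (1 / 3 : ℝ)) (Real.one_le_rpow hr (by norm_num))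
    have e : (r ^ (1 / 3 : ℝ)) ^ 3 = r := by
      rw [← Real.rpow_natCast, ← Real.rpow_mul hr0]; norm_num
    have h' := pow_le_pow_left₀ (by positivity) h 6
    rw [mul_pow, show (r ^ (1 / 3 : ℝ)) ^ 6 = ((r ^ (1 / 3 : ℝ)) ^ 3) ^ 2 by ring, e] at h'
    rw [hK]
    norm_num at h' ⊢
    exact h'
  set R : ℝ := 2 * K with hR
  have hR1 : 1 ≤ R := by rw [hR, hK]; norm_num
  obtain ⟨ρ, hρ1, hρ⟩ : ∃ ρ : ℝ, ρ < 1 ∧ ∀ r ∈ Set.Icc (1 / 5 : ℝ) R, |besselJ r| ≤ ρ := by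
    obtain ⟨r₀, hr₀, hmax⟩ := (isCompact_Icc (a := (1 / 5 : ℝ)) (b := R)).exists_isMaxOn
      ⟨1 / 5, le_rfl, by linarith⟩ continuous_besselJ.abs.continuousOn
    exact ⟨_, abs_besselJ_lt_one (by linarith [hr₀.1]), fun r hr => hmax hr⟩
  have hρ0 : 0 ≤ ρ := (abs_nonneg _).trans (hρ 1 ⟨by norm_num, hR1⟩)
  have hρ6 : ρ ^ 6 < 1 := pow_lt_one₀ hρ0 hρ1 (by norm_num)
  have hρ60 : 0 ≤ ρ ^ 6 := by positivity
  refine ⟨min (3 / 4) (min ((1 - ρ ^ 6) / R ^ 2) (1 / (2 * K ^ 2))), ?_, min_le_left _ _, ?_⟩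
  · refine lt_min (by norm_num) (lt_min (div_pos (by linarith) (by positivity)) ?_)
    rw [hK]; positivity
  intro r hr
  set a := min (3 / 4) (min ((1 - ρ ^ 6) / R ^ 2) (1 / (2 * K ^ 2)))
  have a1 : a ≤ 3 / 4 := min_le_left _ _
  have a2 : a ≤ (1 - ρ ^ 6) / R ^ 2 := (min_le_right _ _).trans (min_le_left _ _)
  have a3 : a ≤ 1 / (2 * K ^ 2) := (min_le_right _ _).trans (min_le_right _ _)
  have hj := abs_nonneg (besselJ r)
  by_cases h1 : r ≤ 1 / 5
  · have ht := abs_le.1 (abs_besselJ_sub_le r)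
    have hr2 : r ^ 2 ≤ 1 / 25 := by nlinarith
    have hJ : |besselJ r| ≤ Real.exp (-r ^ 2 / 8) := by
      have := Real.add_one_le_exp (-r ^ 2 / 8)
      rw [abs_le]
      constructor <;> nlinarith [sq_nonneg r]
    have hJ6 : |besselJ r| ^ 6 ≤ Real.exp (-(3 / 4 * r ^ 2)) := by
      refine (pow_le_pow_left₀ hj hJ 6).trans (le_of_eq ?_)
      rw [← Real.exp_nat_mul]
      congr 1
      push_cast
      ring
    have : 1 + a * r ^ 2 ≤ Real.exp (3 / 4 * r ^ 2) := by
      have := Real.add_one_le_exp (3 / 4 * r ^ 2)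
      nlinarith [sq_nonneg r]
    calc _ ≤ Real.exp (3 / 4 * r ^ 2) * Real.exp (-(3 / 4 * r ^ 2)) := by gcongr
      _ = 1 := by rw [← Real.exp_add]; simp
  · push Not at h1
    by_cases h2 : r ≤ R
    · have hJ6 := pow_le_pow_left₀ hj (hρ r ⟨h1.le, h2⟩) 6
      have : a * r ^ 2 ≤ 1 - ρ ^ 6 := by
        calc a * r ^ 2 ≤ (1 - ρ ^ 6) / R ^ 2 * R ^ 2 := by gcongr
          _ = _ := by field_simp
      calc _ ≤ (1 + (1 - ρ ^ 6)) * ρ ^ 6 := by gcongr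
        _ ≤ 1 := by nlinarith [sq_nonneg (1 - ρ ^ 6)]
    · push Not at h2
      have hf := hfar r (by linarith)
      have hKpos : 0 < K := by rw [hK]; norm_num
      have h4 : a * (|besselJ r| ^ 6 * r ^ 2) ≤ 1 / 2 := by
        calc _ ≤ 1 / (2 * K ^ 2) * K ^ 2 := by gcongr
          _ = 1 / 2 := by field_simp
      have h5 : |besselJ r| ^ 6 ≤ 1 / 2 := by
        have : R ^ 2 ≤ r ^ 2 := by gcongr
        have h6 : |besselJ r| ^ 6 * R ^ 2 ≤ K ^ 2 := by
          refine le_trans ?_ hf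
          gcongr
        rw [hR] at h6
        have hK2 : 0 < K ^ 2 := by positivity
        nlinarith
      nlinarith

/-! ### A common polynomial bound for powers, and its moments -/

/-- Powers of the characteristic function of a step and of the Gaussian that approximates it have
a common rapidly decreasing bound. -/
theorem exists_pow_le_inv :
    ∃ c : ℝ, 0 < c ∧ ∀ N : ℕ, 24 ≤ N → ∀ r : ℝ, 0 ≤ r →
      |besselJ r| ^ N ≤ ((1 + c * N * r ^ 2) ^ 4)⁻¹ ∧
      Real.exp (-r ^ 2 / 4) ^ N ≤ ((1 + c * N * r ^ 2) ^ 4)⁻¹ := by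
  obtain ⟨a, ha, ha', h⟩ := exists_one_add_mul_sq_mul_besselJ_pow_le
  refine ⟨a / 48, by positivity, fun N hN r hr => ?_⟩
  have key : ∀ y : ℝ, 0 ≤ y → y ≤ 1 → (1 + a * r ^ 2) * y ^ 6 ≤ 1 →
      y ^ N ≤ ((1 + a / 48 * N * r ^ 2) ^ 4)⁻¹ := by
    intro y hy hy1 hy6
    -- The factor 24 is 6 for the power that admits a quadratic bound times 4 for the desired decay.
    -- Bernoulli's inequality then makes the `q`-th power linear in `q`, and rounding down costs at
    -- most a factor 2 because `N ≥ 24`; hence the `48`.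
    set q := N / 24 with hq
    have hq1 : 24 * q ≤ N := Nat.mul_div_le N 24
    have hq2 : (N : ℝ) / 48 ≤ q := by
      have : N ≤ 48 * q := by omega
      have : (N : ℝ) ≤ 48 * q := by exact_mod_cast this
      linarith
    have hpos : 0 < 1 + a * r ^ 2 := by positivity
    have b1 : y ^ N ≤ (y ^ 6) ^ (4 * q) := by
      rw [← pow_mul]
      exact pow_le_pow_of_le_one hy hy1 (by omega)
    have b2 : y ^ 6 ≤ (1 + a * r ^ 2)⁻¹ := by
      rw [← one_div, le_div_iff₀ hpos]; linarith
    have b3 : 1 + a / 48 * N * r ^ 2 ≤ (1 + a * r ^ 2) ^ q := by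
      have := one_add_mul_le_pow (a := a * r ^ 2) (by nlinarith [sq_nonneg r, mul_nonneg ha.le (sq_nonneg r)]) q
      refine le_trans ?_ this
      have : 0 ≤ a * r ^ 2 := by positivity
      nlinarith
    calc y ^ N ≤ (y ^ 6) ^ (4 * q) := b1
      _ ≤ ((1 + a * r ^ 2)⁻¹) ^ (4 * q) := by gcongr
      _ = (((1 + a * r ^ 2) ^ q) ^ 4)⁻¹ := by rw [inv_pow, ← pow_mul, mul_comm q 4]
      _ ≤ _ := by gcongr
  refine ⟨key _ (abs_nonneg _) (abs_besselJ_le_one r) (h r hr), key _ (Real.exp_pos _).le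
    (Real.exp_le_one_iff.2 (by nlinarith [sq_nonneg r])) ?_⟩
  rw [← Real.exp_nat_mul]
  have h1 := Real.add_one_le_exp (3 / 2 * r ^ 2)
  calc _ ≤ Real.exp (3 / 2 * r ^ 2) * Real.exp ((6 : ℕ) * (-r ^ 2 / 4)) := by
        gcongr; nlinarith [sq_nonneg r]
    _ = 1 := by rw [← Real.exp_add]; push_cast; ring_nf; simp

/-- Three moments are used: `k = 0` for integrability, `k = 1` for the oscillation of the Fourier
kernel, `k = 2` for the fourth-order difference between `J₀` and the Gaussian. After the largest of
them a decay of order `‖η‖ ^ (-4)` is left, which is integrable in the plane. -/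
theorem integrable_norm_pow_mul_inv {k : ℕ} (hk : k ≤ 2) :
    Integrable fun η : ℂ => ‖η‖ ^ (2 * k) * ((1 + ‖η‖ ^ 2) ^ 4)⁻¹ := by
  have h := integrable_rpow_neg_one_add_norm_sq (E := ℂ) (μ := volume) (r := 4)
    (by rw [Complex.finrank_real_complex]; norm_num)
  refine h.mono' (Continuous.aestronglyMeasurable ?_) (Eventually.of_forall fun η => ?_)
  · exact (by fun_prop : Continuous fun η : ℂ => ‖η‖ ^ (2 * k)).mul
      (Continuous.inv₀ (by fun_prop) fun η => by positivity)
  · rw [Real.norm_of_nonneg (by positivity), show (-4 / 2 : ℝ) = -((2 : ℕ) : ℝ) by norm_num,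
      Real.rpow_neg (by positivity), Real.rpow_natCast]
    have h1 : ‖η‖ ^ (2 * k) ≤ (1 + ‖η‖ ^ 2) ^ 2 := by
      rw [pow_mul]
      calc (‖η‖ ^ 2) ^ k ≤ (1 + ‖η‖ ^ 2) ^ k := by gcongr; linarith
        _ ≤ _ := pow_le_pow_right₀ (by nlinarith [sq_nonneg ‖η‖]) hk
    calc _ ≤ (1 + ‖η‖ ^ 2) ^ 2 * ((1 + ‖η‖ ^ 2) ^ 4)⁻¹ := by gcongr
      _ = _ := by field_simp

/-- Scaling by `√A`: the Jacobian gives one factor `A⁻¹` and the moment gives `k` more. With `A`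
proportional to `N`, this produces the rate in the local limit theorem. -/
theorem integral_norm_pow_mul_inv {A : ℝ} (hA : 0 < A) (k : ℕ) :
    ∫ η : ℂ, ‖η‖ ^ (2 * k) * ((1 + A * ‖η‖ ^ 2) ^ 4)⁻¹
      = (A ^ (k + 1))⁻¹ * ∫ η : ℂ, ‖η‖ ^ (2 * k) * ((1 + ‖η‖ ^ 2) ^ 4)⁻¹ := by
  have h := Measure.integral_comp_smul_of_nonneg (volume : Measure ℂ)
    (fun η : ℂ => ‖η‖ ^ (2 * k) * ((1 + ‖η‖ ^ 2) ^ 4)⁻¹) (√A) (hR := Real.sqrt_nonneg A)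
  rw [Complex.finrank_real_complex, Real.sq_sqrt hA.le, smul_eq_mul] at h
  have h2 : ∀ η : ℂ, ‖√A • η‖ ^ (2 * k) * ((1 + ‖√A • η‖ ^ 2) ^ 4)⁻¹
      = A ^ k * (‖η‖ ^ (2 * k) * ((1 + A * ‖η‖ ^ 2) ^ 4)⁻¹) := fun η => by
    rw [norm_smul, Real.norm_of_nonneg (Real.sqrt_nonneg A), mul_pow, mul_pow, pow_mul √A,
      Real.sq_sqrt hA.le]
    ring
  simp_rw [h2] at h
  rw [integral_const_mul] at h
  rw [pow_succ, mul_inv, mul_assoc, ← h]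
  field_simp

theorem integrable_norm_pow_mul_inv' {A : ℝ} (hA : 0 < A) {k : ℕ} (hk : k ≤ 2) :
    Integrable fun η : ℂ => ‖η‖ ^ (2 * k) * ((1 + A * ‖η‖ ^ 2) ^ 4)⁻¹ := by
  have h := (integrable_comp_smul_iff (volume : Measure ℂ)
    (fun η : ℂ => ‖η‖ ^ (2 * k) * ((1 + ‖η‖ ^ 2) ^ 4)⁻¹) (R := √A)
    (Real.sqrt_pos.2 hA).ne').2 (integrable_norm_pow_mul_inv hk)
  refine (h.const_mul (A ^ k)⁻¹).congr (Eventually.of_forall fun η => ?_)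
  simp only
  rw [norm_smul, Real.norm_of_nonneg (Real.sqrt_nonneg A), mul_pow, mul_pow, pow_mul √A,
      Real.sq_sqrt hA.le]
  field_simp

theorem integrable_besselJ_pow {N : ℕ} (hN : 24 ≤ N) :
    Integrable fun η : ℂ => besselJ ‖η‖ ^ N := by
  obtain ⟨c, hc, h⟩ := exists_pow_le_inv
  have hN0 : (0 : ℝ) < N := by exact_mod_cast (by omega : 0 < N)
  have h0 := integrable_norm_pow_mul_inv' (A := c * N) (by positivity) (k := 0) (by norm_num)
  refine h0.mono' (Continuous.aestronglyMeasurable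
    ((continuous_besselJ.comp continuous_norm).pow N)) (Eventually.of_forall fun η => ?_)
  rw [norm_pow, Real.norm_eq_abs]
  simpa using (h N hN ‖η‖ (norm_nonneg _)).1

/-! ### Approximation of the density of an `N`-step walk -/

theorem re_fourier_ofReal {f : ℂ → ℝ} (hf : Integrable f) (x : ℂ) :
    (𝓕 (fun η => (f η : ℂ)) x).re = ∫ η, Real.cos (2 * Real.pi * inner ℝ η x) * f η := by
  rw [Real.fourier_eq', ← RCLike.re_eq_complex_re, ← integral_re]
  · congr 1 with η
    rw [smul_eq_mul, RCLike.re_eq_complex_re, Complex.re_mul_ofReal, Complex.exp_ofReal_mul_I_re,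
      mul_assoc, neg_mul, Real.cos_neg, mul_assoc]
  · have := (Real.fourierIntegral_convergent_iff (μ := (volume : Measure ℂ))
      (f := fun η => (f η : ℂ)) x).2 hf.ofReal
    refine this.congr (Eventually.of_forall fun η => ?_)
    simp only [Real.fourierChar_apply, Circle.smul_def]
    congr 3
    push_cast
    ring

/-- The analytic part of the local limit theorem: uniform approximation of the density of the
end point of an `N`-step walk, with a rate. -/
theorem exists_abs_re_fourier_besselJ_pow_sub_le :
    ∃ C : ℝ, 0 < C ∧ ∀ N : ℕ, 25 ≤ N → ∀ x : ℂ,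
      |(𝓕 (fun η : ℂ => ((besselJ ‖(2 * Real.pi) • η‖ ^ N : ℝ) : ℂ)) x).re - 1 / (Real.pi * N)|
        ≤ C * (1 + ‖x‖ ^ 2) / N ^ 2 := by
  obtain ⟨c, hc, hdecay⟩ := exists_pow_le_inv
  have hpi := Real.pi_pos
  set K : ℕ → ℝ := fun k => ∫ η : ℂ, ‖η‖ ^ (2 * k) * ((1 + ‖η‖ ^ 2) ^ 4)⁻¹ with hKdef
  have hK0 : ∀ k, 0 ≤ K k := fun k => integral_nonneg fun η => by positivity
  -- The factor `1 / 2` allows for the exponent `N - 1` that appears when a difference of `N`-th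
  -- powers is bounded by the difference of the bases; this also explains `25` in place of `24`.
  set b : ℝ := c * (2 * Real.pi) ^ 2 / 2 with hb
  have hb0 : 0 < b := by positivity
  set C₁ := 4 * (2 * Real.pi) ^ 4 * K 2 / b ^ 3 with hC₁
  set C₂ := (2 * Real.pi) ^ 2 * K 1 / (2 * b ^ 2) with hC₂
  have h1 : 0 ≤ C₁ := by have := hK0 2; positivity
  have h2 : 0 ≤ C₂ := by have := hK0 1; positivity
  refine ⟨C₁ + C₂ + 1, by linarith, fun N hN x => ?_⟩
  have hN0 : (0 : ℝ) < N := by exact_mod_cast (by omega : 0 < N)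
  set A : ℝ := b * N with hA
  have hA0 : 0 < A := by positivity
  set w : ℂ → ℝ := fun η => ((1 + A * ‖η‖ ^ 2) ^ 4)⁻¹ with hw
  set f : ℂ → ℝ := fun η => besselJ ‖(2 * Real.pi) • η‖ ^ N with hf
  set g : ℂ → ℝ := fun η => Real.exp (-(Real.pi ^ 2 * N) * ‖η‖ ^ 2) with hg
  have hnorm : ∀ η : ℂ, ‖(2 * Real.pi) • η‖ = 2 * Real.pi * ‖η‖ := fun η => by
    rw [norm_smul, Real.norm_of_nonneg (by positivity)]
  have hgpow : ∀ η : ℂ, g η = Real.exp (-(2 * Real.pi * ‖η‖) ^ 2 / 4) ^ N := fun η => by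
    rw [← Real.exp_nat_mul]
    simp only [hg]
    congr 1
    ring
  have hwle : ∀ η : ℂ, ∀ M : ℕ, (N : ℝ) / 2 ≤ M →
      ((1 + c * M * (2 * Real.pi * ‖η‖) ^ 2) ^ 4)⁻¹ ≤ w η := fun η M hM => by
    simp only [hw]
    have hle : A * ‖η‖ ^ 2 ≤ c * M * (2 * Real.pi * ‖η‖) ^ 2 := by
      rw [hA, hb]
      calc c * (2 * Real.pi) ^ 2 / 2 * N * ‖η‖ ^ 2
          = c * (N / 2) * (2 * Real.pi * ‖η‖) ^ 2 := by ring
        _ ≤ _ := by gcongr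
    gcongr
  have hgw : ∀ η, g η ≤ w η := fun η => by
    rw [hgpow]
    exact (hdecay N (by omega) _ (by positivity)).2.trans (hwle η N (by linarith))
  have hfg : ∀ η, |f η - g η| ≤ 4 * (2 * Real.pi) ^ 4 * N * (‖η‖ ^ (2 * 2) * w η) := fun η => by
    rw [hgpow, hf]
    simp only [hnorm]
    set r := 2 * Real.pi * ‖η‖ with hr
    have hr0 : 0 ≤ r := by positivity
    have hmax : max |besselJ r| |Real.exp (-r ^ 2 / 4)| ^ (N - 1) ≤ w η := by
      have hM : (N : ℝ) / 2 ≤ (N - 1 : ℕ) := by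
        rw [Nat.cast_sub (by omega)]
        have : (25 : ℝ) ≤ N := by exact_mod_cast hN
        push_cast; linarith
      have := hdecay (N - 1) (by omega) r hr0
      rcases max_cases |besselJ r| |Real.exp (-r ^ 2 / 4)| with h | h
      · rw [h.1]; exact this.1.trans (hwle η _ hM)
      · rw [h.1, abs_of_pos (Real.exp_pos _)]; exact this.2.trans (hwle η _ hM)
    calc _ ≤ _ := abs_pow_sub_pow_le _ _ N
      _ ≤ 4 * r ^ 4 * N * w η := by
        gcongr
        exact abs_besselJ_sub_exp_le r
      _ = _ := by rw [hr]; ring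
  have hif : Integrable f :=
    (integrable_comp_smul_iff (volume : Measure ℂ) (fun η : ℂ => besselJ ‖η‖ ^ N)
      (R := 2 * Real.pi) (by positivity)).2 (integrable_besselJ_pow (by omega))
  have hiw : ∀ k ≤ 2, Integrable fun η : ℂ => ‖η‖ ^ (2 * k) * w η := fun k hk =>
    integrable_norm_pow_mul_inv' hA0 hk
  have hig : Integrable g := by
    refine (hiw 0 (by norm_num)).mono' (Continuous.aestronglyMeasurable (by fun_prop))
      (Eventually.of_forall fun η => ?_)
    rw [Real.norm_of_nonneg (Real.exp_pos _).le]
    simpa only [mul_zero, pow_zero, one_mul] using hgw η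
  have hG : ∫ η, g η = 1 / (Real.pi * N) := by
    rw [hg, GaussianFourier.integral_rexp_neg_mul_sq_norm (by positivity),
      Complex.finrank_real_complex]
    norm_num
    field_simp
  rw [re_fourier_ofReal hif, ← hG, ← integral_sub _ hig]
  swap
  · refine hif.bdd_mul (c := 1) (Continuous.aestronglyMeasurable (by fun_prop))
      (Eventually.of_forall fun η => ?_)
    exact Real.abs_cos_le_one _
  -- Splitting `t f - g = t (f - g) + (t - 1) g` separates the Gaussian approximation, of size `N
  -- ‖η‖⁴`, from the oscillation of the kernel, of size `‖x‖² ‖η‖²`. Against the weight `w` they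
  -- integrate to `N * N⁻³` and `‖x‖² N⁻²`.
  have hpoint : ∀ η : ℂ, ‖Real.cos (2 * Real.pi * inner ℝ η x) * f η - g η‖
      ≤ 4 * (2 * Real.pi) ^ 4 * N * (‖η‖ ^ (2 * 2) * w η)
        + (2 * Real.pi) ^ 2 * ‖x‖ ^ 2 / 2 * (‖η‖ ^ (2 * 1) * w η) := fun η => by
    set t := Real.cos (2 * Real.pi * inner ℝ η x) with ht
    have e1 : |t - 1| ≤ (2 * Real.pi) ^ 2 * ‖x‖ ^ 2 / 2 * ‖η‖ ^ (2 * 1) := by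
      have h := Real.one_sub_sq_div_two_le_cos (x := 2 * Real.pi * inner ℝ η x)
      have h' := Real.cos_le_one (2 * Real.pi * inner ℝ η x)
      have hin : (inner ℝ η x : ℝ) ^ 2 ≤ (‖η‖ * ‖x‖) ^ 2 := by
        rw [← sq_abs]
        gcongr
        exact abs_real_inner_le_norm η x
      rw [abs_sub_comm, abs_of_nonneg (by linarith)]
      have : (2 * Real.pi) ^ 2 * (inner ℝ η x : ℝ) ^ 2 ≤ (2 * Real.pi) ^ 2 * (‖η‖ * ‖x‖) ^ 2 := by
        gcongr
      nlinarith
    have e2 : |t| ≤ 1 := Real.abs_cos_le_one _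
    have e3 : 0 ≤ g η := (Real.exp_pos _).le
    calc ‖t * f η - g η‖ = |t * (f η - g η) + (t - 1) * g η| := by
          rw [Real.norm_eq_abs]; congr 1; ring
      _ ≤ |t * (f η - g η)| + |(t - 1) * g η| := abs_add_le _ _
      _ = |t| * |f η - g η| + |t - 1| * g η := by rw [abs_mul, abs_mul, abs_of_nonneg e3]
      _ ≤ 1 * (4 * (2 * Real.pi) ^ 4 * N * (‖η‖ ^ (2 * 2) * w η))
          + (2 * Real.pi) ^ 2 * ‖x‖ ^ 2 / 2 * ‖η‖ ^ (2 * 1) * w η := by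
        gcongr
        · exact hfg η
        · exact hgw η
      _ = _ := by ring
  rw [← Real.norm_eq_abs]
  refine (norm_integral_le_of_norm_le (((hiw 2 le_rfl).const_mul _).add
    ((hiw 1 (by norm_num)).const_mul _)) (Eventually.of_forall hpoint)).trans ?_
  rw [integral_add' ((hiw 2 le_rfl).const_mul _) ((hiw 1 (by norm_num)).const_mul _)]
  rw [integral_const_mul, integral_const_mul, integral_norm_pow_mul_inv hA0,
    integral_norm_pow_mul_inv hA0]
  change 4 * (2 * Real.pi) ^ 4 * N * ((A ^ (2 + 1))⁻¹ * K 2)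
    + (2 * Real.pi) ^ 2 * ‖x‖ ^ 2 / 2 * ((A ^ (1 + 1))⁻¹ * K 1) ≤ _
  calc _ = (C₁ + C₂ * ‖x‖ ^ 2) / N ^ 2 := by
        rw [hC₁, hC₂, hA]
        simp only [mul_pow]
        field_simp
        ring
    _ ≤ _ := by
        gcongr
        nlinarith [sq_nonneg ‖x‖]

/-! ### From characteristic functions to densities -/

theorem charFun_smul_eq_integral_fourierChar (α : Measure ℂ) (η : ℂ) :
    charFun α ((2 * Real.pi) • η) = ∫ x, ((Real.fourierChar (inner ℝ η x) : Circle) : ℂ) ∂α := by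
  rw [charFun_apply]
  congr 1 with x
  rw [Real.fourierChar_apply, inner_smul_right, real_inner_comm]

/-- A finite measure with an integrable characteristic function has a density, the Fourier
transform of that function: the formula on smooth test functions. -/
theorem integral_eq_integral_mul_re_fourier_charFun {α : Measure ℂ} [IsFiniteMeasure α]
    (hα : Integrable fun η : ℂ => charFun α ((2 * Real.pi) • η)) {g : ℂ → ℝ}
    (hg : ContDiff ℝ (⊤ : ℕ∞) g) (hg' : HasCompactSupport g) :
    ∫ x, g x ∂α
      = ∫ x, g x * (𝓕 (fun η : ℂ => charFun α ((2 * Real.pi) • η)) x).re := by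
  set Φ : ℂ → ℂ := fun η => charFun α ((2 * Real.pi) • η) with hΦ
  have hgc : ContDiff ℝ (⊤ : ℕ∞) fun x => (g x : ℂ) := Complex.ofRealCLM.contDiff.comp hg
  have hgc' : HasCompactSupport fun x => (g x : ℂ) := hg'.comp_left (g := Complex.ofReal) rfl
  set G : SchwartzMap ℂ ℂ := hgc'.toSchwartzMap hgc with hG
  have hGx : ∀ x, G x = (g x : ℂ) := fun x => rfl
  have e1 : ∫ x, G x ∂α = ∫ η, (𝓕 G) η • Φ η := by
    have hf : Integrable (𝓕 G : SchwartzMap ℂ ℂ) := (𝓕 G : SchwartzMap ℂ ℂ).integrable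
    -- Fubini between `volume` and `α`. With the negated pairing, the transform of `𝓕 G` is the
    -- inverse one and returns `G`, while the transform of the constant `1` against `α` is the
    -- characteristic function.
    have h := VectorFourier.integral_fourierIntegral_smul_eq_flip (μ := (volume : Measure ℂ))
      (ν := α) (L := -innerₗ ℂ) (f := (𝓕 G : SchwartzMap ℂ ℂ)) (g := fun _ => (1 : ℂ))
      Real.continuous_fourierChar (by
        simp only [LinearMap.neg_apply, innerₗ_apply_apply]; fun_prop) hf
      (integrable_const _)
    have hl : ∀ x, VectorFourier.fourierIntegral Real.fourierChar volume (-innerₗ ℂ)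
        (𝓕 G : SchwartzMap ℂ ℂ) x = G x := fun x => by
      have : (𝓕⁻ (𝓕 G : SchwartzMap ℂ ℂ) : SchwartzMap ℂ ℂ) x = G x := by simp
      rw [← this, SchwartzMap.fourierInv_coe, Real.fourierInv_eq]
      simp [VectorFourier.fourierIntegral]
    have hr : ∀ η, VectorFourier.fourierIntegral Real.fourierChar α (-innerₗ ℂ).flip
        (fun _ => (1 : ℂ)) η = Φ η := fun η => by
      simp only [hΦ]
      rw [charFun_smul_eq_integral_fourierChar]
      simp [VectorFourier.fourierIntegral, Circle.smul_def]
    simp_rw [hl, hr] at h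
    simpa using h
  have e2 : ∫ η, (𝓕 G) η • Φ η = ∫ x, G x • 𝓕 Φ x := by
    have h := VectorFourier.integral_fourierIntegral_smul_eq_flip (μ := (volume : Measure ℂ))
      (ν := (volume : Measure ℂ)) (L := innerₗ ℂ) (f := G) (g := Φ)
      Real.continuous_fourierChar (by simp only [innerₗ_apply_apply]; fun_prop) G.integrable hα
    rw [flip_innerₗ] at h
    exact h
  have hcont : Continuous (𝓕 Φ) :=
    VectorFourier.fourierIntegral_continuous Real.continuous_fourierChar
      (by simp only [innerₗ_apply_apply]; fun_prop) hα
  have e3 : ∫ x, G x ∂α = ((∫ x, g x ∂α : ℝ) : ℂ) := integral_ofReal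
  rw [e2, e3] at e1
  have e4 := congrArg Complex.re e1
  rw [Complex.ofReal_re, ← RCLike.re_eq_complex_re, ← integral_re] at e4
  · rw [e4]
    congr 1 with x
    rw [hGx, smul_eq_mul, RCLike.re_eq_complex_re, Complex.re_ofReal_mul]
  · refine Continuous.integrable_of_hasCompactSupport (by fun_prop) ?_
    exact hgc'.mul_right

/-- Comparison of two measures on an open set by means of smooth test functions. -/
theorem measure_le_of_forall_integral_le {α β : Measure ℂ} [IsFiniteMeasureOnCompacts α]
    [IsFiniteMeasureOnCompacts β] {U : Set ℂ} (hU : IsOpen U)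
    (h : ∀ g : ℂ → ℝ, ContDiff ℝ (⊤ : ℕ∞) g → HasCompactSupport g → (∀ x, 0 ≤ g x) →
      (∀ x ∉ U, g x = 0) → ∫ x, g x ∂α ≤ ∫ x, g x ∂β)
    {B : Set ℂ} (hB : MeasurableSet B) (hBU : B ⊆ U) : α B ≤ β B := by
  -- Inner regularity of `α` and outer regularity of `β` reduce the claim to a compact set inside an
  -- open one, between which a smooth bump function fits.
  rw [hB.measure_eq_iSup_isCompact]
  refine iSup_le fun K => iSup_le fun hKB => iSup_le fun hK => ?_
  refine le_trans ?_ (measure_mono hKB)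
  rw [K.measure_eq_iInf_isOpen β]
  refine le_iInf fun V => le_iInf fun hKV => le_iInf fun hV => ?_
  obtain ⟨T, hT, hKT, hTV⟩ := exists_compact_between hK (hV.inter hU)
    (Set.subset_inter hKV (hKB.trans hBU))
  obtain ⟨g, hg1, hg0, hg⟩ := exists_contMDiffMap_one_nhds_of_subset_interior
    (modelWithCornersSelf ℝ ℂ) (n := (⊤ : ℕ∞)) hK.isClosed hKT
  have hgd : ContDiff ℝ (⊤ : ℕ∞) g := g.contMDiff.contDiff
  have hgs : HasCompactSupport g := HasCompactSupport.intro hT hg0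
  have hcmp := h g hgd hgs (fun x => (hg x).1) fun x hx => hg0 x fun hxT => hx (hTV hxT).2
  have hiα : Integrable g α := hgd.continuous.integrable_of_hasCompactSupport hgs
  have hiβ : Integrable g β := hgd.continuous.integrable_of_hasCompactSupport hgs
  have l1 : α K ≤ ENNReal.ofReal (∫ x, g x ∂α) := by
    rw [ofReal_integral_eq_lintegral_ofReal hiα (Eventually.of_forall fun x => (hg x).1),
      ← lintegral_indicator_one hK.measurableSet]
    refine lintegral_mono fun x => ?_
    by_cases hx : x ∈ K
    · simp [hx, hg1.self_of_nhdsSet x hx]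
    · simp [hx]
  have l2 : ENNReal.ofReal (∫ x, g x ∂β) ≤ β V := by
    rw [ofReal_integral_eq_lintegral_ofReal hiβ (Eventually.of_forall fun x => (hg x).1),
      ← lintegral_indicator_one hV.measurableSet]
    refine lintegral_mono fun x => ?_
    by_cases hx : x ∈ V
    · simpa [hx] using (hg x).2
    · have : g x = 0 := hg0 x fun hxT => hx (hTV hxT).1
      simp [hx, this]
  exact l1.trans ((ENNReal.ofReal_le_ofReal hcmp).trans l2)

/-- If the Fourier transform of an integrable characteristic function is at most `c` on an open
set, so is the density of the measure there. -/
theorem measure_le_of_re_fourier_charFun_le {α : Measure ℂ} [IsFiniteMeasure α]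
    (hα : Integrable fun η : ℂ => charFun α ((2 * Real.pi) • η)) {U : Set ℂ} (hU : IsOpen U)
    {c : ℝ} (hc : 0 ≤ c)
    (h : ∀ x ∈ U, (𝓕 (fun η : ℂ => charFun α ((2 * Real.pi) • η)) x).re ≤ c)
    {B : Set ℂ} (hB : MeasurableSet B) (hBU : B ⊆ U) : α B ≤ ENNReal.ofReal c * volume B := by
  have hcont : Continuous (𝓕 (fun η : ℂ => charFun α ((2 * Real.pi) • η))) :=
    VectorFourier.fourierIntegral_continuous Real.continuous_fourierChar
      (by simp only [innerₗ_apply_apply]; fun_prop) hα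
  have : IsFiniteMeasureOnCompacts (ENNReal.ofReal c • (volume : Measure ℂ)) :=
    IsFiniteMeasureOnCompacts.smul volume ENNReal.ofReal_ne_top
  have := measure_le_of_forall_integral_le (α := α) (β := ENNReal.ofReal c • volume) hU
    (fun g hg hg' hg0 hgU => by
      rw [integral_eq_integral_mul_re_fourier_charFun hα hg hg', integral_smul_measure,
        ENNReal.toReal_ofReal hc, smul_eq_mul, ← integral_const_mul]
      refine integral_mono ?_ ((hg.continuous.integrable_of_hasCompactSupport hg').const_mul c)
        fun x => ?_
      · have := hg.continuous
        exact Continuous.integrable_of_hasCompactSupport (by fun_prop) hg'.mul_right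
      · by_cases hx : x ∈ U
        · simp only
          rw [mul_comm c]
          exact mul_le_mul_of_nonneg_left (h x hx) (hg0 x)
        · simp [hgU x hx]) hB hBU
  simpa using this

/-- No sign of `c` is required, because `ENNReal.ofReal` makes a negative bound trivial; the factor
`1 - D / N` of the local limit theorem is negative for small `N`. -/
theorem le_measure_of_le_re_fourier_charFun {α : Measure ℂ} [IsFiniteMeasure α]
    (hα : Integrable fun η : ℂ => charFun α ((2 * Real.pi) • η)) {U : Set ℂ} (hU : IsOpen U)
    {c : ℝ}
    (h : ∀ x ∈ U, c ≤ (𝓕 (fun η : ℂ => charFun α ((2 * Real.pi) • η)) x).re)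
    {B : Set ℂ} (hB : MeasurableSet B) (hBU : B ⊆ U) : ENNReal.ofReal c * volume B ≤ α B := by
  rcases le_or_gt c 0 with hc | hc
  · simp [ENNReal.ofReal_of_nonpos hc]
  have hcont : Continuous (𝓕 (fun η : ℂ => charFun α ((2 * Real.pi) • η))) :=
    VectorFourier.fourierIntegral_continuous Real.continuous_fourierChar
      (by simp only [innerₗ_apply_apply]; fun_prop) hα
  have : IsFiniteMeasureOnCompacts (ENNReal.ofReal c • (volume : Measure ℂ)) :=
    IsFiniteMeasureOnCompacts.smul volume ENNReal.ofReal_ne_top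
  have := measure_le_of_forall_integral_le (β := α) (α := ENNReal.ofReal c • volume) hU
    (fun g hg hg' hg0 hgU => by
      rw [integral_eq_integral_mul_re_fourier_charFun hα hg hg', integral_smul_measure,
        ENNReal.toReal_ofReal hc.le, smul_eq_mul, ← integral_const_mul]
      refine integral_mono ((hg.continuous.integrable_of_hasCompactSupport hg').const_mul c) ?_
        fun x => ?_
      · have := hg.continuous
        exact Continuous.integrable_of_hasCompactSupport (by fun_prop) hg'.mul_right
      · by_cases hx : x ∈ U
        · simp only
          rw [mul_comm c]
          exact mul_le_mul_of_nonneg_left (h x hx) (hg0 x)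
        · simp [hgU x hx]) hB hBU
  simpa using this

/-- The local limit theorem, as a comparison of measures near the origin. -/
theorem exists_local_limit :
    ∃ D : ℝ, 0 < D ∧ ∀ N : ℕ, 25 ≤ N → ∀ α : Measure ℂ, IsFiniteMeasure α →
      (∀ ξ, charFun α ξ = (besselJ ‖ξ‖ : ℂ) ^ N) →
      ∀ B : Set ℂ, MeasurableSet B → B ⊆ Metric.ball 0 4 →
        ENNReal.ofReal (1 / (Real.pi * N) * (1 - D / N)) * volume B ≤ α B ∧
        α B ≤ ENNReal.ofReal (1 / (Real.pi * N) * (1 + D / N)) * volume B := by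
  obtain ⟨C, hC, h⟩ := exists_abs_re_fourier_besselJ_pow_sub_le
  -- `17 = 1 + 4²` bounds `1 + ‖x‖²` on the ball, and `π` converts the absolute error into one
  -- relative to `1 / (π N)`.
  refine ⟨Real.pi * (C * 17), by positivity, fun N hN α hα hchar B hB hBU => ?_⟩
  have hN0 : (0 : ℝ) < N := by exact_mod_cast (by omega : 0 < N)
  have hpi := Real.pi_pos
  have hfun : (fun η : ℂ => charFun α ((2 * Real.pi) • η))
      = fun η : ℂ => ((besselJ ‖(2 * Real.pi) • η‖ ^ N : ℝ) : ℂ) := by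
    ext η; rw [hchar]; push_cast; rfl
  have hint : Integrable fun η : ℂ => charFun α ((2 * Real.pi) • η) := by
    rw [hfun]
    exact ((integrable_comp_smul_iff (volume : Measure ℂ) (fun η : ℂ => besselJ ‖η‖ ^ N)
      (R := 2 * Real.pi) (by positivity)).2 (integrable_besselJ_pow (by omega))).ofReal
  have hb : ∀ x ∈ Metric.ball (0 : ℂ) 4,
      |(𝓕 (fun η : ℂ => charFun α ((2 * Real.pi) • η)) x).re - 1 / (Real.pi * N)|
        ≤ C * 17 / N ^ 2 := fun x hx => by
    rw [hfun]
    refine (h N hN x).trans ?_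
    have : ‖x‖ < 4 := by simpa using hx
    gcongr
    nlinarith [norm_nonneg x]
  have e1 : 1 / (Real.pi * N) * (1 - Real.pi * (C * 17) / N)
      = 1 / (Real.pi * N) - C * 17 / N ^ 2 := by field_simp
  have e2 : 1 / (Real.pi * N) * (1 + Real.pi * (C * 17) / N)
      = 1 / (Real.pi * N) + C * 17 / N ^ 2 := by field_simp
  constructor
  · refine le_measure_of_le_re_fourier_charFun hint Metric.isOpen_ball (fun x hx => ?_) hB hBU
    rw [e1]
    linarith [(abs_le.1 (hb x hx)).1]
  · refine measure_le_of_re_fourier_charFun_le hint Metric.isOpen_ball (by positivity)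
      (fun x hx => ?_) hB hBU
    rw [e2]
    linarith [(abs_le.1 (hb x hx)).2]

/-! ### Sums of independent steps -/

/-- The law of the sequence of the `n` steps. -/
abbrev stepsLaw (n : ℕ) : Measure (Fin n → ℂ) := Measure.pi fun _ => stepLaw

theorem integral_exp_sum_inner {n : ℕ} (ξ : Fin n → ℂ) :
    ∫ s, Complex.exp ((∑ j, inner ℝ (s j) (ξ j) : ℝ) * Complex.I) ∂(stepsLaw n)
      = ∏ j, (besselJ ‖ξ j‖ : ℂ) := by
  have h := integral_fintype_prod_eq_prod (μ := fun _ : Fin n => stepLaw)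
    (f := fun j (z : ℂ) => Complex.exp ((inner ℝ z (ξ j) : ℝ) * Complex.I))
  simp_rw [← charFun_stepLaw, charFun_apply]
  rw [← h]
  congr 1 with s
  rw [← Complex.exp_sum]
  congr 1
  push_cast
  rw [Finset.sum_mul]

theorem charFun_map_sum {n : ℕ} (A : Finset (Fin n)) (ξ : ℂ) :
    charFun ((stepsLaw n).map fun s => ∑ j ∈ A, s j) ξ = (besselJ ‖ξ‖ : ℂ) ^ A.card := by
  rw [charFun_apply, integral_map (by fun_prop) (Continuous.aestronglyMeasurable (by fun_prop))]
  have h := integral_exp_sum_inner (n := n) fun j => if j ∈ A then ξ else 0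
  have e1 : ∀ s : Fin n → ℂ, ∑ j, inner ℝ (s j) (if j ∈ A then ξ else 0)
      = (inner ℝ (∑ j ∈ A, s j) ξ : ℝ) := fun s => by
    rw [sum_inner, ← Finset.sum_filter_add_sum_filter_not Finset.univ (· ∈ A)]
    rw [Finset.sum_congr rfl (fun j hj => by rw [if_pos (Finset.mem_filter.1 hj).2]),
      Finset.sum_congr (s₁ := Finset.univ.filter (· ∉ A)) rfl
        (fun j hj => by rw [if_neg (Finset.mem_filter.1 hj).2, inner_zero_right])]
    simp
  simp_rw [e1] at h
  rw [h]
  have hj0 : besselJ 0 = 1 := by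
    have := abs_besselJ_sub_le 0
    norm_num at this
    linarith
  rw [Finset.prod_congr rfl (g := fun j => if j ∈ A then (besselJ ‖ξ‖ : ℂ) else 1)
    (fun j _ => by split_ifs <;> simp [hj0])]
  rw [Finset.prod_ite_mem]
  simp

/-! ### Near returns and existence of the polygon law -/

/-- The density at the origin of a finite measure with integrable characteristic function. -/
theorem tendsto_measureReal_ball_div {α : Measure ℂ} [IsFiniteMeasure α]
    (hα : Integrable fun η : ℂ => charFun α ((2 * Real.pi) • η)) :
    ∃ L : ℝ, Tendsto (fun ε : ℝ => α.real (Metric.ball 0 ε) / (Real.pi * ε ^ 2))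
      (𝓝[>] 0) (𝓝 L) := by
  set h : ℂ → ℝ := fun x => (𝓕 (fun η : ℂ => charFun α ((2 * Real.pi) • η)) x).re with hh
  have hcont : Continuous h := Complex.continuous_re.comp
    (VectorFourier.fourierIntegral_continuous Real.continuous_fourierChar
      (by simp only [innerₗ_apply_apply]; fun_prop) hα)
  -- The maximum with `0` avoids a separate proof that the density is nonnegative at the origin.
  refine ⟨max 0 (h 0), Metric.tendsto_nhds.2 fun δ hδ => ?_⟩
  obtain ⟨r, hr, hball⟩ := Metric.continuous_iff.1 hcont 0 (δ / 2) (by positivity)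
  filter_upwards [Ioo_mem_nhdsGT hr] with ε hε
  have hε0 := hε.1
  have hv : (volume : Measure ℂ) (Metric.ball 0 ε) = ENNReal.ofReal (Real.pi * ε ^ 2) := by
    rw [Complex.volume_ball, ← ENNReal.ofReal_pow hε0.le, ← NNReal.coe_real_pi,
      ENNReal.ofReal_mul (by positivity), ENNReal.ofReal_coe_nnreal, mul_comm]
  have hpos : 0 < Real.pi * ε ^ 2 := by positivity
  have hsub : Metric.ball (0 : ℂ) ε ⊆ Metric.ball 0 r := Metric.ball_subset_ball hε.2.le
  have hx : ∀ x ∈ Metric.ball (0 : ℂ) r, |h x - h 0| < δ / 2 := fun x hx => hball x hx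
  have hup := measure_le_of_re_fourier_charFun_le hα Metric.isOpen_ball
    (c := max 0 (h 0) + δ / 2) (by positivity)
    (fun x hxr => by linarith [(abs_lt.1 (hx x hxr)).2, le_max_right 0 (h 0)])
    Metric.isOpen_ball.measurableSet hsub
  have hlow := le_measure_of_le_re_fourier_charFun hα Metric.isOpen_ball
    (c := h 0 - δ / 2) (fun x hxr => by linarith [(abs_lt.1 (hx x hxr)).1])
    Metric.isOpen_ball.measurableSet hsub
  rw [hv, ← ENNReal.ofReal_mul (by positivity)] at hup
  have hup' : α.real (Metric.ball 0 ε) ≤ (max 0 (h 0) + δ / 2) * (Real.pi * ε ^ 2) :=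
    ENNReal.toReal_le_of_le_ofReal (by positivity) hup
  have hlow' : (h 0 - δ / 2) * (Real.pi * ε ^ 2) ≤ α.real (Metric.ball 0 ε) := by
    rcases le_or_gt (h 0 - δ / 2) 0 with hn | hn
    · exact (mul_nonpos_of_nonpos_of_nonneg hn hpos.le).trans measureReal_nonneg
    · rw [hv, ← ENNReal.ofReal_mul hn.le] at hlow
      exact (ENNReal.ofReal_le_iff_le_toReal (measure_ne_top _ _)).1 hlow
  have h1 := (div_le_iff₀ hpos).2 hup'
  have h2 := (le_div_iff₀ hpos).2 hlow'
  have h3 : 0 ≤ α.real (Metric.ball 0 ε) / (Real.pi * ε ^ 2) := by positivity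
  rw [Real.dist_eq, abs_lt]
  rcases max_cases 0 (h 0) with hm | hm <;> rw [hm.1] at h1 ⊢ <;> constructor <;> linarith

/-- The product is at most a power of its largest factor. This reduces the integrability of a
product of differently shifted Bessel functions to that of translates of a single power. -/
theorem prod_le_sum_pow {ι : Type*} [Fintype ι] [Nonempty ι] (a : ι → ℝ) (ha : ∀ i, 0 ≤ a i) :
    ∏ i, a i ≤ ∑ i, a i ^ Fintype.card ι := by
  obtain ⟨i₀, -, hi₀⟩ := Finset.exists_max_image Finset.univ a Finset.univ_nonempty
  calc ∏ i, a i ≤ ∏ _i : ι, a i₀ :=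
        Finset.prod_le_prod (fun i _ => ha i) fun i hi => hi₀ i hi
    _ = a i₀ ^ Fintype.card ι := by simp
    _ ≤ _ := Finset.single_le_sum (f := fun i => a i ^ Fintype.card ι)
      (fun i _ => by have := ha i; positivity) (Finset.mem_univ i₀)

theorem integrable_prod_besselJ {n : ℕ} (hn : 24 ≤ n) (ξ : Fin n → ℂ) :
    Integrable fun η : ℂ => ∏ j, (besselJ ‖ξ j + (2 * Real.pi) • η‖ : ℂ) := by
  have : Nonempty (Fin n) := ⟨⟨0, by omega⟩⟩
  have hi : ∀ j, Integrable fun η : ℂ => |besselJ ‖ξ j + (2 * Real.pi) • η‖| ^ n := fun j => by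
    have h1 := ((integrable_besselJ_pow hn).comp_add_left (ξ j)).norm
    have h2 := (integrable_comp_smul_iff (volume : Measure ℂ)
      (fun η : ℂ => ‖besselJ ‖ξ j + η‖ ^ n‖) (R := 2 * Real.pi) (by positivity)).2 h1
    simpa [norm_pow] using h2
  refine (integrable_finsetSum Finset.univ fun j _ => hi j).mono'
    (Continuous.aestronglyMeasurable ?_) (Eventually.of_forall fun η => ?_)
  · refine continuous_finsetProd _ fun j _ => ?_
    exact Complex.continuous_ofReal.comp (continuous_besselJ.comp (by fun_prop))
  · rw [norm_prod]
    simp only [Complex.norm_real, Real.norm_eq_abs]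
    have := prod_le_sum_pow (fun j => |besselJ ‖ξ j + (2 * Real.pi) • η‖|) fun _ => abs_nonneg _
    simpa using this

/-- The set of step sequences whose walk returns to within `ε` of its origin. -/
def nearReturn (n : ℕ) (ε : ℝ) : Set (Fin n → ℂ) := {s | ‖∑ j, s j‖ < ε}

theorem measurableSet_nearReturn (n : ℕ) (ε : ℝ) : MeasurableSet (nearReturn n ε) :=
  measurableSet_lt (by fun_prop) measurable_const

/-- Adding `1` makes the cosine weight nonnegative, so that it defines a finite measure. The
characteristic function of the sum of the steps under this measure is a combination of three
products of shifted Bessel functions, hence integrable, and the measure has a density at the origin.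
The phase `τ` gives access to both cosine and sine. -/
theorem exists_tendsto_setIntegral_one_add_cos {n : ℕ} (hn : 24 ≤ n) (ξ : Fin n → ℂ) (τ : ℝ) :
    ∃ L : ℝ, Tendsto (fun ε : ℝ => (∫ s in nearReturn n ε,
        (1 + Real.cos (∑ j, inner ℝ (s j) (ξ j) + τ)) ∂(stepsLaw n)) / (Real.pi * ε ^ 2))
      (𝓝[>] 0) (𝓝 L) := by
  set W : (Fin n → ℂ) → ℝ := fun s => 1 + Real.cos (∑ j, inner ℝ (s j) (ξ j) + τ) with hW
  have hWc : Continuous W := by fun_prop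
  have hW0 : ∀ s, 0 ≤ W s := fun s => by linarith [Real.neg_one_le_cos (∑ j, inner ℝ (s j) (ξ j) + τ)]
  have hWb : ∀ s, W s ≤ 2 := fun s => by linarith [Real.cos_le_one (∑ j, inner ℝ (s j) (ξ j) + τ)]
  have hWi : Integrable W (stepsLaw n) := (integrable_const (2 : ℝ)).mono'
    hWc.aestronglyMeasurable (Eventually.of_forall fun s => by
      rw [Real.norm_of_nonneg (hW0 s)]; exact hWb s)
  have hsum : Continuous fun s : Fin n → ℂ => ∑ j, s j := by fun_prop
  set ρ := (stepsLaw n).withDensity fun s => ENNReal.ofReal (W s) with hρ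
  have : IsFiniteMeasure ρ := isFiniteMeasure_withDensity_ofReal hWi.2
  set α := ρ.map fun s => ∑ j, s j with hα
  have hball : ∀ ε, α.real (Metric.ball 0 ε) = ∫ s in nearReturn n ε, W s ∂(stepsLaw n) := by
    intro ε
    have hpre : (fun s : Fin n → ℂ => ∑ j, s j) ⁻¹' Metric.ball 0 ε = nearReturn n ε := by
      ext s; simp [nearReturn]
    rw [measureReal_def, hα, Measure.map_apply hsum.measurable Metric.isOpen_ball.measurableSet,
      hpre, hρ, withDensity_apply _ (measurableSet_nearReturn n ε),
      integral_eq_lintegral_of_nonneg_ae (Eventually.of_forall hW0) hWc.aestronglyMeasurable]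
  let e : (Fin n → ℂ) → (Fin n → ℂ) → ℂ := fun ζ s =>
    Complex.exp ((∑ j, inner ℝ (s j) (ζ j) : ℝ) * Complex.I)
  have he : ∀ ζ, Integrable (e ζ) (stepsLaw n) := fun ζ =>
    (integrable_const (1 : ℝ)).mono' (Continuous.aestronglyMeasurable (by fun_prop))
      (Eventually.of_forall fun s => (Complex.norm_exp_ofReal_mul_I _).le)
  have hchar : ∀ η, charFun α η = ∏ j : Fin n, (besselJ ‖(0 : ℂ) + η‖ : ℂ)
      + (1 / 2 * Complex.exp (τ * Complex.I)) * ∏ j, (besselJ ‖ξ j + η‖ : ℂ)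
      + (1 / 2 * Complex.exp (-τ * Complex.I)) * ∏ j, (besselJ ‖-ξ j + η‖ : ℂ) := by
    intro η
    have hA : Integrable (fun s => e (fun _ => (0 : ℂ) + η) s
        + (1 / 2 * Complex.exp (τ * Complex.I)) * e (fun j => ξ j + η) s) (stepsLaw n) :=
      (he _).add ((he _).const_mul _)
    rw [charFun_apply, hα, integral_map hsum.aemeasurable
      (Continuous.aestronglyMeasurable (by fun_prop)), hρ,
      integral_withDensity_eq_integral_toReal_smul (by fun_prop) (by simp)]
    rw [← integral_exp_sum_inner (fun j => (0 : ℂ) + η),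
      ← integral_exp_sum_inner (fun j => ξ j + η),
      ← integral_exp_sum_inner (fun j => -ξ j + η), ← integral_const_mul, ← integral_const_mul,
      ← integral_add (he _) ((he _).const_mul _),
      ← integral_add hA ((he _).const_mul _)]
    congr 1 with s
    rw [ENNReal.toReal_ofReal (hW0 s), hW, Complex.real_smul]
    simp only [e, inner_add_right, Finset.sum_add_distrib, inner_neg_right, inner_zero_right,
      Finset.sum_neg_distrib, sum_inner]
    set a := ∑ j, inner ℝ (s j) (ξ j)
    set b := ∑ j, inner ℝ (s j) η
    push_cast
    rw [Complex.cos]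
    simp only [add_mul, neg_mul, neg_add, Complex.exp_add, zero_mul, Complex.exp_zero,
      Finset.sum_const_zero]
    ring
  have hint : Integrable fun η : ℂ => charFun α ((2 * Real.pi) • η) := by
    simp_rw [hchar]
    exact ((integrable_prod_besselJ hn fun _ => 0).add
      ((integrable_prod_besselJ hn ξ).const_mul _)).add
      ((integrable_prod_besselJ hn fun j => -ξ j).const_mul _)
  obtain ⟨L, hL⟩ := tendsto_measureReal_ball_div hint
  exact ⟨L, by simpa only [hball] using hL⟩

theorem charFun_map_sum_univ {n : ℕ} (ξ : ℂ) :
    charFun ((stepsLaw n).map fun s => ∑ j, s j) ξ = (besselJ ‖ξ‖ : ℂ) ^ n := by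
  simpa using charFun_map_sum (Finset.univ : Finset (Fin n)) ξ

theorem volume_ball_ofReal {ε : ℝ} (hε : 0 ≤ ε) (z : ℂ) :
    (volume : Measure ℂ) (Metric.ball z ε) = ENNReal.ofReal (Real.pi * ε ^ 2) := by
  rw [Complex.volume_ball, ← ENNReal.ofReal_pow hε, ← NNReal.coe_real_pi,
    ENNReal.ofReal_mul (by positivity), ENNReal.ofReal_coe_nnreal, mul_comm]

/-- Two-sided estimate of the probability of a near return. -/
theorem exists_stepsLaw_nearReturn_bounds :
    ∃ D : ℝ, 0 < D ∧ ∀ n : ℕ, 25 ≤ n → ∀ ε : ℝ, 0 < ε → ε ≤ 1 →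
      (1 - D / n) * (ε ^ 2 / n) ≤ (stepsLaw n).real (nearReturn n ε) ∧
      (stepsLaw n).real (nearReturn n ε) ≤ (1 + D / n) * (ε ^ 2 / n) := by
  obtain ⟨D, hD, h⟩ := exists_local_limit
  refine ⟨D, hD, fun n hn ε hε hε1 => ?_⟩
  have hn0 : (0 : ℝ) < n := by exact_mod_cast (by omega : 0 < n)
  have hsum : Continuous fun s : Fin n → ℂ => ∑ j, s j := by fun_prop
  have hpre : (fun s : Fin n → ℂ => ∑ j, s j) ⁻¹' Metric.ball 0 ε = nearReturn n ε := by
    ext s; simp [nearReturn]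
  have := h n hn ((stepsLaw n).map fun s => ∑ j, s j) inferInstance charFun_map_sum_univ
    (Metric.ball 0 ε) Metric.isOpen_ball.measurableSet (Metric.ball_subset_ball (by linarith))
  rw [Measure.map_apply hsum.measurable Metric.isOpen_ball.measurableSet, hpre,
    volume_ball_ofReal hε.le] at this
  have hpi := Real.pi_pos
  have e1 : 1 / (Real.pi * n) * (1 - D / n) * (Real.pi * ε ^ 2) = (1 - D / n) * (ε ^ 2 / n) := by
    field_simp
  have e2 : 1 / (Real.pi * n) * (1 + D / n) * (Real.pi * ε ^ 2) = (1 + D / n) * (ε ^ 2 / n) := by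
    field_simp
  rw [← ENNReal.ofReal_mul' (by positivity), ← ENNReal.ofReal_mul' (by positivity), e1, e2] at this
  exact ⟨(ENNReal.ofReal_le_iff_le_toReal (measure_ne_top _ _)).1 this.1,
    ENNReal.toReal_le_of_le_ofReal (by positivity) this.2⟩

theorem path_zero {n : ℕ} (s : Fin n → ℂ) : path s 0 = 0 := by
  simp [path]

theorem path_last {n : ℕ} (s : Fin n → ℂ) : path s (Fin.last n) = ∑ j, s j := by
  simp [path, Fin.castSucc_lt_last]

theorem continuous_path (n : ℕ) : Continuous (path : (Fin n → ℂ) → _) := by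
  unfold path
  fun_prop

theorem cond_walkLaw (n : ℕ) (ε : ℝ) :
    ProbabilityTheory.cond (walkLaw n)
        {X : Fin (n + 1) → ℂ | dist (X (Fin.last n)) (X 0) < ε}
      = (ProbabilityTheory.cond (stepsLaw n) (nearReturn n ε)).map path := by
  have hm : MeasurableSet {X : Fin (n + 1) → ℂ | dist (X (Fin.last n)) (X 0) < ε} :=
    measurableSet_lt (by fun_prop) measurable_const
  have hp := (continuous_path n).measurable
  have hpre : (path : (Fin n → ℂ) → _) ⁻¹'
      {X : Fin (n + 1) → ℂ | dist (X (Fin.last n)) (X 0) < ε} = nearReturn n ε := by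
    ext s
    simp [nearReturn, path_zero, path_last]
  rw [ProbabilityTheory.cond, ProbabilityTheory.cond, walkLaw, Measure.restrict_map hp hm,
    Measure.map_apply hp hm, hpre, Measure.map_smul]

/-- The step sequences, as an inner product space. -/
abbrev StepSpace (n : ℕ) : Type := PiLp 2 fun _ : Fin n => ℂ

theorem continuous_toLp (n : ℕ) :
    Continuous (WithLp.toLp 2 : (Fin n → ℂ) → StepSpace n) :=
  PiLp.continuous_toLp 2 _

/-- The law of the steps conditioned on a near return. -/
def condSteps (n : ℕ) (ε : ℝ) : Measure (StepSpace n) :=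
  (ProbabilityTheory.cond (stepsLaw n) (nearReturn n ε)).map (WithLp.toLp 2)

theorem isProbabilityMeasure_condSteps {n : ℕ} {ε : ℝ} (h : (stepsLaw n) (nearReturn n ε) ≠ 0) :
    IsProbabilityMeasure (condSteps n ε) := by
  have := ProbabilityTheory.cond_isProbabilityMeasure h
  exact Measure.isProbabilityMeasure_map (continuous_toLp n).aemeasurable

theorem integral_cond_eq {n : ℕ} {E : Type*} [NormedAddCommGroup E] [NormedSpace ℝ E] (ε : ℝ)
    (f : (Fin n → ℂ) → E) :
    ∫ s, f s ∂(ProbabilityTheory.cond (stepsLaw n) (nearReturn n ε))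
      = ((stepsLaw n).real (nearReturn n ε))⁻¹ • ∫ s in nearReturn n ε, f s ∂(stepsLaw n) := by
  rw [ProbabilityTheory.cond, integral_smul_measure, ENNReal.toReal_inv, measureReal_def]

/-- The conditional expectation is a quotient of two near-return integrals, each of order `ε²`; the
added `1` in the weight is subtracted at the end. -/
theorem exists_tendsto_integral_cond_cos {n : ℕ} (hn : 24 ≤ n) (ξ : Fin n → ℂ) (τ : ℝ) {L₀ : ℝ}
    (hL₀ : 0 < L₀) (h₀ : Tendsto (fun ε : ℝ => (stepsLaw n).real (nearReturn n ε)
      / (Real.pi * ε ^ 2)) (𝓝[>] 0) (𝓝 L₀)) :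
    ∃ L : ℝ, Tendsto (fun ε : ℝ => ∫ s, Real.cos (∑ j, inner ℝ (s j) (ξ j) + τ)
        ∂(ProbabilityTheory.cond (stepsLaw n) (nearReturn n ε))) (𝓝[>] 0) (𝓝 L) := by
  obtain ⟨L, hL⟩ := exists_tendsto_setIntegral_one_add_cos hn ξ τ
  refine ⟨L / L₀ - 1, ((hL.div h₀ hL₀.ne').sub_const 1).congr' ?_⟩
  filter_upwards [self_mem_nhdsWithin, h₀.eventually (lt_mem_nhds hL₀)] with ε hε hpos
  have hε0 : (0 : ℝ) < ε := hε
  have hpi := Real.pi_pos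
  have hden : 0 < Real.pi * ε ^ 2 := by positivity
  have hP : 0 < (stepsLaw n).real (nearReturn n ε) := by
    by_contra hneg
    exact absurd hpos (not_lt.2 (div_nonpos_of_nonpos_of_nonneg (not_lt.1 hneg) hden.le))
  simp only [Pi.div_apply]
  rw [integral_cond_eq, integral_add (integrable_const _), setIntegral_const, smul_eq_mul,
    smul_eq_mul]
  · field_simp
    ring
  · refine ((integrable_const (1 : ℝ)).mono' (Continuous.aestronglyMeasurable (by fun_prop))
      (Eventually.of_forall fun s => ?_))
    exact Real.abs_cos_le_one _

theorem exists_tendsto_charFun_condSteps {n : ℕ} (hn : 24 ≤ n) {L₀ : ℝ}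
    (hL₀ : 0 < L₀) (h₀ : Tendsto (fun ε : ℝ => (stepsLaw n).real (nearReturn n ε)
      / (Real.pi * ε ^ 2)) (𝓝[>] 0) (𝓝 L₀)) (t : StepSpace n) :
    ∃ z : ℂ, Tendsto (fun ε : ℝ => charFun (condSteps n ε) t) (𝓝[>] 0) (𝓝 z) := by
  obtain ⟨a, ha⟩ := exists_tendsto_integral_cond_cos hn (fun j => t j) 0 hL₀ h₀
  -- The phase `-π / 2` turns the cosine into the sine, which gives the imaginary part.
  obtain ⟨b, hb⟩ := exists_tendsto_integral_cond_cos hn (fun j => t j) (-(Real.pi / 2)) hL₀ h₀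
  refine ⟨a + b * Complex.I, Tendsto.congr (fun ε => ?_)
    (((Complex.continuous_ofReal.tendsto a).comp ha).add
      (((Complex.continuous_ofReal.tendsto b).comp hb).mul_const Complex.I))⟩
  have hi : ∀ f : (Fin n → ℂ) → ℝ, Continuous f → (∀ s, |f s| ≤ 1) → Integrable f
      (ProbabilityTheory.cond (stepsLaw n) (nearReturn n ε)) := fun f hf hb =>
    (integrable_const (1 : ℝ)).mono' hf.aestronglyMeasurable (Eventually.of_forall hb)
  rw [charFun_apply, condSteps, integral_map (continuous_toLp n).aemeasurable
    (Continuous.aestronglyMeasurable (by fun_prop))]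
  simp only [Function.comp_apply, add_zero, ← sub_eq_add_neg, Real.cos_sub_pi_div_two]
  have hc : ∀ f : (Fin n → ℂ) → ℝ,
      ((∫ s, f s ∂(ProbabilityTheory.cond (stepsLaw n) (nearReturn n ε)) : ℝ) : ℂ)
        = ∫ s, (f s : ℂ) ∂(ProbabilityTheory.cond (stepsLaw n) (nearReturn n ε)) :=
    fun f => integral_ofReal.symm
  rw [hc, hc, ← integral_mul_const, ← integral_add]
  · congr 1 with s
    rw [PiLp.inner_apply, Complex.exp_mul_I]
    simp
  · exact (hi _ (by fun_prop) fun s => Real.abs_cos_le_one _).ofReal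
  · exact ((hi _ (by fun_prop) fun s => Real.abs_sin_le_one _).ofReal).mul_const _

theorem ae_stepsLaw_norm_eq_one (n : ℕ) : ∀ᵐ s ∂(stepsLaw n), ∀ j, ‖s j‖ = 1 := by
  refine ae_all_iff.2 fun j => ?_
  have h := (measurePreserving_eval (fun _ : Fin n => stepLaw) j).quasiMeasurePreserving.tendsto_ae
  exact h.eventually ae_stepLaw_norm_eq_one

/-- The box of step sequences with steps of length at most one. -/
def unitSteps (n : ℕ) : Set (StepSpace n) :=
  WithLp.toLp 2 '' (Set.univ.pi fun _ : Fin n => Metric.closedBall (0 : ℂ) 1)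

theorem isCompact_unitSteps (n : ℕ) : IsCompact (unitSteps n) :=
  (isCompact_univ_pi fun _ => isCompact_closedBall _ _).image (continuous_toLp n)

theorem condSteps_compl_unitSteps (n : ℕ) (ε : ℝ) : condSteps n ε (unitSteps n)ᶜ = 0 := by
  have hac := ProbabilityTheory.cond_absolutelyContinuous (μ := stepsLaw n) (s := nearReturn n ε)
  rw [condSteps, Measure.map_apply (continuous_toLp n).measurable
    (isCompact_unitSteps n).measurableSet.compl]
  have hae := (ae_stepsLaw_norm_eq_one n).filter_mono hac.ae_le
  rw [ae_iff] at hae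
  refine measure_mono_null (t := {s | ¬∀ j, ‖s j‖ = 1}) (fun s hs hs' => hs ?_) hae
  exact ⟨s, fun j _ => by simpa using (hs' j).le, rfl⟩

/-- The law of the polygon exists as soon as the density of the end point at the origin is
positive. -/
theorem exists_isPolygonLaw {n : ℕ} (hn : 24 ≤ n) {L₀ : ℝ} (hL₀ : 0 < L₀)
    (h₀ : Tendsto (fun ε : ℝ => (stepsLaw n).real (nearReturn n ε)
      / (Real.pi * ε ^ 2)) (𝓝[>] 0) (𝓝 L₀)) :
    ∃ μ : ProbabilityMeasure (Fin (n + 1) → ℂ), IsPolygonLaw n μ := by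
  have hpos : ∀ᶠ ε : ℝ in 𝓝[>] 0, (stepsLaw n) (nearReturn n ε) ≠ 0 := by
    filter_upwards [h₀.eventually (lt_mem_nhds hL₀)] with ε hε h
    simp [measureReal_def, h] at hε
  choose f hf using exists_tendsto_charFun_condSteps hn hL₀ h₀
  -- By Lévy's continuity theorem, it suffices to find a probability measure whose characteristic
  -- function is the pointwise limit `f`.
  have key : ∀ ν : ProbabilityMeasure (StepSpace n), (∀ t, charFun (ν : Measure _) t = f t) →
      IsPolygonLaw n (ν.map ((continuous_path n).comp
        (PiLp.continuous_ofLp 2 _)).aemeasurable) := by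
    intro ν hν g
    refine tendsto_of_seq_tendsto fun ε hε => ?_
    obtain ⟨k, hk⟩ := eventually_atTop.1 (hε.eventually hpos)
    have hε' : Tendsto (fun j => ε (j + k)) atTop (𝓝[>] 0) := hε.comp (tendsto_add_atTop_nat k)
    rw [← tendsto_add_atTop_iff_nat k]
    have hp : ∀ j, IsProbabilityMeasure (condSteps n (ε (j + k))) := fun j =>
      isProbabilityMeasure_condSteps (hk _ (by omega))
    let Q : ℕ → ProbabilityMeasure (StepSpace n) := fun j => ⟨condSteps n (ε (j + k)), hp j⟩
    have hQ : Tendsto Q atTop (𝓝 ν) := by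
      refine ProbabilityMeasure.tendsto_of_tendsto_charFun fun t => ?_
      rw [hν]
      exact (hf t).comp hε'
    have hpath : Continuous (path ∘ WithLp.ofLp : StepSpace n → Fin (n + 1) → ℂ) :=
      (continuous_path n).comp (PiLp.continuous_ofLp 2 _)
    have := (ProbabilityMeasure.tendsto_iff_forall_integral_tendsto.1 hQ)
      (g.compContinuous ⟨_, hpath⟩)
    rw [ProbabilityMeasure.toMeasure_map, integral_map hpath.aemeasurable
      g.continuous.aestronglyMeasurable]
    refine this.congr fun j => ?_
    rw [Function.comp_apply, cond_walkLaw, integral_map (continuous_path n).aemeasurable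
      g.continuous.aestronglyMeasurable]
    change ∫ x, (g ∘ path ∘ WithLp.ofLp) x ∂(condSteps n (ε (j + k))) = _
    rw [condSteps, integral_map (continuous_toLp n).aemeasurable
      (g.continuous.comp hpath).aestronglyMeasurable]
    rfl
  obtain ⟨δ, hδ, hδ'⟩ := mem_nhdsGT_iff_exists_Ioo_subset.1 hpos
  have hδ0 : (0 : ℝ) < δ := hδ
  set ε : ℕ → ℝ := fun j => δ / (j + 2) with hεdef
  have hεpos : ∀ j, 0 < ε j := fun j => by positivity
  have hε : Tendsto ε atTop (𝓝[>] 0) := by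
    refine tendsto_nhdsWithin_iff.2 ⟨?_, Eventually.of_forall hεpos⟩
    exact tendsto_const_nhds.div_atTop
      (tendsto_atTop_add_const_right _ _ tendsto_natCast_atTop_atTop)
  have hp : ∀ j, IsProbabilityMeasure (condSteps n (ε j)) := fun j =>
    isProbabilityMeasure_condSteps (hδ' ⟨hεpos j, by
      rw [hεdef]
      exact div_lt_self hδ0 (by have : (0 : ℝ) ≤ j := Nat.cast_nonneg j
                                linarith)⟩)
  let Q : ℕ → ProbabilityMeasure (StepSpace n) := fun j => ⟨condSteps n (ε j), hp j⟩
  have htight : IsTightMeasureSet      {x : Measure (StepSpace n) | ∃ μ ∈ Set.range Q, (μ : Measure (StepSpace n)) = x} := by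
    rw [isTightMeasureSet_iff_exists_isCompact_measure_compl_le]
    refine fun r hr => ⟨unitSteps n, isCompact_unitSteps n, ?_⟩
    rintro _ ⟨_, ⟨j, rfl⟩, rfl⟩
    change condSteps n (ε j) (unitSteps n)ᶜ ≤ r
    rw [condSteps_compl_unitSteps]
    exact zero_le
  have hcomp := isCompact_closure_of_isTightMeasureSet htight
  -- Tightness yields a limit point along an ultrafilter. Its characteristic function must be `f`,
  -- since convergence to `f` holds along the whole filter.
  let U : Ultrafilter ℕ := Ultrafilter.of atTop
  have hU : (U : Filter ℕ) ≤ atTop := Ultrafilter.of_le _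
  obtain ⟨ν, -, hν : Tendsto Q U (𝓝 ν)⟩ := hcomp.ultrafilter_le_nhds (U.map Q)
    (le_principal_iff.2 (mem_map.2 (Eventually.of_forall fun j => subset_closure ⟨j, rfl⟩)))
  refine ⟨_, key ν fun t => ?_⟩
  rw [ProbabilityMeasure.tendsto_iff_forall_integral_rclike_tendsto ℂ] at hν
  have h1 := hν (BoundedContinuousFunction.innerProbChar t)
  refine tendsto_nhds_unique ?_ (((hf t).comp hε).mono_left hU)
  rw [charFun_eq_integral_innerProbChar]
  refine h1.congr fun j => ?_
  rw [Function.comp_apply, charFun_eq_integral_innerProbChar]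
  rfl

/-- For `n > D` the lower bound on near returns keeps the limiting density at the origin positive.
-/
theorem eventually_exists_isPolygonLaw :
    ∀ᶠ n : ℕ in atTop, ∃ μ : ProbabilityMeasure (Fin (n + 1) → ℂ), IsPolygonLaw n μ := by
  obtain ⟨D, hD, h⟩ := exists_stepsLaw_nearReturn_bounds
  filter_upwards [eventually_ge_atTop 25, eventually_gt_atTop ⌈D⌉₊] with n hn hnD
  have hn0 : (0 : ℝ) < n := by exact_mod_cast (by omega : 0 < n)
  have hDn : 0 < 1 - D / n := by
    have : D < n := (Nat.le_ceil D).trans_lt (by exact_mod_cast hnD)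
    rw [sub_pos, div_lt_one hn0]
    exact this
  -- With zero frequency and phase the weight is the constant `2`, whence the division by `2` below.
  obtain ⟨L, hL⟩ := exists_tendsto_setIntegral_one_add_cos (by omega : 24 ≤ n) 0 0
  have hL' : Tendsto (fun ε : ℝ => (stepsLaw n).real (nearReturn n ε) / (Real.pi * ε ^ 2))
      (𝓝[>] 0) (𝓝 (L / 2)) := by
    refine (hL.div_const 2).congr fun ε => ?_
    simp
    ring
  refine exists_isPolygonLaw (by omega) (L₀ := L / 2) ?_ hL'
  have hpi := Real.pi_pos
  have : (1 - D / n) / (Real.pi * n) ≤ L / 2 := by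
    refine ge_of_tendsto hL' ?_
    filter_upwards [Ioo_mem_nhdsGT (zero_lt_one' ℝ)] with ε hε
    have hε0 : 0 < ε := hε.1
    have := (h n hn ε hε.1 hε.2.le).1
    rw [le_div_iff₀ (by positivity)]
    refine le_trans (le_of_eq ?_) this
    field_simp
  exact lt_of_lt_of_le (by positivity) this

/-! ### Geometry of a crossing: the parallelogram of two sides -/

/-- The determinant of two vectors of the plane. -/
def crossDet (u v : ℂ) : ℝ := u.re * v.im - u.im * v.re

theorem continuous_crossDet : Continuous fun p : ℂ × ℂ => crossDet p.1 p.2 := by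
  unfold crossDet; fun_prop

/-- The linear map with values `-u`, `-v` on the standard basis. -/
def negCombination (u v : ℂ) : ℂ →ₗ[ℝ] ℂ where
  toFun z := -(z.re • u + z.im • v)
  map_add' x y := by simp only [Complex.add_re, Complex.add_im, add_smul]; ring
  map_smul' c x := by
    simp only [Complex.smul_re, Complex.smul_im, smul_eq_mul, mul_smul, RingHom.id_apply, smul_add,
      smul_neg]

theorem negCombination_apply (u v z : ℂ) : negCombination u v z = -(z.re • u + z.im • v) := rfl

theorem det_negCombination (u v : ℂ) : LinearMap.det (negCombination u v) = crossDet u v := by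
  rw [← LinearMap.det_toMatrix Complex.basisOneI, Matrix.det_fin_two]
  simp only [LinearMap.toMatrix_apply, Complex.coe_basisOneI, Complex.coe_basisOneI_repr,
    negCombination_apply]
  simp [crossDet]
  ring

/-- The open and closed unit squares. -/
def openSquare : Set ℂ := {z | z.re ∈ Set.Ioo (0 : ℝ) 1 ∧ z.im ∈ Set.Ioo (0 : ℝ) 1}

def closedSquare : Set ℂ := {z | z.re ∈ Set.Icc (0 : ℝ) 1 ∧ z.im ∈ Set.Icc (0 : ℝ) 1}

theorem volume_openSquare : volume openSquare = 1 := by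
  have h := Complex.volume_preserving_equiv_real_prod.measure_preimage_equiv
    (Set.Ioo (0 : ℝ) 1 ×ˢ Set.Ioo (0 : ℝ) 1)
  have e : (Complex.measurableEquivRealProd ⁻¹' (Set.Ioo (0 : ℝ) 1 ×ˢ Set.Ioo (0 : ℝ) 1))
      = openSquare := rfl
  rw [e] at h
  rw [h, Measure.volume_eq_prod, Measure.prod_prod]
  simp

theorem isCompact_closedSquare : IsCompact closedSquare := by
  refine Metric.isCompact_of_isClosed_isBounded ?_ ?_
  · exact (isClosed_Icc.preimage Complex.continuous_re).inter
      (isClosed_Icc.preimage Complex.continuous_im)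
  · refine (Metric.isBounded_closedBall (x := (0 : ℂ)) (r := 2)).subset fun z hz => ?_
    have h1 := hz.1
    have h2 := hz.2
    rw [mem_closedBall_zero_iff]
    refine (Complex.norm_le_abs_re_add_abs_im z).trans ?_
    rw [abs_of_nonneg h1.1, abs_of_nonneg h2.1]
    linarith [h1.2, h2.2]

/-- The configurations `((u, v), x)` with `-x` a combination of `u` and `v` with coefficients in
`S`. -/
def combinationSet (S : Set ℂ) : Set ((ℂ × ℂ) × ℂ) :=
  {q | ∃ z ∈ S, q.2 = negCombination q.1.1 q.1.2 z}

theorem preimage_combinationSet (S : Set ℂ) (u v : ℂ) :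
    Prod.mk (u, v) ⁻¹' combinationSet S = negCombination u v '' S := by
  ext x
  simp [combinationSet, eq_comm]

/-- Projection along a compact factor is a closed map. -/
theorem isClosed_combinationSet {K : Set ℂ} (hK : IsCompact K) : IsClosed (combinationSet K) := by
  have : CompactSpace K := isCompact_iff_compactSpace.1 hK
  have hc : IsClosed {p : K × ((ℂ × ℂ) × ℂ) |
      p.2.2 = negCombination p.2.1.1 p.2.1.2 (p.1 : ℂ)} := by
    simp only [negCombination_apply]
    exact isClosed_eq (by fun_prop) (by fun_prop)
  have h := isClosedMap_snd_of_compactSpace _ hc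
  convert h using 1
  ext q
  constructor
  · rintro ⟨z, hz, e⟩
    exact ⟨(⟨z, hz⟩, q), e, rfl⟩
  · rintro ⟨⟨z, q'⟩, e, rfl⟩
    exact ⟨z, z.2, e⟩

/-- The open square is a countable union of compact squares, so the set is a countable union of
closed sets. -/
theorem measurableSet_combinationSet_openSquare : MeasurableSet (combinationSet openSquare) := by
  let K : ℕ → Set ℂ := fun j => {z | z.re ∈ Set.Icc (1 / ((j : ℝ) + 1)) (1 - 1 / ((j : ℝ) + 1)) ∧
    z.im ∈ Set.Icc (1 / ((j : ℝ) + 1)) (1 - 1 / ((j : ℝ) + 1))}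
  have hpos : ∀ j : ℕ, (0 : ℝ) < 1 / ((j : ℝ) + 1) := fun j => by positivity
  have hK : ∀ j, IsCompact (K j) := fun j => by
    refine isCompact_closedSquare.of_isClosed_subset ?_ fun z hz => ?_
    · exact (isClosed_Icc.preimage Complex.continuous_re).inter
        (isClosed_Icc.preimage Complex.continuous_im)
    · have := hpos j
      exact ⟨⟨this.le.trans hz.1.1, hz.1.2.trans (by linarith)⟩,
        ⟨this.le.trans hz.2.1, hz.2.2.trans (by linarith)⟩⟩
  have hU : combinationSet openSquare = ⋃ j, combinationSet (K j) := by
    ext q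
    simp only [Set.mem_iUnion]
    constructor
    · rintro ⟨z, ⟨h1, h2⟩, e⟩
      obtain ⟨j, hj⟩ := exists_nat_one_div_lt (lt_min (lt_min h1.1 (sub_pos.2 h1.2))
        (lt_min h2.1 (sub_pos.2 h2.2)))
      simp only [lt_min_iff] at hj
      exact ⟨j, z, ⟨⟨hj.1.1.le, by linarith [hj.1.2]⟩, ⟨hj.2.1.le, by linarith [hj.2.2]⟩⟩, e⟩
    · rintro ⟨j, z, ⟨h1, h2⟩, e⟩
      have := hpos j
      exact ⟨z, ⟨⟨this.trans_le h1.1, h1.2.trans_lt (by linarith)⟩,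
        ⟨this.trans_le h2.1, h2.2.trans_lt (by linarith)⟩⟩, e⟩
  rw [hU]
  exact MeasurableSet.iUnion fun j => (isClosed_combinationSet (hK j)).measurableSet

theorem volume_preimage_combinationSet_openSquare (u v : ℂ) :
    volume (Prod.mk (u, v) ⁻¹' combinationSet openSquare) = ENNReal.ofReal |crossDet u v| := by
  rw [preimage_combinationSet, Measure.addHaar_image_linearMap, det_negCombination,
    volume_openSquare, mul_one]

/-- The chord `u + v + x` is the combination with coefficients `1 - z.re`, `1 - z.im`, which also
lie in the unit interval. -/
theorem norm_le_of_mem_combinationSet {u v x : ℂ} (hu : ‖u‖ = 1) (hv : ‖v‖ = 1)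
    (h : ((u, v), x) ∈ combinationSet openSquare) : ‖x‖ ≤ 2 ∧ ‖u + v + x‖ ≤ 2 := by
  obtain ⟨z, ⟨h1, h2⟩, e⟩ := h
  simp only [negCombination_apply] at e
  constructor
  · rw [e, norm_neg]
    refine (norm_add_le _ _).trans ?_
    rw [norm_smul, norm_smul, hu, hv, Real.norm_of_nonneg h1.1.le, Real.norm_of_nonneg h2.1.le]
    linarith [h1.2, h2.2]
  · have : u + v + x = (1 - z.re) • u + (1 - z.im) • v := by
      rw [e]; simp only [sub_smul, one_smul]; ring
    rw [this]
    refine (norm_add_le _ _).trans ?_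
    rw [norm_smul, norm_smul, hu, hv, Real.norm_of_nonneg (sub_pos.2 h1.2).le,
      Real.norm_of_nonneg (sub_pos.2 h2.2).le]
    linarith [h1.1, h2.1]

theorem integral_abs_sin : ∫ θ in (-Real.pi)..Real.pi, |Real.sin θ| = 4 := by
  have hc : Continuous fun θ : ℝ => |Real.sin θ| := by fun_prop
  have h1 : ∫ θ in (0)..Real.pi, |Real.sin θ| = 2 := by
    rw [intervalIntegral.integral_congr (g := Real.sin) fun θ hθ => ?_, integral_sin]
    · norm_num
    · rw [Set.uIcc_of_le Real.pi_pos.le] at hθ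
      exact abs_of_nonneg (Real.sin_nonneg_of_mem_Icc hθ)
  have h2 : ∫ θ in (-Real.pi)..0, |Real.sin θ| = 2 := by
    have h := intervalIntegral.integral_comp_sub_right (a := 0) (b := Real.pi)
      (fun θ => |Real.sin θ|) Real.pi
    simp only [zero_sub, sub_self] at h
    rw [← h, ← h1]
    simp [Real.sin_sub_pi]
  rw [← intervalIntegral.integral_add_adjacent_intervals (hc.intervalIntegrable (-Real.pi) 0)
    (hc.intervalIntegrable 0 Real.pi), h1, h2]
  norm_num

/-- For unit vectors the determinant is the sine of the angle between them, and `|sin|` has mean `4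
/ (2 π)`. -/
theorem integral_abs_crossDet {u : ℂ} (hu : ‖u‖ = 1) : ∫ v, |crossDet u v| ∂stepLaw = 2 / Real.pi := by
  have hc : Continuous fun v : ℂ => |crossDet u v| := by unfold crossDet; fun_prop
  rw [integral_stepLaw hc.stronglyMeasurable]
  have h : ∀ θ : ℝ, |crossDet u (Complex.exp (θ * Complex.I))| = |Real.sin (θ + -u.arg)| := by
    intro θ
    have := Complex.norm_mul_exp_arg_mul_I u
    rw [hu, Complex.ofReal_one, one_mul] at this
    conv_lhs => rw [← this]
    rw [crossDet, Complex.exp_ofReal_mul_I_re, Complex.exp_ofReal_mul_I_re,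
      Complex.exp_ofReal_mul_I_im, Complex.exp_ofReal_mul_I_im, ← sub_eq_add_neg, Real.sin_sub]
    congr 1
    ring
  simp_rw [h]
  rw [integral_shift_of_periodic (f := fun θ => |Real.sin θ|) (fun θ => by simp), integral_abs_sin,
    smul_eq_mul]
  field_simp
  norm_num

theorem lintegral_abs_crossDet :
    ∫⁻ p, ENNReal.ofReal |crossDet p.1 p.2| ∂(stepLaw.prod stepLaw)
      = ENNReal.ofReal (2 / Real.pi) := by
  have hc := continuous_crossDet
  rw [lintegral_prod _ (by fun_prop)]
  rw [lintegral_congr_ae (g := fun _ => ENNReal.ofReal (2 / Real.pi))]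
  · simp
  filter_upwards [ae_stepLaw_norm_eq_one] with u hu
  rw [← integral_abs_crossDet hu, ofReal_integral_eq_lintegral_ofReal]
  · have hv : ∀ᵐ v ∂stepLaw, ‖|crossDet u v|‖ ≤ 2 := by
      filter_upwards [ae_stepLaw_norm_eq_one] with v hv
      rw [Real.norm_of_nonneg (abs_nonneg _), crossDet]
      have a1 := Complex.abs_re_le_norm u
      have a2 := Complex.abs_im_le_norm u
      have a3 := Complex.abs_re_le_norm v
      have a4 := Complex.abs_im_le_norm v
      rw [hu] at a1 a2
      rw [hv] at a3 a4
      refine (abs_sub _ _).trans ?_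
      rw [abs_mul, abs_mul]
      nlinarith [abs_nonneg u.re, abs_nonneg u.im, abs_nonneg v.re, abs_nonneg v.im]
    exact (integrable_const (2 : ℝ)).mono' (Continuous.aestronglyMeasurable
      (hc.comp (by fun_prop : Continuous fun v : ℂ => (u, v))).abs) hv
  · exact Eventually.of_forall fun v => abs_nonneg _

/-! ### Independence of two sides, the gap and the remaining steps -/

theorem iIndepFun_steps (n : ℕ) :
    ProbabilityTheory.iIndepFun (fun (j : Fin n) (s : Fin n → ℂ) => s j) (stepsLaw n) :=
  ProbabilityTheory.iIndepFun_pi (μ := fun _ : Fin n => stepLaw) (X := fun _ => id)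
    fun _ => aemeasurable_id

/-- Expresses a sum over `A` as a function of the coordinates in a larger block, as independence of
disjoint blocks requires. -/
theorem sum_subtype_ite {n : ℕ} {A S : Finset (Fin n)} (h : A ⊆ S) (s : Fin n → ℂ) :
    ∑ j : S, (if (j : Fin n) ∈ A then s j else 0) = ∑ j ∈ A, s j := by
  rw [Finset.sum_coe_sort S fun j => if j ∈ A then s j else 0, Finset.sum_ite_mem,
    Finset.inter_eq_right.2 h]

/-- The pair of sides, the displacement between them, and the rest of the displacement. -/
def sidesAndGap {n : ℕ} (k l : Fin n) (A : Finset (Fin n)) (s : Fin n → ℂ) : (ℂ × ℂ) × ℂ :=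
  ((s k, s l), ∑ j ∈ A, s j)

theorem continuous_sidesAndGap {n : ℕ} (k l : Fin n) (A : Finset (Fin n)) :
    Continuous (sidesAndGap k l A) := by
  unfold sidesAndGap; fun_prop

theorem map_sidesAndGap {n : ℕ} {k l : Fin n} {A : Finset (Fin n)} (hkl : k ≠ l) (hk : k ∉ A)
    (hl : l ∉ A) :
    (stepsLaw n).map (sidesAndGap k l A)
      = (stepLaw.prod stepLaw).prod ((stepsLaw n).map fun s => ∑ j ∈ A, s j) := by
  have hmeas : ∀ j : Fin n, Measurable fun s : Fin n → ℂ => s j := fun j => measurable_pi_apply j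
  have hev : ∀ j : Fin n, (stepsLaw n).map (fun s => s j) = stepLaw := fun j =>
    (measurePreserving_eval (fun _ : Fin n => stepLaw) j).map_eq
  have h1 : (stepsLaw n).map (fun s => (s k, s l)) = stepLaw.prod stepLaw := by
    have h := (iIndepFun_steps n).indepFun hkl
    rw [ProbabilityTheory.indepFun_iff_map_prod_eq_prod_map_map (hmeas k).aemeasurable
      (hmeas l).aemeasurable, hev, hev] at h
    exact h
  have hdisj : Disjoint ({k, l} : Finset (Fin n)) A := by
    simp [Finset.disjoint_left, hk, hl]
  have h2 := ((iIndepFun_steps n).indepFun_finset {k, l} A hdisj hmeas).comp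
    (φ := fun x : (({k, l} : Finset (Fin n)) → ℂ) => (x ⟨k, by simp⟩, x ⟨l, by simp⟩))
    (ψ := fun x : (A → ℂ) => ∑ j, x j) (by fun_prop) (by fun_prop)
  have e2 : ((fun x : (A → ℂ) => ∑ j, x j) ∘ fun (s : Fin n → ℂ) (j : A) => s j)
      = fun s => ∑ j ∈ A, s j := by
    ext1 s
    exact Finset.sum_coe_sort A fun j => s j
  rw [e2, ProbabilityTheory.indepFun_iff_map_prod_eq_prod_map_map
    (Measurable.aemeasurable (by fun_prop)) (Measurable.aemeasurable (by fun_prop))] at h2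
  rw [← h1]
  exact h2

theorem map_sidesAndGap_prod {n : ℕ} {k l : Fin n} {A B : Finset (Fin n)} (hk : k ∉ B)
    (hl : l ∉ B) (hAB : Disjoint A B) :
    (stepsLaw n).map (fun s => (sidesAndGap k l A s, ∑ j ∈ B, s j))
      = ((stepsLaw n).map (sidesAndGap k l A)).prod ((stepsLaw n).map fun s => ∑ j ∈ B, s j) := by
  have hmeas : ∀ j : Fin n, Measurable fun s : Fin n → ℂ => s j := fun j => measurable_pi_apply j
  have hdisj : Disjoint ({k, l} ∪ A : Finset (Fin n)) B := by
    rw [Finset.disjoint_union_left]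
    exact ⟨by simp [Finset.disjoint_left, hk, hl], hAB⟩
  have h2 := ((iIndepFun_steps n).indepFun_finset ({k, l} ∪ A) B hdisj hmeas).comp
    (φ := fun x : (({k, l} ∪ A : Finset (Fin n)) → ℂ) =>
      (((x ⟨k, by simp⟩, x ⟨l, by simp⟩), ∑ j : ({k, l} ∪ A : Finset (Fin n)), if (j : Fin n) ∈ A then x j else 0) : (ℂ × ℂ) × ℂ))
    (ψ := fun x : (B → ℂ) => ∑ j, x j)
    (by
      refine Measurable.prodMk (by fun_prop) (Finset.measurable_fun_sum _ fun j _ => ?_)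
      split_ifs <;> fun_prop) (by fun_prop)
  have e1 : ((fun x : (({k, l} ∪ A : Finset (Fin n)) → ℂ) =>
      (((x ⟨k, by simp⟩, x ⟨l, by simp⟩), ∑ j : ({k, l} ∪ A : Finset (Fin n)), if (j : Fin n) ∈ A then x j else 0) : (ℂ × ℂ) × ℂ))
      ∘ fun (s : Fin n → ℂ) (j : ({k, l} ∪ A : Finset (Fin n))) => s j) = sidesAndGap k l A := by
    ext1 s
    simp only [Function.comp_apply, sidesAndGap]
    rw [sum_subtype_ite Finset.subset_union_right]
  have e2 : ((fun x : (B → ℂ) => ∑ j, x j) ∘ fun (s : Fin n → ℂ) (j : B) => s j)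
      = fun s => ∑ j ∈ B, s j := by
    ext1 s
    exact Finset.sum_coe_sort B fun j => s j
  rw [e1, e2, ProbabilityTheory.indepFun_iff_map_prod_eq_prod_map_map
    (continuous_sidesAndGap k l A).aemeasurable (Measurable.aemeasurable (by fun_prop))] at h2
  exact h2

theorem ae_prod_stepLaw_norm_eq_one :
    ∀ᵐ p ∂(stepLaw.prod stepLaw), ‖p.1‖ = 1 ∧ ‖p.2‖ = 1 :=
  (Measure.quasiMeasurePreserving_fst.ae ae_stepLaw_norm_eq_one).and
    (Measure.quasiMeasurePreserving_snd.ae ae_stepLaw_norm_eq_one)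

/-! ### Comparison of configuration laws with a fixed finite measure -/

/-- The configurations to which the local limit theorem applies. -/
def boundedConfigs : Set ((ℂ × ℂ) × ℂ) := {q | ‖q.2‖ < 3 ∧ ‖q.1.1 + q.1.2 + q.2‖ < 3}

theorem isOpen_boundedConfigs : IsOpen boundedConfigs := by
  have hl : ∀ f : (ℂ × ℂ) × ℂ → ℝ, Continuous f → IsOpen {q | f q < 3} :=
    fun f hf => isOpen_lt hf continuous_const
  exact (hl _ (by fun_prop)).inter (hl _ (by fun_prop))

/-- Two independent steps and a displacement that is uniform near the origin. -/
def configMeasure : Measure ((ℂ × ℂ) × ℂ) :=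
  ((stepLaw.prod stepLaw).prod volume).restrict boundedConfigs

theorem configMeasure_apply {Q : Set ((ℂ × ℂ) × ℂ)} (hQ : MeasurableSet Q)
    (hQb : Q ⊆ boundedConfigs) :
    configMeasure Q = ∫⁻ p, volume (Prod.mk p ⁻¹' Q) ∂(stepLaw.prod stepLaw) := by
  rw [configMeasure, Measure.restrict_apply hQ, Set.inter_eq_left.2 hQb, Measure.prod_apply hQ]

theorem preimage_subset_ball {Q : Set ((ℂ × ℂ) × ℂ)} (hQb : Q ⊆ boundedConfigs) (p : ℂ × ℂ) :
    Prod.mk p ⁻¹' Q ⊆ Metric.ball 0 4 := fun x hx => by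
  have := (hQb hx).1
  rw [mem_ball_zero_iff]
  simp only at this
  linarith

instance : IsFiniteMeasure configMeasure := by
  refine ⟨?_⟩
  have h : configMeasure Set.univ = configMeasure boundedConfigs := by
    rw [configMeasure, Measure.restrict_apply_univ,
      Measure.restrict_apply isOpen_boundedConfigs.measurableSet, Set.inter_self]
  rw [h, configMeasure_apply isOpen_boundedConfigs.measurableSet subset_rfl]
  calc _ ≤ ∫⁻ _p, volume (Metric.ball (0 : ℂ) 4) ∂(stepLaw.prod stepLaw) :=
        lintegral_mono fun p => measure_mono (preimage_subset_ball subset_rfl p)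
    _ < ⊤ := by
        rw [lintegral_const, measure_univ, mul_one]
        exact measure_ball_lt_top

/-- The bounded configurations whose sides cross. -/
def crossingConfigs : Set ((ℂ × ℂ) × ℂ) := combinationSet openSquare ∩ boundedConfigs

theorem measurableSet_crossingConfigs : MeasurableSet crossingConfigs :=
  measurableSet_combinationSet_openSquare.inter isOpen_boundedConfigs.measurableSet

/-- The radius 3 exceeds the bound 2 forced by a crossing of unit sides, so no crossing is lost. It
also leaves room for a displacement `ε ≤ 1` inside the ball of radius 4 of the local limit theorem.
-/
theorem mem_crossingConfigs_iff {q : (ℂ × ℂ) × ℂ} (h1 : ‖q.1.1‖ = 1) (h2 : ‖q.1.2‖ = 1) :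
    q ∈ crossingConfigs ↔ q ∈ combinationSet openSquare := by
  refine ⟨fun h => h.1, fun h => ⟨h, ?_⟩⟩
  have := norm_le_of_mem_combinationSet (x := q.2) h1 h2 h
  exact ⟨by linarith [this.1], by linarith [this.2]⟩

theorem configMeasure_real_crossingConfigs :
    configMeasure.real crossingConfigs = 2 / Real.pi := by
  have hpi := Real.pi_pos
  rw [measureReal_def, configMeasure_apply measurableSet_crossingConfigs Set.inter_subset_right,
    lintegral_congr_ae (g := fun p => ENNReal.ofReal |crossDet p.1 p.2|), lintegral_abs_crossDet,
    ENNReal.toReal_ofReal (by positivity)]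
  filter_upwards [ae_prod_stepLaw_norm_eq_one] with p hp
  rw [← volume_preimage_combinationSet_openSquare]
  congr 1
  ext x
  exact mem_crossingConfigs_iff hp.1 hp.2

/-- The law of a configuration of two steps, alone and together with a near return of the walk,
is comparable to `configMeasure`. -/
theorem exists_config_bounds :
    ∃ D : ℝ, 0 < D ∧ ∀ (n : ℕ) (k l : Fin n) (A B : Finset (Fin n)), k ≠ l → k ∉ A → l ∉ A →
      25 ≤ A.card → ∀ Q, MeasurableSet Q → Q ⊆ boundedConfigs →
      (1 / (Real.pi * A.card) * (1 - D / A.card) * configMeasure.real Q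
          ≤ (stepsLaw n).real (sidesAndGap k l A ⁻¹' Q) ∧
        (stepsLaw n).real (sidesAndGap k l A ⁻¹' Q)
          ≤ 1 / (Real.pi * A.card) * (1 + D / A.card) * configMeasure.real Q) ∧
      (k ∉ B → l ∉ B → Disjoint A B → 25 ≤ B.card → ∀ ε : ℝ, 0 < ε → ε ≤ 1 →
        (ε ^ 2 / B.card * (1 - D / B.card)) * (stepsLaw n).real (sidesAndGap k l A ⁻¹' Q)
          ≤ (stepsLaw n).real (sidesAndGap k l A ⁻¹' Q ∩
            {s | ‖s k + s l + ∑ j ∈ A, s j + ∑ j ∈ B, s j‖ < ε}) ∧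
        (stepsLaw n).real (sidesAndGap k l A ⁻¹' Q ∩
            {s | ‖s k + s l + ∑ j ∈ A, s j + ∑ j ∈ B, s j‖ < ε})
          ≤ (ε ^ 2 / B.card * (1 + D / B.card)) *
            (stepsLaw n).real (sidesAndGap k l A ⁻¹' Q)) := by
  obtain ⟨D, hD, h⟩ := exists_local_limit
  have hpi := Real.pi_pos
  refine ⟨D, hD, fun n k l A B hkl hkA hlA hA Q hQ hQb => ⟨?_, fun hkB hlB hAB hB ε hε hε1 => ?_⟩⟩
  · have hm0 : (0 : ℝ) < A.card := by exact_mod_cast (by omega : 0 < A.card)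
    set ρ := (stepsLaw n).map fun s => ∑ j ∈ A, s j with hρ
    have hb := h A.card hA ρ inferInstance (charFun_map_sum A)
    have hP : (stepsLaw n) (sidesAndGap k l A ⁻¹' Q)
        = ∫⁻ p, ρ (Prod.mk p ⁻¹' Q) ∂(stepLaw.prod stepLaw) := by
      rw [← Measure.map_apply (continuous_sidesAndGap k l A).measurable hQ,
        map_sidesAndGap hkl hkA hlA, Measure.prod_apply hQ]
    have hms : ∀ p, MeasurableSet (Prod.mk p ⁻¹' Q) := fun p =>
      measurable_prodMk_left hQ
    have hI : ∀ c : ℝ, ∫⁻ p, ENNReal.ofReal c * volume (Prod.mk p ⁻¹' Q) ∂(stepLaw.prod stepLaw)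
        = ENNReal.ofReal (c * configMeasure.real Q) := fun c => by
      rw [lintegral_const_mul' _ _ ENNReal.ofReal_ne_top, ← configMeasure_apply hQ hQb,
        ENNReal.ofReal_mul' measureReal_nonneg, ofReal_measureReal]
    constructor
    · rw [measureReal_def (stepsLaw n), ← ENNReal.ofReal_le_iff_le_toReal (measure_ne_top _ _),
        ← hI, hP]
      exact lintegral_mono fun p => (hb _ (hms p) (preimage_subset_ball hQb p)).1
    · refine ENNReal.toReal_le_of_le_ofReal (by positivity) ?_
      rw [← hI, hP]
      exact lintegral_mono fun p => (hb _ (hms p) (preimage_subset_ball hQb p)).2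
  · have hm0 : (0 : ℝ) < B.card := by exact_mod_cast (by omega : 0 < B.card)
    set ρ := (stepsLaw n).map fun s => ∑ j ∈ B, s j with hρ
    have hb := h B.card hB ρ inferInstance (charFun_map_sum B)
    set κ := (stepsLaw n).map (sidesAndGap k l A) with hκ
    set R : Set (((ℂ × ℂ) × ℂ) × ℂ) := {r | r.1 ∈ Q ∧ ‖r.1.1.1 + r.1.1.2 + r.1.2 + r.2‖ < ε} with hR
    have hRm : MeasurableSet R := by
      refine (measurable_fst hQ).inter ?_
      exact measurableSet_lt
        (f := fun r : ((ℂ × ℂ) × ℂ) × ℂ => ‖r.1.1.1 + r.1.1.2 + r.1.2 + r.2‖) (by fun_prop)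
        measurable_const
    have hP : (stepsLaw n) (sidesAndGap k l A ⁻¹' Q ∩
            {s | ‖s k + s l + ∑ j ∈ A, s j + ∑ j ∈ B, s j‖ < ε})
        = ∫⁻ q, ρ (Prod.mk q ⁻¹' R) ∂κ := by
      rw [← Measure.prod_apply hRm, ← map_sidesAndGap_prod hkB hlB hAB, Measure.map_apply _ hRm]
      · rfl
      · exact Measurable.prodMk (continuous_sidesAndGap k l A).measurable (by fun_prop)
    have hκQ : κ Q = (stepsLaw n) (sidesAndGap k l A ⁻¹' Q) :=
      Measure.map_apply (continuous_sidesAndGap k l A).measurable hQ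
    have hsec : ∀ q,
        ENNReal.ofReal (ε ^ 2 / B.card * (1 - D / B.card)) * Q.indicator 1 q
          ≤ ρ (Prod.mk q ⁻¹' R) ∧ ρ (Prod.mk q ⁻¹' R)
          ≤ ENNReal.ofReal (ε ^ 2 / B.card * (1 + D / B.card)) * Q.indicator 1 q := by
      intro q
      by_cases hqQ : q ∈ Q
      -- Given the configuration, the walk nearly returns exactly when the outer steps sum to a
      -- point within `ε` of the negated chord. This ball has area `π ε²`, and the density `1 / (π
      -- b)`, with `b = B.card`, turns it into `ε² / b`.
      · have hball : Prod.mk q ⁻¹' R = Metric.ball (-(q.1.1 + q.1.2 + q.2)) ε := by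
          ext y
          rw [Metric.mem_ball, dist_eq_norm, sub_neg_eq_add, add_comm y]
          simp [hR, hqQ]
        have hle := (hQb hqQ).2
        have hsub : Metric.ball (-(q.1.1 + q.1.2 + q.2)) ε ⊆ Metric.ball 0 4 := by
          refine Metric.ball_subset_ball' ?_
          rw [dist_zero_right, norm_neg]
          linarith
        have hbq := hb _ Metric.isOpen_ball.measurableSet hsub
        rw [volume_ball_ofReal hε.le, ← ENNReal.ofReal_mul' (by positivity),
          ← ENNReal.ofReal_mul' (by positivity)] at hbq
        rw [hball, Set.indicator_of_mem hqQ, Pi.one_apply, mul_one, mul_one]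
        convert hbq using 3 <;> field_simp
      · have : Prod.mk q ⁻¹' R = ∅ := by
          ext y; simp [hR, hqQ]
        simp [this, hqQ]
    have hI : ∀ c : ℝ, ∫⁻ q, ENNReal.ofReal c * Q.indicator 1 q ∂κ
        = ENNReal.ofReal (c * (stepsLaw n).real (sidesAndGap k l A ⁻¹' Q)) := fun c => by
      rw [lintegral_const_mul' _ _ ENNReal.ofReal_ne_top, lintegral_indicator_one hQ,
        hκQ, ENNReal.ofReal_mul' measureReal_nonneg, ofReal_measureReal]
    constructor
    · rw [measureReal_def (stepsLaw n) (_ ∩ _),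
        ← ENNReal.ofReal_le_iff_le_toReal (measure_ne_top _ _), ← hI, hP]
      exact lintegral_mono fun q => (hsec q).1
    · refine ENNReal.toReal_le_of_le_ofReal (by positivity) ?_
      rw [← hI, hP]
      exact lintegral_mono fun q => (hsec q).2

/-! ### Configurations along a path -/

/-- The two sides `k`, `l` of a path and the displacement between them. -/
def config {n : ℕ} (k l : Fin n) (X : Fin (n + 1) → ℂ) : (ℂ × ℂ) × ℂ :=
  ((X k.succ - X k.castSucc, X l.succ - X l.castSucc), X l.castSucc - X k.succ)

theorem continuous_config {n : ℕ} (k l : Fin n) : Continuous (config k l) := by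
  unfold config; fun_prop

theorem cross_iff_config_mem {n : ℕ} (X : Fin (n + 1) → ℂ) (k l : Fin n) :
    Cross X k l ↔ config k l X ∈ combinationSet openSquare := by
  unfold Cross
  rw [openSegment_eq_image, openSegment_eq_image]
  constructor
  · rintro ⟨p, ⟨θ, hθ, h1⟩, ⟨τ, hτ, h2⟩⟩
    -- The gap starts at the end of side `k`, so side `k` enters with the fraction still left after
    -- the meeting point.
    refine ⟨⟨1 - θ, τ⟩, ⟨⟨by linarith [hθ.2], by linarith [hθ.1]⟩, hτ⟩, ?_⟩
    have e : (1 - τ) • X l.castSucc + τ • X l.succ = (1 - θ) • X k.castSucc + θ • X k.succ :=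
      h2.trans h1.symm
    simp only [config, negCombination_apply, smul_sub, sub_smul, one_smul] at e ⊢
    linear_combination e
  · rintro ⟨z, ⟨h1, h2⟩, e⟩
    refine ⟨_, ⟨1 - z.re, ⟨by linarith [h1.2], by linarith [h1.1]⟩, rfl⟩, ⟨z.im, h2, ?_⟩⟩
    simp only [config, negCombination_apply, smul_sub, sub_smul, one_smul] at e ⊢
    linear_combination e

theorem measurableSet_cross {n : ℕ} (k l : Fin n) :
    MeasurableSet {X : Fin (n + 1) → ℂ | Cross X k l} := by
  have : {X : Fin (n + 1) → ℂ | Cross X k l} = config k l ⁻¹' combinationSet openSquare := by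
    ext X; exact cross_iff_config_mem X k l
  rw [this]
  exact (continuous_config k l).measurable measurableSet_combinationSet_openSquare

theorem path_succ {n : ℕ} (s : Fin n → ℂ) (k : Fin n) :
    path s k.succ = path s k.castSucc + s k := by
  have : (Finset.univ.filter fun j : Fin n => j.castSucc < k.succ)
      = insert k (Finset.univ.filter fun j : Fin n => j.castSucc < k.castSucc) := by
    ext j
    simp [Fin.castSucc_lt_succ_iff, le_iff_eq_or_lt]
  rw [path, path, this, Finset.sum_insert (by simp), add_comm]

theorem path_castSucc {n : ℕ} (s : Fin n → ℂ) {k l : Fin n} (hkl : k < l) :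
    path s l.castSucc = path s k.succ + ∑ j ∈ Finset.Ioo k l, s j := by
  have : (Finset.univ.filter fun j : Fin n => j.castSucc < l.castSucc)
      = (Finset.univ.filter fun j : Fin n => j.castSucc < k.succ) ∪ Finset.Ioo k l := by
    ext j
    simp only [Finset.mem_filter, Finset.mem_univ, true_and, Finset.mem_union, Finset.mem_Ioo,
      Fin.castSucc_lt_succ_iff, Fin.castSucc_lt_castSucc_iff]
    constructor
    · intro h
      rcases le_or_gt j k with h' | h'
      · exact Or.inl h'
      · exact Or.inr ⟨h', h⟩
    · rintro (h | h)
      · exact h.trans_lt hkl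
      · exact h.2
  rw [path, path, this, Finset.sum_union]
  rw [Finset.disjoint_left]
  intro j hj hj'
  simp only [Finset.mem_filter, Finset.mem_univ, true_and, Fin.castSucc_lt_succ_iff,
    Finset.mem_Ioo] at hj hj'
  exact absurd hj (not_le.2 hj'.1)

theorem config_path {n : ℕ} (s : Fin n → ℂ) {k l : Fin n} (hkl : k < l) :
    config k l (path s) = sidesAndGap k l (Finset.Ioo k l) s := by
  rw [config, sidesAndGap, path_succ, path_succ, path_castSucc s hkl, path_succ]
  simp

/-- The sides other than `k`, `l` and those between them. -/
def outerSides {n : ℕ} (k l : Fin n) : Finset (Fin n) := (insert k (insert l (Finset.Ioo k l)))ᶜ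

theorem sum_eq_sides_add {n : ℕ} (s : Fin n → ℂ) {k l : Fin n} (hkl : k < l) :
    ∑ j, s j = s k + s l + ∑ j ∈ Finset.Ioo k l, s j + ∑ j ∈ outerSides k l, s j := by
  rw [outerSides, ← Finset.sum_add_sum_compl (insert k (insert l (Finset.Ioo k l))) s,
    Finset.sum_insert (by simp [hkl.ne]), Finset.sum_insert (by simp)]
  ring

theorem card_outerSides {n : ℕ} {k l : Fin n} (hkl : k < l) :
    (outerSides k l).card + (Finset.Ioo k l).card + 2 = n := by
  have h := Finset.card_compl_add_card (insert k (insert l (Finset.Ioo k l)))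
  rw [Finset.card_insert_of_notMem (by simp [hkl.ne]), Finset.card_insert_of_notMem (by simp),
    Fintype.card_fin] at h
  rw [outerSides]
  omega

theorem walkLaw_apply_config {n : ℕ} {k l : Fin n} (hkl : k < l) {Q : Set ((ℂ × ℂ) × ℂ)}
    (hQ : MeasurableSet Q) :
    (walkLaw n).real (config k l ⁻¹' Q)
      = (stepsLaw n).real (sidesAndGap k l (Finset.Ioo k l) ⁻¹' Q) := by
  rw [walkLaw, map_measureReal_apply (continuous_path n).measurable
    ((continuous_config k l).measurable hQ)]
  congr 1
  ext s
  simp only [Set.mem_preimage, config_path s hkl]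

/-- The walk conditioned on a near return. -/
def condWalk (n : ℕ) (ε : ℝ) : Measure (Fin (n + 1) → ℂ) :=
  ProbabilityTheory.cond (walkLaw n) {X : Fin (n + 1) → ℂ | dist (X (Fin.last n)) (X 0) < ε}

theorem condWalk_real_config {n : ℕ} {k l : Fin n} (hkl : k < l) {Q : Set ((ℂ × ℂ) × ℂ)}
    (hQ : MeasurableSet Q) (ε : ℝ) :
    (condWalk n ε).real (config k l ⁻¹' Q) = (stepsLaw n).real
      (sidesAndGap k l (Finset.Ioo k l) ⁻¹' Q ∩ {s | ‖s k + s l + ∑ j ∈ Finset.Ioo k l, s j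
        + ∑ j ∈ outerSides k l, s j‖ < ε}) / (stepsLaw n).real (nearReturn n ε) := by
  rw [condWalk, cond_walkLaw, map_measureReal_apply (continuous_path n).measurable
    ((continuous_config k l).measurable hQ), ProbabilityTheory.cond, measureReal_ennreal_smul_apply,
    measureReal_restrict_apply ((continuous_path n).measurable
      ((continuous_config k l).measurable hQ)), ENNReal.toReal_inv, ← measureReal_def,
    inv_mul_eq_div]
  congr 2
  ext s
  simp only [Set.mem_inter_iff, Set.mem_preimage, config_path s hkl, nearReturn,
    Set.mem_ofPred_eq, sum_eq_sides_add s hkl]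

/-! ### Passage to the weak limit -/

/-- Upper bounds by a finite measure pass to weak limits. -/
theorem measure_preimage_le_of_tendsto {X Y : Type*} [TopologicalSpace X] [MeasurableSpace X]
    [BorelSpace X] [HasOuterApproxClosed X] [PseudoMetricSpace Y] [MeasurableSpace Y]
    [BorelSpace Y] {μs : ℕ → ProbabilityMeasure X} {μ : ProbabilityMeasure X}
    (h : Tendsto μs atTop (𝓝 μ)) {Ψ : X → Y} (hΨ : Continuous Ψ) {N : Measure Y}
    [IsFiniteMeasure N] {Ω : Set Y} (hΩ : IsOpen Ω)
    (hle : ∀ j, ∀ Q, MeasurableSet Q → Q ⊆ Ω → (μs j : Measure X) (Ψ ⁻¹' Q) ≤ N Q)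
    {Q : Set Y} (hQΩ : Q ⊆ Ω) : (μ : Measure X) (Ψ ⁻¹' Q) ≤ N Q := by
  -- Regularity of `N` replaces `Q` by an open set, to which the portmanteau inequality applies;
  -- nothing is needed about the boundary of `Q`. The lower bound uses closed sets in the same way.
  rw [Q.measure_eq_iInf_isOpen N]
  refine le_iInf fun U => le_iInf fun hQU => le_iInf fun hU => ?_
  calc (μ : Measure X) (Ψ ⁻¹' Q) ≤ (μ : Measure X) (Ψ ⁻¹' (U ∩ Ω)) :=
        measure_mono (Set.preimage_mono (Set.subset_inter hQU hQΩ))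
    _ ≤ liminf (fun j => (μs j : Measure X) (Ψ ⁻¹' (U ∩ Ω))) atTop :=
        ProbabilityMeasure.le_liminf_measure_open_of_tendsto h ((hU.inter hΩ).preimage hΨ)
    _ ≤ liminf (fun _ : ℕ => N U) atTop := by
        refine liminf_le_liminf (Eventually.of_forall fun j => ?_)
        exact (hle j _ (hU.inter hΩ).measurableSet Set.inter_subset_right).trans
          (measure_mono Set.inter_subset_left)
    _ = N U := liminf_const _

/-- Lower bounds by a finite measure pass to weak limits. -/
theorem le_measure_preimage_of_tendsto {X Y : Type*} [TopologicalSpace X] [MeasurableSpace X]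
    [BorelSpace X] [HasOuterApproxClosed X] [PseudoMetricSpace Y] [MeasurableSpace Y]
    [BorelSpace Y] {μs : ℕ → ProbabilityMeasure X} {μ : ProbabilityMeasure X}
    (h : Tendsto μs atTop (𝓝 μ)) {Ψ : X → Y} (hΨ : Continuous Ψ) {N : Measure Y}
    [IsFiniteMeasure N] {Ω : Set Y}
    (hle : ∀ j, ∀ Q, MeasurableSet Q → Q ⊆ Ω → N Q ≤ (μs j : Measure X) (Ψ ⁻¹' Q))
    {Q : Set Y} (hQ : MeasurableSet Q) (hQΩ : Q ⊆ Ω) : N Q ≤ (μ : Measure X) (Ψ ⁻¹' Q) := by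
  rw [hQ.measure_eq_iSup_isClosed_of_ne_top (measure_ne_top N Q)]
  refine iSup_le fun F => iSup_le fun hFQ => iSup_le fun hF => ?_
  calc N F = limsup (fun _ : ℕ => N F) atTop := (limsup_const _).symm
    _ ≤ limsup (fun j => (μs j : Measure X) (Ψ ⁻¹' F)) atTop :=
        limsup_le_limsup (Eventually.of_forall fun j =>
          hle j _ hF.measurableSet (hFQ.trans hQΩ))
    _ ≤ (μ : Measure X) (Ψ ⁻¹' F) :=
        ProbabilityMeasure.limsup_measure_closed_le_of_tendsto h (hF.preimage hΨ)
    _ ≤ _ := measure_mono (Set.preimage_mono hFQ)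

/-- The three factors come from the density of the gap, from the probability `ε² / b` that the outer
steps close the walk, and from division by the near-return probability `ε² / n`. The cancellation of
`ε` makes the bounds uniform, as the weak limit requires. -/
theorem exists_condWalk_config_bounds :
    ∃ D : ℝ, 0 < D ∧ ∀ (n : ℕ) (k l : Fin n) (a b : ℕ), k < l → (Finset.Ioo k l).card = a →
      (outerSides k l).card = b → 25 ≤ a → 25 ≤ b → D < a → D < b →
      ∀ ε : ℝ, 0 < ε → ε ≤ 1 → IsProbabilityMeasure (condWalk n ε) ∧
      ∀ Q, MeasurableSet Q → Q ⊆ boundedConfigs →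
        (1 / (Real.pi * a) * (1 - D / a)) * (1 / b * (1 - D / b)) * (n / (1 + D / n))
          * configMeasure.real Q ≤ (condWalk n ε).real (config k l ⁻¹' Q) ∧
        (condWalk n ε).real (config k l ⁻¹' Q) ≤
          (1 / (Real.pi * a) * (1 + D / a)) * (1 / b * (1 + D / b)) * (n / (1 - D / n))
            * configMeasure.real Q := by
  obtain ⟨D₁, hD₁, h₁⟩ := exists_stepsLaw_nearReturn_bounds
  obtain ⟨D₂, hD₂, h₂⟩ := exists_config_bounds
  set D := max D₁ D₂
  have e₁ : D₁ ≤ D := le_max_left _ _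
  have e₂ : D₂ ≤ D := le_max_right _ _
  have hD0 : 0 < D := hD₁.trans_le e₁
  refine ⟨D, hD0, fun n k l a b hkl ha hb ha25 hb25 haD hbD ε hε hε1 => ?_⟩
  have hcard := card_outerSides hkl
  have hpi := Real.pi_pos
  have ha0 : (0 : ℝ) < a := by exact_mod_cast (by omega : 0 < a)
  have hb0 : (0 : ℝ) < b := by exact_mod_cast (by omega : 0 < b)
  have hn0 : (0 : ℝ) < n := by exact_mod_cast (by omega : 0 < n)
  have han : (a : ℝ) ≤ n := by exact_mod_cast (by omega : a ≤ n)
  have hDa : D / a < 1 := (div_lt_one ha0).2 haD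
  have hDb : D / b < 1 := (div_lt_one hb0).2 hbD
  have hDn : D / n < 1 := (div_lt_one hn0).2 (haD.trans_le han)
  obtain ⟨hlow, hup⟩ := h₁ n (by omega) ε hε hε1
  have hlow' : (1 - D / n) * (ε ^ 2 / n) ≤ (stepsLaw n).real (nearReturn n ε) :=
    le_trans (by gcongr) hlow
  have hup' : (stepsLaw n).real (nearReturn n ε) ≤ (1 + D / n) * (ε ^ 2 / n) :=
    hup.trans (by gcongr)
  have hDn' : 0 < 1 - D / n := by linarith
  have hpos : 0 < (stepsLaw n).real (nearReturn n ε) := lt_of_lt_of_le (by positivity) hlow'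
  refine ⟨?_, fun Q hQ hQb => ?_⟩
  · rw [condWalk, cond_walkLaw]
    have := ProbabilityTheory.cond_isProbabilityMeasure (μ := stepsLaw n) (s := nearReturn n ε)
      (fun h => by simp [measureReal_def, h] at hpos)
    exact Measure.isProbabilityMeasure_map (continuous_path n).aemeasurable
  obtain ⟨⟨q1, q2⟩, hq⟩ := h₂ n k l (Finset.Ioo k l) (outerSides k l) hkl.ne (by simp) (by simp)
    (by omega) Q hQ hQb
  obtain ⟨q3, q4⟩ := hq (by simp [outerSides]) (by simp [outerSides]) (by
    rw [Finset.disjoint_left]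
    intro j hj hj'
    simp only [outerSides, Finset.mem_compl, Finset.mem_insert, not_or] at hj'
    exact hj'.2.2 hj) (by omega) ε hε hε1
  rw [condWalk_real_config hkl hQ]
  rw [ha] at q1 q2
  rw [hb] at q3 q4
  set M := configMeasure.real Q
  have hM : 0 ≤ M := measureReal_nonneg
  constructor
  · rw [le_div_iff₀ hpos]
    have hD2b : D₂ / b ≤ D / b := by gcongr
    have hD2a : D₂ / a ≤ D / a := by gcongr
    have t1 : 0 ≤ 1 - D / b := by linarith
    have t2 : 0 ≤ 1 - D / a := by linarith
    have t3 : 0 ≤ 1 - D₂ / b := by linarith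
    have t4 : 0 ≤ ε ^ 2 / b * (1 - D₂ / b) := by positivity
    calc (1 / (Real.pi * a) * (1 - D / a)) * (1 / b * (1 - D / b)) * (n / (1 + D / n)) * M
          * (stepsLaw n).real (nearReturn n ε)
        ≤ (1 / (Real.pi * a) * (1 - D / a)) * (1 / b * (1 - D / b)) * (n / (1 + D / n)) * M
          * ((1 + D / n) * (ε ^ 2 / n)) := by gcongr
      _ = (ε ^ 2 / b * (1 - D / b)) * (1 / (Real.pi * a) * (1 - D / a) * M) := by field_simp
      _ ≤ (ε ^ 2 / b * (1 - D₂ / b)) * (1 / (Real.pi * a) * (1 - D₂ / a) * M) := by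
          gcongr
      _ ≤ (ε ^ 2 / b * (1 - D₂ / b)) *
          (stepsLaw n).real (sidesAndGap k l (Finset.Ioo k l) ⁻¹' Q) := by
          gcongr
      _ ≤ _ := q3
  · rw [div_le_iff₀ hpos]
    calc _ ≤ _ := q4
      _ ≤ (ε ^ 2 / b * (1 + D₂ / b)) * (1 / (Real.pi * a) * (1 + D₂ / a) * M) := by gcongr
      _ ≤ (ε ^ 2 / b * (1 + D / b)) * (1 / (Real.pi * a) * (1 + D / a) * M) := by gcongr
      _ = (1 / (Real.pi * a) * (1 + D / a)) * (1 / b * (1 + D / b)) * (n / (1 - D / n)) * M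
          * ((1 - D / n) * (ε ^ 2 / n)) := by
          have : (n : ℝ) - D ≠ 0 := (sub_pos.2 (haD.trans_le han)).ne'
          field_simp
      _ ≤ _ := by gcongr

theorem IsPolygonLaw.exists_seq {n : ℕ} {μ : ProbabilityMeasure (Fin (n + 1) → ℂ)}
    (hμ : IsPolygonLaw n μ)
    (hp : ∀ ε : ℝ, 0 < ε → ε ≤ 1 → IsProbabilityMeasure (condWalk n ε)) :
    ∃ (ε : ℕ → ℝ) (μs : ℕ → ProbabilityMeasure (Fin (n + 1) → ℂ)),
      (∀ j, 0 < ε j ∧ ε j ≤ 1 ∧ (μs j : Measure (Fin (n + 1) → ℂ)) = condWalk n (ε j)) ∧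
      Tendsto μs atTop (𝓝 μ) := by
  have hε : ∀ j : ℕ, (0 : ℝ) < 1 / (j + 1) ∧ (1 : ℝ) / (j + 1) ≤ 1 := fun j => by
    have hj : (0 : ℝ) ≤ j := Nat.cast_nonneg j
    exact ⟨by positivity, by rw [div_le_one (by positivity)]; linarith⟩
  refine ⟨fun j => 1 / (j + 1), fun j => ⟨condWalk n (1 / (j + 1)), hp _ (hε j).1 (hε j).2⟩,
    fun j => ⟨(hε j).1, (hε j).2, rfl⟩, ?_⟩
  refine ProbabilityMeasure.tendsto_iff_forall_integral_tendsto.2 fun g => ?_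
  exact (hμ g).comp (tendsto_nhdsWithin_iff.2
    ⟨tendsto_one_div_add_atTop_nhds_zero_nat, Eventually.of_forall fun j => (hε j).1⟩)

/-- The paths with sides of unit length. -/
def unitPaths (n : ℕ) : Set (Fin (n + 1) → ℂ) :=
  {X | ∀ k : Fin n, ‖X k.succ - X k.castSucc‖ = 1}

theorem isClosed_unitPaths (n : ℕ) : IsClosed (unitPaths n) := by
  have : unitPaths n = ⋂ k : Fin n, {X | ‖X k.succ - X k.castSucc‖ = 1} := by
    ext X; simp [unitPaths]
  rw [this]
  exact isClosed_iInter fun k => isClosed_eq (by fun_prop) continuous_const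

theorem path_mem_unitPaths {n : ℕ} {s : Fin n → ℂ} (hs : ∀ j, ‖s j‖ = 1) :
    path s ∈ unitPaths n := fun k => by
  rw [path_succ, add_sub_cancel_left, hs]

theorem ae_walkLaw_mem_unitPaths (n : ℕ) : ∀ᵐ X ∂(walkLaw n), X ∈ unitPaths n := by
  refine (ae_map_iff (p := fun X => X ∈ unitPaths n) (continuous_path n).aemeasurable
    (isClosed_unitPaths n).measurableSet).2 ?_
  filter_upwards [ae_stepsLaw_norm_eq_one n] with s hs using path_mem_unitPaths hs

theorem measureReal_cross_eq {n : ℕ} {ν : Measure (Fin (n + 1) → ℂ)}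
    (hν : ∀ᵐ X ∂ν, X ∈ unitPaths n) (k l : Fin n) :
    ν.real {X | Cross X k l} = ν.real (config k l ⁻¹' crossingConfigs) := by
  refine measureReal_congr ?_
  filter_upwards [hν] with X hX
  refine propext ((cross_iff_config_mem X k l).trans ?_)
  exact (mem_crossingConfigs_iff (q := config k l X) (hX k) (hX l)).symm

/-- A closed set of full measure keeps full measure under weak limits. -/
theorem ae_mem_unitPaths_of_tendsto {n : ℕ} {μ : ProbabilityMeasure (Fin (n + 1) → ℂ)}
    {ε : ℕ → ℝ} {μs : ℕ → ProbabilityMeasure (Fin (n + 1) → ℂ)}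
    (hμs : ∀ j, (μs j : Measure (Fin (n + 1) → ℂ)) = condWalk n (ε j))
    (h : Tendsto μs atTop (𝓝 μ)) :
    ∀ᵐ X ∂(μ : Measure (Fin (n + 1) → ℂ)), X ∈ unitPaths n := by
  have h1 : ∀ j, (μs j : Measure (Fin (n + 1) → ℂ)) (unitPaths n) = 1 := fun j => by
    rw [← mem_ae_iff_prob_eq_one (isClosed_unitPaths n).measurableSet, hμs, condWalk]
    exact (ae_walkLaw_mem_unitPaths n).filter_mono
      ProbabilityTheory.cond_absolutelyContinuous.ae_le
  have h2 := ProbabilityMeasure.limsup_measure_closed_le_of_tendsto h (isClosed_unitPaths n)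
  simp only [h1, limsup_const] at h2
  exact (mem_ae_iff_prob_eq_one (isClosed_unitPaths n).measurableSet).2
    (le_antisymm prob_le_one h2)

/-- The bounds for positive `ε` are comparisons with multiples of `configMeasure`, so they pass to
the limit law on the set of crossing configurations, of mass `2 / π`. -/
theorem exists_polygon_cross_bounds :
    ∃ D : ℝ, 0 < D ∧ ∀ (n : ℕ) (μ : ProbabilityMeasure (Fin (n + 1) → ℂ)), IsPolygonLaw n μ →
      ∀ (k l : Fin n) (a b : ℕ), k < l → (Finset.Ioo k l).card = a →
      (outerSides k l).card = b → 25 ≤ a → 25 ≤ b → D < a → D < b →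
        2 / Real.pi ^ 2 * ((1 - D / a) * (1 - D / b) * (n / (a * b)) / (1 + D / n))
          ≤ (μ : Measure (Fin (n + 1) → ℂ)).real {X | Cross X k l} ∧
        (μ : Measure (Fin (n + 1) → ℂ)).real {X | Cross X k l}
          ≤ 2 / Real.pi ^ 2 * ((1 + D / a) * (1 + D / b) * (n / (a * b)) / (1 - D / n)) := by
  obtain ⟨D, hD, h⟩ := exists_condWalk_config_bounds
  refine ⟨D, hD, fun n μ hμ k l a b hkl ha hb ha25 hb25 haD hbD => ?_⟩
  have hE := h n k l a b hkl ha hb ha25 hb25 haD hbD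
  obtain ⟨ε, μs, hμs, hlim⟩ := hμ.exists_seq fun ε hε hε1 => (hE ε hε hε1).1
  have hunit := ae_mem_unitPaths_of_tendsto (fun j => (hμs j).2.2) hlim
  have hcard := card_outerSides hkl
  have hpi := Real.pi_pos
  have ha0 : (0 : ℝ) < a := by exact_mod_cast (by omega : 0 < a)
  have hb0 : (0 : ℝ) < b := by exact_mod_cast (by omega : 0 < b)
  have hn0 : (0 : ℝ) < n := by exact_mod_cast (by omega : 0 < n)
  have han : (a : ℝ) ≤ n := by exact_mod_cast (by omega : a ≤ n)
  have hDn : D / n < 1 := (div_lt_one hn0).2 (haD.trans_le han)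
  have hDn' : 0 < 1 - D / n := by linarith
  have hfin : ∀ c : ℝ, IsFiniteMeasure (ENNReal.ofReal c • configMeasure) := fun c =>
    configMeasure.smul_finite ENNReal.ofReal_ne_top
  have hsmul : ∀ (c : ℝ) Q, (ENNReal.ofReal c • configMeasure) Q
      = ENNReal.ofReal (c * configMeasure.real Q) := fun c Q => by
    rw [Measure.smul_apply, smul_eq_mul, ENNReal.ofReal_mul' measureReal_nonneg,
      ofReal_measureReal]
  rw [measureReal_cross_eq hunit, measureReal_def]
  have hsub : crossingConfigs ⊆ boundedConfigs := Set.inter_subset_right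
  constructor
  · rw [← ENNReal.ofReal_le_iff_le_toReal (measure_ne_top _ _)]
    have := le_measure_preimage_of_tendsto hlim (continuous_config k l)
      (N := ENNReal.ofReal ((1 / (Real.pi * a) * (1 - D / a)) * (1 / b * (1 - D / b)) *
        (n / (1 + D / n))) • configMeasure) (Ω := boundedConfigs) (fun j Q hQ hQb => by
          rw [hsmul, (hμs j).2.2]
          have := (hE (ε j) (hμs j).1 (hμs j).2.1).1
          rw [ENNReal.ofReal_le_iff_le_toReal (measure_ne_top _ _)]
          exact ((hE (ε j) (hμs j).1 (hμs j).2.1).2 Q hQ hQb).1)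
      measurableSet_crossingConfigs hsub
    rw [hsmul, configMeasure_real_crossingConfigs] at this
    refine le_trans (le_of_eq ?_) this
    congr 1
    field_simp
  · have := measure_preimage_le_of_tendsto hlim (continuous_config k l)
      (N := ENNReal.ofReal ((1 / (Real.pi * a) * (1 + D / a)) * (1 / b * (1 + D / b)) *
        (n / (1 - D / n))) • configMeasure) isOpen_boundedConfigs (fun j Q hQ hQb => by
          rw [hsmul, (hμs j).2.2]
          have := (hE (ε j) (hμs j).1 (hμs j).2.1).1
          refine (ENNReal.le_ofReal_iff_toReal_le (measure_ne_top _ _) (by positivity)).2 ?_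
          exact ((hE (ε j) (hμs j).1 (hμs j).2.1).2 Q hQ hQb).2)
      hsub
    rw [hsmul, configMeasure_real_crossingConfigs] at this
    refine ENNReal.toReal_le_of_le_ofReal (by positivity) (this.trans (le_of_eq ?_))
    congr 1
    field_simp

/-! ### Crossing probabilities of two given sides -/

/-- Since `n = a + b + 2`, the ratio `n / (a * b)` equals `1 / a + 1 / b + 2 / (a * b)`. The last
term and all products of a relative error with the main term are quadratic in `1 / a`, `1 / b`. -/
theorem abs_sub_le_of_ratio_bounds {D a b n x : ℝ} (hD : 0 < D) (ha1 : 1 ≤ a) (hb1 : 1 ≤ b)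
    (ha : 2 * D ≤ a) (hb : 2 * D ≤ b) (hn : n = a + b + 2)
    (hlow : (1 - D / a) * (1 - D / b) * (n / (a * b)) / (1 + D / n) ≤ x)
    (hup : x ≤ (1 + D / a) * (1 + D / b) * (n / (a * b)) / (1 - D / n)) :
    |x - (1 / a + 1 / b)| ≤ (1 + 24 * D) * (1 / a ^ 2 + 1 / b ^ 2) := by
  have ha0 : 0 < a := by linarith
  have hb0 : 0 < b := by linarith
  have hn0 : 0 < n := by linarith
  obtain ⟨p, hp⟩ : ∃ p, p = 1 / a := ⟨_, rfl⟩
  obtain ⟨q, hq⟩ : ∃ q, q = 1 / b := ⟨_, rfl⟩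
  obtain ⟨c, hc⟩ : ∃ c, c = D / n := ⟨_, rfl⟩
  have hp0 : 0 < p := by rw [hp]; positivity
  have hq0 : 0 < q := by rw [hq]; positivity
  have hc0 : 0 < c := by rw [hc]; positivity
  have hp1 : p ≤ 1 := by rw [hp, div_le_one ha0]; exact ha1
  have hq1 : q ≤ 1 := by rw [hq, div_le_one hb0]; exact hb1
  have hu : D / a = D * p := by rw [hp]; ring
  have hv : D / b = D * q := by rw [hq]; ring
  have hu2 : D * p ≤ 1 / 2 := by rw [← hu, div_le_iff₀ ha0]; linarith
  have hv2 : D * q ≤ 1 / 2 := by rw [← hv, div_le_iff₀ hb0]; linarith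
  have hcu : c ≤ D * p := by
    rw [hc, ← hu]
    gcongr
    linarith
  have hnab : n / (a * b) = p + q + 2 * p * q := by
    rw [hn, hp, hq]; field_simp; ring
  have hsq : 1 / a ^ 2 + 1 / b ^ 2 = p ^ 2 + q ^ 2 := by rw [hp, hq]; ring
  rw [hu, hv, hnab, ← hc] at hlow hup
  rw [hsq, ← hp, ← hq]
  have hpq : 2 * p * q ≤ p ^ 2 + q ^ 2 := two_mul_le_add_sq p q
  have hpq2 : (p + q) ^ 2 ≤ 2 * (p ^ 2 + q ^ 2) := by nlinarith [sq_nonneg (p - q)]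
  have hpq0 : 0 < p * q := by positivity
  obtain ⟨u, hu'⟩ : ∃ u, u = D * p := ⟨_, rfl⟩
  obtain ⟨v, hv'⟩ : ∃ v, v = D * q := ⟨_, rfl⟩
  rw [← hu', ← hv'] at hlow hup
  rw [← hu'] at hu2 hcu
  rw [← hv'] at hv2
  have hu0 : 0 < u := by rw [hu']; positivity
  have hv0 : 0 < v := by rw [hv']; positivity
  have hS : u + v = D * (p + q) := by rw [hu', hv']; ring
  have hw0 : 0 < p + q + 2 * p * q := by positivity
  rw [abs_le]
  constructor
  · have h1 : (1 - u) * (1 - v) * (p + q + 2 * p * q) / (1 + c)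
        ≥ (p + q) * (1 - 2 * (u + v)) := by
      rw [ge_iff_le, le_div_iff₀ (by linarith)]
      by_cases hneg : 1 - 2 * (u + v) ≤ 0
      · have : (p + q) * (1 - 2 * (u + v)) * (1 + c) ≤ 0 :=
          mul_nonpos_of_nonpos_of_nonneg
            (mul_nonpos_of_nonneg_of_nonpos (by linarith) hneg) (by linarith)
        refine this.trans ?_
        exact mul_nonneg (mul_nonneg (by linarith) (by linarith)) hw0.le
      · push Not at hneg
        have e1 : (1 - 2 * (u + v)) * (1 + c) ≤ (1 - u) * (1 - v) := by
          nlinarith [mul_pos hu0 hv0, mul_nonneg (sub_nonneg.2 hcu) hneg.le]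
        calc (p + q) * (1 - 2 * (u + v)) * (1 + c)
            = (p + q) * ((1 - 2 * (u + v)) * (1 + c)) := by ring
          _ ≤ (p + q + 2 * p * q) * ((1 - u) * (1 - v)) := by
              apply mul_le_mul (by linarith) e1 _ hw0.le
              exact mul_nonneg hneg.le (by linarith)
          _ = _ := by ring
    have h2 : (p + q) * (2 * (u + v)) = 2 * D * (p + q) ^ 2 := by rw [hS]; ring
    have h3 : 2 * D * (p + q) ^ 2 ≤ 2 * D * (2 * (p ^ 2 + q ^ 2)) := by gcongr
    nlinarith [mul_pos hD (show 0 < p ^ 2 + q ^ 2 by positivity)]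
  · have h1 : (1 + u) * (1 + v) * (p + q + 2 * p * q) / (1 - c)
        ≤ (p + q + 2 * p * q) * (1 + 6 * (u + v)) := by
      rw [div_le_iff₀ (by linarith)]
      have e1 : (1 + u) * (1 + v) ≤ (1 + 6 * (u + v)) * (1 - c) := by
        have : (1 + 6 * (u + v)) * (1 - u) ≤ (1 + 6 * (u + v)) * (1 - c) := by gcongr
        refine le_trans ?_ this
        have h1 := mul_nonneg hu0.le (sub_nonneg.2 hu2)
        have h2 := mul_nonneg hv0.le (sub_nonneg.2 hu2)
        linarith
      calc _ ≤ (1 + 6 * (u + v)) * (1 - c) * (p + q + 2 * p * q) := by gcongr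
        _ = _ := by ring
    -- Each of the two summands is at most `12 D (p² + q²)`, which gives the constant `24 D`; the
    -- `1` beside it comes from `2 p q ≤ p² + q²`.
    have h2 : (p + q + 2 * p * q) * (6 * (u + v))
        = 6 * D * (p + q) ^ 2 + 6 * D * ((2 * p * q) * (p + q)) := by rw [hS]; ring
    have h3 : 6 * D * (p + q) ^ 2 ≤ 6 * D * (2 * (p ^ 2 + q ^ 2)) := by gcongr
    have h4 : (2 * p * q) * (p + q) ≤ (p ^ 2 + q ^ 2) * 2 :=
      mul_le_mul hpq (by linarith) (by linarith) (by positivity)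
    have h5 : 6 * D * ((2 * p * q) * (p + q)) ≤ 6 * D * ((p ^ 2 + q ^ 2) * 2) := by gcongr
    linarith

theorem two_div_pi_sq_le_one : 2 / Real.pi ^ 2 ≤ 1 := by
  have := Real.pi_gt_three
  rw [div_le_one (by positivity)]
  nlinarith

/-- The crossing probability of two sides of a polygon. -/
theorem exists_abs_polygon_cross_sub_le :
    ∃ C : ℝ, 0 < C ∧ ∀ (n : ℕ) (μ : ProbabilityMeasure (Fin (n + 1) → ℂ)), IsPolygonLaw n μ →
      ∀ (k l : Fin n) (a b : ℕ), k < l → (Finset.Ioo k l).card = a →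
      (outerSides k l).card = b → 1 ≤ a → 1 ≤ b →
        |(μ : Measure (Fin (n + 1) → ℂ)).real {X | Cross X k l}
          - 2 / Real.pi ^ 2 * (1 / a + 1 / b)| ≤ C * (1 / (a : ℝ) ^ 2 + 1 / (b : ℝ) ^ 2) := by
  obtain ⟨D, hD, h⟩ := exists_polygon_cross_bounds
  obtain ⟨T, hT⟩ := exists_nat_ge (max 25 (2 * D))
  have hT1 : 25 ≤ T := by exact_mod_cast (le_max_left _ _).trans hT
  have hT2 : 2 * D ≤ T := (le_max_right _ _).trans hT
  have hpi := Real.pi_pos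
  refine ⟨max (3 * T ^ 2) (1 + 24 * D), lt_max_of_lt_right (by positivity),
    fun n μ hμ k l a b hkl ha hb ha1 hb1 => ?_⟩
  have ha1' : (1 : ℝ) ≤ a := by exact_mod_cast ha1
  have hb1' : (1 : ℝ) ≤ b := by exact_mod_cast hb1
  have hc0 : 0 < 2 / Real.pi ^ 2 := by positivity
  have hc1 := two_div_pi_sq_le_one
  set P := (μ : Measure (Fin (n + 1) → ℂ)).real {X | Cross X k l}
  -- If `a` or `b` is small, the left side is at most `3`, since a probability is at most `1` and
  -- the main term at most `2`; the factor `T²` makes the right side at least that.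
  by_cases hsmall : a < T ∨ b < T
  · have hP0 : 0 ≤ P := measureReal_nonneg
    have hP1 : P ≤ 1 := measureReal_le_one
    have hab : 1 / (a : ℝ) + 1 / b ≤ 2 := by
      have h1 : 1 / (a : ℝ) ≤ 1 := by rw [div_le_one (by linarith)]; exact ha1'
      have h2 : 1 / (b : ℝ) ≤ 1 := by rw [div_le_one (by linarith)]; exact hb1'
      linarith
    have hab0 : 0 ≤ 1 / (a : ℝ) + 1 / b := by positivity
    have hl : |P - 2 / Real.pi ^ 2 * (1 / a + 1 / b)| ≤ 3 := by
      rw [abs_le]; constructor <;> nlinarith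
    have hsq : 1 ≤ (T : ℝ) ^ 2 * (1 / (a : ℝ) ^ 2 + 1 / (b : ℝ) ^ 2) := by
      have key : ∀ c : ℕ, 1 ≤ (c : ℝ) → c < T → 1 ≤ (T : ℝ) ^ 2 * (1 / (c : ℝ) ^ 2) := by
        intro c hc hcT
        rw [mul_one_div, one_le_div (by positivity)]
        gcongr
      rw [mul_add]
      rcases hsmall with h | h
      · have := key a ha1' h
        have : 0 ≤ (T : ℝ) ^ 2 * (1 / (b : ℝ) ^ 2) := by positivity
        linarith
      · have := key b hb1' h
        have : 0 ≤ (T : ℝ) ^ 2 * (1 / (a : ℝ) ^ 2) := by positivity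
        linarith
    calc _ ≤ (3 : ℝ) := hl
      _ ≤ 3 * T ^ 2 * (1 / (a : ℝ) ^ 2 + 1 / (b : ℝ) ^ 2) := by linarith
      _ ≤ _ := by gcongr; exact le_max_left _ _
  · push Not at hsmall
    have haT : (T : ℝ) ≤ a := by exact_mod_cast hsmall.1
    have hbT : (T : ℝ) ≤ b := by exact_mod_cast hsmall.2
    obtain ⟨h1, h2⟩ := h n μ hμ k l a b hkl ha hb (by omega) (by omega) (by linarith) (by linarith)
    have hcard := card_outerSides hkl
    have hn : (n : ℝ) = a + b + 2 := by
      rw [← hcard, ha, hb]; push_cast; ring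
    have key := abs_sub_le_of_ratio_bounds (x := P / (2 / Real.pi ^ 2)) hD ha1' hb1' (by linarith)
      (by linarith) hn ((le_div_iff₀' hc0).2 h1) ((div_le_iff₀' hc0).2 h2)
    have e : P - 2 / Real.pi ^ 2 * (1 / a + 1 / b)
        = 2 / Real.pi ^ 2 * (P / (2 / Real.pi ^ 2) - (1 / a + 1 / b)) := by
      field_simp
    rw [e, abs_mul, abs_of_pos hc0]
    calc _ ≤ 1 * ((1 + 24 * D) * (1 / (a : ℝ) ^ 2 + 1 / (b : ℝ) ^ 2)) := by gcongr
      _ ≤ _ := by rw [one_mul]; gcongr; exact le_max_right _ _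

/-- The crossing probability of two sides of a walk. -/
theorem exists_abs_walk_cross_sub_le :
    ∃ C : ℝ, 0 < C ∧ ∀ (n : ℕ) (k l : Fin n) (a : ℕ), k < l → (Finset.Ioo k l).card = a →
      1 ≤ a → |(walkLaw n).real {X | Cross X k l} - 2 / Real.pi ^ 2 * (1 / a)|
        ≤ C * (1 / (a : ℝ) ^ 2) := by
  obtain ⟨D, hD, h⟩ := exists_config_bounds
  have hpi := Real.pi_pos
  have hc0 : 0 < 2 / Real.pi ^ 2 := by positivity
  have hc1 := two_div_pi_sq_le_one
  refine ⟨max 1250 D, lt_max_of_lt_right hD, fun n k l a hkl ha ha1 => ?_⟩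
  have ha1' : (1 : ℝ) ≤ a := by exact_mod_cast ha1
  have ha0 : (0 : ℝ) < a := by linarith
  have : IsProbabilityMeasure (walkLaw n) :=
    Measure.isProbabilityMeasure_map (continuous_path n).aemeasurable
  -- Below the threshold of the local limit theorem the trivial bound `2` suffices; `1250 = 2 *
  -- 25²`.
  by_cases hsmall : a < 25
  · have hP0 : 0 ≤ (walkLaw n).real {X | Cross X k l} := measureReal_nonneg
    have hP1 : (walkLaw n).real {X | Cross X k l} ≤ 1 := measureReal_le_one
    have hab : 1 / (a : ℝ) ≤ 1 := by rw [div_le_one (by linarith)]; exact ha1'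
    have hab0 : 0 ≤ 1 / (a : ℝ) := by positivity
    have hl : |(walkLaw n).real {X | Cross X k l} - 2 / Real.pi ^ 2 * (1 / a)| ≤ 2 := by
      rw [abs_le]; constructor <;> nlinarith
    have hsq : 1 ≤ 625 * (1 / (a : ℝ) ^ 2) := by
      have : (a : ℝ) < 25 := by exact_mod_cast hsmall
      rw [mul_one_div, one_le_div (by positivity)]
      nlinarith
    calc _ ≤ (2 : ℝ) := hl
      _ ≤ 1250 * (1 / (a : ℝ) ^ 2) := by linarith
      _ ≤ _ := by gcongr; exact le_max_left _ _
  · obtain ⟨⟨h1, h2⟩, -⟩ := h n k l (Finset.Ioo k l) ∅ hkl.ne (by simp) (by simp) (by omega)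
      crossingConfigs measurableSet_crossingConfigs Set.inter_subset_right
    rw [ha, configMeasure_real_crossingConfigs] at h1 h2
    rw [measureReal_cross_eq (ae_walkLaw_mem_unitPaths n),
      walkLaw_apply_config hkl measurableSet_crossingConfigs]
    have e1 : 1 / (Real.pi * a) * (1 - D / a) * (2 / Real.pi)
        = 2 / Real.pi ^ 2 * (1 / a) - 2 / Real.pi ^ 2 * (D * (1 / (a : ℝ) ^ 2)) := by
      field_simp
    have e2 : 1 / (Real.pi * a) * (1 + D / a) * (2 / Real.pi)
        = 2 / Real.pi ^ 2 * (1 / a) + 2 / Real.pi ^ 2 * (D * (1 / (a : ℝ) ^ 2)) := by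
      field_simp
    have e3 : 2 / Real.pi ^ 2 * (D * (1 / (a : ℝ) ^ 2)) ≤ 1 * (max 1250 D * (1 / (a : ℝ) ^ 2)) := by
      gcongr
      exact le_max_right _ _
    rw [abs_le]
    constructor <;> linarith

/-! ### Linearity of expectation and counting of pairs -/

theorem integrable_and_integral_ncard_cross {n : ℕ} (ν : Measure (Fin (n + 1) → ℂ))
    [IsFiniteMeasure ν] (S : Finset (Fin n × Fin n)) :
    Integrable (fun X => (({p : Fin n × Fin n | p ∈ S ∧ Cross X p.1 p.2}.ncard : ℕ) : ℝ)) ν ∧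
    ∫ X, (({p : Fin n × Fin n | p ∈ S ∧ Cross X p.1 p.2}.ncard : ℕ) : ℝ) ∂ν
      = ∑ p ∈ S, ν.real {X | Cross X p.1 p.2} := by
  classical
  have h : (fun X : Fin (n + 1) → ℂ =>
      (({p : Fin n × Fin n | p ∈ S ∧ Cross X p.1 p.2}.ncard : ℕ) : ℝ))
      = fun X => ∑ p ∈ S, Set.indicator {X | Cross X p.1 p.2} (1 : (Fin (n + 1) → ℂ) → ℝ) X := by
    funext X
    have : {p : Fin n × Fin n | p ∈ S ∧ Cross X p.1 p.2}
        = (S.filter fun p => Cross X p.1 p.2 : Finset (Fin n × Fin n)) := by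
      ext p; simp
    rw [this, Set.ncard_coe_finset, Finset.card_filter]
    push_cast
    refine Finset.sum_congr rfl fun p _ => ?_
    simp [Set.indicator_apply]
  have hi : ∀ p ∈ S, Integrable
      (Set.indicator {X | Cross X p.1 p.2} (1 : (Fin (n + 1) → ℂ) → ℝ)) ν := fun p _ =>
    (integrable_const (1 : ℝ)).indicator (measurableSet_cross p.1 p.2)
  rw [h]
  refine ⟨integrable_finsetSum _ hi, ?_⟩
  rw [integral_finsetSum _ hi]
  exact Finset.sum_congr rfl fun p _ => integral_indicator_one (measurableSet_cross p.1 p.2)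

/-- The pairs of nonadjacent sides of a walk. -/
def walkPairs (n : ℕ) : Finset (Fin n × Fin n) :=
  Finset.univ.filter fun p => (p.1 : ℕ) + 2 ≤ p.2

/-- The pairs of nonadjacent sides of a polygon. -/
def polygonPairs (n : ℕ) : Finset (Fin n × Fin n) :=
  (walkPairs n).filter fun p => (p.2 : ℕ) + 1 ≠ p.1 + n

theorem sum_walkPairs_eq_sum_sum (n : ℕ) (g : ℕ → ℝ) :
    ∑ p ∈ walkPairs n, g (p.2 - p.1 - 1)
      = ∑ l ∈ Finset.range n, ∑ a ∈ Finset.range (l - 1), g (a + 1) := by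
  rw [walkPairs, Finset.sum_filter, Fintype.sum_prod_type_right,
    Finset.sum_range (fun l => ∑ a ∈ Finset.range (l - 1), g (a + 1))]
  refine Finset.sum_congr rfl fun l _ => ?_
  rw [← Finset.sum_range_reflect, Fin.sum_univ_eq_sum_range
    (fun k => if k + 2 ≤ (l : ℕ) then g (l - k - 1) else 0) n, ← Finset.sum_filter]
  refine Finset.sum_congr ?_ fun k hk => ?_
  · ext k
    have := l.isLt
    simp only [Finset.mem_filter, Finset.mem_range]
    omega
  · rw [Finset.mem_range] at hk
    congr 1
    omega

/-- A new last side adds one pair for each possible number of sides between, which drives the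
induction on `m`. -/
theorem sum_walkPairs (m : ℕ) (g : ℕ → ℝ) :
    ∑ p ∈ walkPairs (m + 2), g (p.2 - p.1 - 1)
      = ∑ a ∈ Finset.range m, ((m : ℝ) - a) * g (a + 1) := by
  rw [sum_walkPairs_eq_sum_sum]
  induction m with
  | zero => simp [Finset.sum_range_succ]
  | succ m ih =>
    rw [Finset.sum_range_succ, ih, Finset.sum_range_succ _ m,
      show m + 2 - 1 = m + 1 from rfl, Finset.sum_range_succ _ m, ← add_assoc,
      ← Finset.sum_add_distrib]
    push_cast
    congr 1
    · exact Finset.sum_congr rfl fun a _ => by ring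
    · ring

/-- The only walk pair that is adjacent in the polygon consists of the first and last sides, with `m
+ 1` sides between them. Setting `g` to zero at that value reduces the sum to the one for walks. -/
theorem sum_polygonPairs (m : ℕ) (g : ℕ → ℝ) :
    ∑ p ∈ polygonPairs (m + 3), g (p.2 - p.1 - 1)
      = ∑ a ∈ Finset.range m, ((m : ℝ) + 1 - a) * g (a + 1) := by
  have h : ∑ p ∈ polygonPairs (m + 3), g (p.2 - p.1 - 1)
      = ∑ p ∈ walkPairs (m + 1 + 2),
        (fun a => if a = m + 1 then 0 else g a) ((p.2 : ℕ) - p.1 - 1) := by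
    rw [polygonPairs, Finset.sum_filter]
    refine Finset.sum_congr rfl fun p hp => ?_
    have h2 : (p.1 : ℕ) + 2 ≤ p.2 := by simpa [walkPairs] using hp
    by_cases h : (p.2 : ℕ) + 1 = p.1 + (m + 3)
    · rw [if_neg (by simpa using h)]
      simp only
      rw [if_pos (by omega)]
    · rw [if_pos h]
      simp only
      rw [if_neg (by omega)]
  rw [h, sum_walkPairs (m + 1) fun a => if a = m + 1 then 0 else g a, Finset.sum_range_succ]
  simp only [if_true, mul_zero, add_zero]
  refine Finset.sum_congr rfl fun a ha => ?_
  rw [Finset.mem_range] at ha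
  rw [if_neg (by omega)]
  push_cast
  ring

/-! ### Harmonic sums -/

theorem abs_harmonic_sub_log_le {m n : ℕ} (h1 : m + 1 ≤ n) (h2 : n ≤ m + 3) :
    |(harmonic m : ℝ) - Real.log n| ≤ 2 := by
  have hn : (0 : ℝ) < n := by exact_mod_cast (by omega : 0 < n)
  have hm : (0 : ℝ) < (m : ℝ) + 1 := by positivity
  have hle : (n : ℝ) ≤ m + 3 := by exact_mod_cast h2
  have hge : (m : ℝ) + 1 ≤ n := by exact_mod_cast h1
  have hlow := log_add_one_le_harmonic m
  push_cast at hlow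
  have hup := harmonic_le_one_add_log m
  have hlog : Real.log n - Real.log (m + 1) ≤ 2 := by
    rw [← Real.log_div hn.ne' hm.ne']
    refine (Real.log_le_sub_one_of_pos (by positivity)).trans ?_
    rw [sub_le_iff_le_add, div_le_iff₀ hm]
    have : (0 : ℝ) ≤ m := Nat.cast_nonneg m
    linarith
  have hlog' : Real.log m ≤ Real.log n := by
    rcases Nat.eq_zero_or_pos m with h | h
    · rw [h, Nat.cast_zero, Real.log_zero]
      exact Real.log_natCast_nonneg n
    · exact Real.log_le_log (by exact_mod_cast h) (by linarith)
  rw [abs_le]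
  constructor <;> linarith

theorem harmonic_eq_sum_range (m : ℕ) :
    (harmonic m : ℝ) = ∑ a ∈ Finset.range m, 1 / ((a : ℝ) + 1) := by
  simp [harmonic]

theorem sum_one_div_sq_le_two (m : ℕ) :
    ∑ a ∈ Finset.range m, 1 / ((a : ℝ) + 1) ^ 2 ≤ (2 : ℝ) := by
  -- The strengthened bound telescopes; at `m = 0` the convention `1 / 0 = 0` keeps it true.
  suffices h : ∑ a ∈ Finset.range m, 1 / ((a : ℝ) + 1) ^ 2 ≤ (2 : ℝ) - 1 / (m : ℝ) by
    have : (0 : ℝ) ≤ 1 / m := by positivity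
    linarith
  induction m with
  | zero => simp
  | succ m ih =>
    rw [Finset.sum_range_succ]
    rcases Nat.eq_zero_or_pos m with rfl | h
    · norm_num
    · have hm : (0 : ℝ) < m := by exact_mod_cast h
      have : 1 / ((m : ℝ) + 1) ^ 2 ≤ 1 / m - 1 / (m + 1) := by
        rw [div_sub_div _ _ hm.ne' (by positivity), div_le_div_iff₀ (by positivity) (by positivity)]
        nlinarith
      push_cast
      linarith

theorem abs_sum_walk_sub_le (m : ℕ) :
    |∑ a ∈ Finset.range m, ((m : ℝ) - a) * (1 / ((a : ℝ) + 1))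
      - (m + 2 : ℕ) * Real.log (m + 2 : ℕ)| ≤ 4 * (m + 2 : ℕ) := by
  -- Termwise, `(m - a) / (a + 1) = (m + 1) / (a + 1) - 1`.
  have e : ∑ a ∈ Finset.range m, ((m : ℝ) - a) * (1 / ((a : ℝ) + 1))
      = (m + 1) * (harmonic m : ℝ) - m := by
    rw [harmonic_eq_sum_range, Finset.mul_sum,
      show (m : ℝ) = ∑ a ∈ Finset.range m, (1 : ℝ) by simp, ← Finset.sum_sub_distrib]
    refine Finset.sum_congr rfl fun a _ => ?_
    have : (a : ℝ) + 1 ≠ 0 := by positivity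
    simp only [Finset.sum_const, Finset.card_range, nsmul_eq_mul, mul_one]
    field_simp
    ring
  have hH := abs_le.1 (abs_harmonic_sub_log_le (m := m) (n := m + 2) (by omega) (by omega))
  have h0 : (0 : ℝ) ≤ harmonic m := by rw [harmonic_eq_sum_range]; positivity
  have h1 : (harmonic m : ℝ) ≤ m := by
    rw [harmonic_eq_sum_range]
    calc _ ≤ ∑ a ∈ Finset.range m, (1 : ℝ) := Finset.sum_le_sum fun a _ => by
          rw [div_le_one (by positivity)]
          have : (0 : ℝ) ≤ a := Nat.cast_nonneg a
          linarith
      _ = m := by simp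
  have hm : (0 : ℝ) ≤ m := Nat.cast_nonneg m
  rw [e]
  push_cast at hH ⊢
  rw [abs_le]
  constructor <;> nlinarith

/-- The two parts of a term are `(m + 2) / (a + 1) - 1` and `1 + 1 / (m - a)`. The constants cancel,
and reflection turns the second sum into a harmonic number, so the identity is exact. -/
theorem sum_polygon_eq (m : ℕ) :
    ∑ a ∈ Finset.range m, ((m : ℝ) + 1 - a) * (1 / ((a : ℝ) + 1) + 1 / ((m : ℝ) - a))
      = (m + 3 : ℕ) * (harmonic m : ℝ) := by
  have e : ∑ a ∈ Finset.range m, 1 / ((m : ℝ) - a) = harmonic m := by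
    rw [harmonic_eq_sum_range, ← Finset.sum_range_reflect]
    refine Finset.sum_congr rfl fun a ha => ?_
    rw [Finset.mem_range] at ha
    rw [Nat.sub_sub, Nat.cast_sub (by omega)]
    push_cast
    congr 1
    ring
  have h : ∀ a ∈ Finset.range m,
      ((m : ℝ) + 1 - a) * (1 / ((a : ℝ) + 1) + 1 / ((m : ℝ) - a))
        = (m + 2) * (1 / ((a : ℝ) + 1)) + 1 / ((m : ℝ) - a) := fun a ha => by
    rw [Finset.mem_range] at ha
    have h1 : (a : ℝ) + 1 ≠ 0 := by positivity
    have h2 : (m : ℝ) - a ≠ 0 := by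
      rw [sub_ne_zero]
      exact_mod_cast ha.ne'
    field_simp
    ring
  rw [Finset.sum_congr rfl h, Finset.sum_add_distrib, e, ← Finset.mul_sum,
    ← harmonic_eq_sum_range]
  push_cast
  ring

theorem sum_walk_error_le (m : ℕ) :
    ∑ a ∈ Finset.range m, ((m : ℝ) - a) * (1 / ((a : ℝ) + 1) ^ 2) ≤ 2 * ((m + 2 : ℕ) : ℝ) := by
  calc _ ≤ ∑ a ∈ Finset.range m, (m : ℝ) * (1 / ((a : ℝ) + 1) ^ 2) := by
        refine Finset.sum_le_sum fun a _ => ?_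
        gcongr
        simp
    _ ≤ (m : ℝ) * 2 := by
        rw [← Finset.mul_sum]
        gcongr
        exact sum_one_div_sq_le_two m
    _ ≤ _ := by push_cast; linarith

theorem sum_polygon_error_le (m : ℕ) :
    ∑ a ∈ Finset.range m,
      ((m : ℝ) + 1 - a) * (1 / ((a : ℝ) + 1) ^ 2 + 1 / ((m : ℝ) - a) ^ 2)
      ≤ 4 * ((m + 3 : ℕ) : ℝ) := by
  have hm : (0 : ℝ) ≤ m := Nat.cast_nonneg m
  calc _ ≤ ∑ a ∈ Finset.range m, (((m : ℝ) + 1) * (1 / ((a : ℝ) + 1) ^ 2) + 2) := by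
        refine Finset.sum_le_sum fun a ha => ?_
        rw [Finset.mem_range] at ha
        have ha' : (a : ℝ) + 1 ≤ m := by exact_mod_cast ha
        have ha0 : (0 : ℝ) ≤ a := Nat.cast_nonneg a
        rw [mul_add]
        gcongr
        · linarith
        -- With `y = m - a ≥ 1`, this is `(y + 1) / y² ≤ 2`.
        · rw [mul_one_div, div_le_iff₀ (by nlinarith)]
          nlinarith
    _ = ((m : ℝ) + 1) * ∑ a ∈ Finset.range m, 1 / ((a : ℝ) + 1) ^ 2 + m * 2 := by
        rw [Finset.sum_add_distrib, Finset.mul_sum]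
        simp
    _ ≤ ((m : ℝ) + 1) * 2 + m * 2 := by
        gcongr
        exact sum_one_div_sq_le_two m
    _ ≤ _ := by push_cast; linarith

/-! ### Summation over pairs and the expectations -/

theorem abs_sum_sub_le_of_forall {ι : Type*} {S : Finset ι} {P f e : ι → ℝ} {c C L M N : ℝ}
    (hP : ∀ p ∈ S, |P p - c * f p| ≤ C * e p) (hc : 0 ≤ c) (hc1 : c ≤ 1) (hC : 0 ≤ C)
    (hf : |∑ p ∈ S, f p - L| ≤ M) (he : ∑ p ∈ S, e p ≤ N) :
    |∑ p ∈ S, P p - c * L| ≤ C * N + M := by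
  have e1 : ∑ p ∈ S, P p - c * L
      = ∑ p ∈ S, (P p - c * f p) + c * (∑ p ∈ S, f p - L) := by
    rw [Finset.sum_sub_distrib, ← Finset.mul_sum]; ring
  rw [e1]
  refine (abs_add_le _ _).trans (add_le_add ?_ ?_)
  · calc _ ≤ ∑ p ∈ S, |P p - c * f p| := Finset.abs_sum_le_sum_abs _ _
      _ ≤ ∑ p ∈ S, C * e p := Finset.sum_le_sum hP
      _ ≤ _ := by rw [← Finset.mul_sum]; gcongr
  · rw [abs_mul, abs_of_nonneg hc]
    calc _ ≤ 1 * M := by gcongr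
      _ = M := one_mul M

/-- Covers the `n` too small to have a pair of nonadjacent sides, where the sum over pairs is empty.
-/
theorem abs_zero_sub_mul_log_le {n : ℕ} (hn : n ≤ 2) :
    |0 - 2 / Real.pi ^ 2 * (n * Real.log n)| ≤ 4 * (n : ℝ) := by
  have hpi := Real.pi_pos
  have h1 := two_div_pi_sq_le_one
  have hl0 := Real.log_natCast_nonneg n
  have hn' : (n : ℝ) ≤ 2 := by exact_mod_cast hn
  have hl1 : Real.log n ≤ 4 := (Real.log_le_self (Nat.cast_nonneg n)).trans (by linarith)
  rw [zero_sub, abs_neg, abs_of_nonneg (by positivity)]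
  calc _ ≤ 1 * ((n : ℝ) * 4) := by gcongr
    _ = _ := by ring

theorem card_Ioo_eq {n : ℕ} (k l : Fin n) : (Finset.Ioo k l).card = l - k - 1 := Fin.card_Ioo k l

/-- The expected number of self-intersections of a random walk. -/
theorem exists_abs_integral_walkCrossings_sub_le :
    ∃ C : ℝ, 0 ≤ C ∧ ∀ n : ℕ,
      Integrable (fun X => (walkCrossings X : ℝ)) (walkLaw n) ∧
      |(∫ X, (walkCrossings X : ℝ) ∂(walkLaw n)) - 2 / Real.pi ^ 2 * (n * Real.log n)| ≤ C * n := by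
  obtain ⟨C, hC, h⟩ := exists_abs_walk_cross_sub_le
  refine ⟨2 * C + 4, by positivity, fun n => ?_⟩
  have : IsProbabilityMeasure (walkLaw n) :=
    Measure.isProbabilityMeasure_map (continuous_path n).aemeasurable
  have key := integrable_and_integral_ncard_cross (walkLaw n) (walkPairs n)
  have e : ∀ X : Fin (n + 1) → ℂ, {p : Fin n × Fin n | p ∈ walkPairs n ∧ Cross X p.1 p.2}.ncard
      = walkCrossings X := fun X => by simp [walkCrossings, walkPairs]
  simp only [e] at key
  refine ⟨key.1, ?_⟩
  rw [key.2]
  have hn0 : (0 : ℝ) ≤ n := Nat.cast_nonneg n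
  rcases Nat.lt_or_ge n 2 with hn | hn
  · have : walkPairs n = ∅ := by
      ext p
      have := p.2.isLt
      simp only [walkPairs, Finset.mem_filter, Finset.mem_univ, true_and, Finset.notMem_empty,
        iff_false]
      omega
    rw [this, Finset.sum_empty]
    refine (abs_zero_sub_mul_log_le hn.le).trans ?_
    gcongr
    linarith
  · obtain ⟨m, rfl⟩ := Nat.exists_eq_add_of_le' hn
    have hs1 := sum_walkPairs m (fun a => 1 / (a : ℝ))
    have hs2 := sum_walkPairs m (fun a => 1 / (a : ℝ) ^ 2)
    simp only [Nat.cast_add_one] at hs1 hs2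
    have hmain := hs1 ▸ abs_sum_walk_sub_le m
    have herr := hs2 ▸ sum_walk_error_le m
    refine (abs_sum_sub_le_of_forall (fun p hp => h (m + 2) p.1 p.2 (p.2 - p.1 - 1) ?_
      (card_Ioo_eq _ _) ?_) (by positivity) two_div_pi_sq_le_one hC.le hmain herr).trans
      (le_of_eq (by ring))
    all_goals
      have h2 : (p.1 : ℕ) + 2 ≤ p.2 := by simpa [walkPairs] using hp
    · exact Fin.lt_def.2 (by omega)
    · omega

/-- The expected number of self-intersections of a random polygon. -/
theorem exists_abs_integral_polygonCrossings_sub_le :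
    ∃ C : ℝ, 0 ≤ C ∧ ∀ (n : ℕ) (μ : ProbabilityMeasure (Fin (n + 1) → ℂ)), IsPolygonLaw n μ →
      Integrable (fun X => (polygonCrossings X : ℝ)) (μ : Measure (Fin (n + 1) → ℂ)) ∧
      |(∫ X, (polygonCrossings X : ℝ) ∂(μ : Measure (Fin (n + 1) → ℂ)))
        - 2 / Real.pi ^ 2 * (n * Real.log n)| ≤ C * n := by
  obtain ⟨C, hC, h⟩ := exists_abs_polygon_cross_sub_le
  refine ⟨4 * C + 4, by positivity, fun n μ hμ => ?_⟩
  have key := integrable_and_integral_ncard_cross (μ : Measure (Fin (n + 1) → ℂ)) (polygonPairs n)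
  have e : ∀ X : Fin (n + 1) → ℂ, {p : Fin n × Fin n | p ∈ polygonPairs n ∧ Cross X p.1 p.2}.ncard
      = polygonCrossings X := fun X => by
    simp [polygonCrossings, polygonPairs, walkPairs, and_assoc]
  simp only [e] at key
  refine ⟨key.1, ?_⟩
  rw [key.2]
  have hn0 : (0 : ℝ) ≤ n := Nat.cast_nonneg n
  rcases Nat.lt_or_ge n 3 with hn | hn
  · have : polygonPairs n = ∅ := by
      ext p
      have := p.2.isLt
      simp only [polygonPairs, walkPairs, Finset.mem_filter, Finset.mem_univ, true_and,
        Finset.notMem_empty, iff_false]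
      omega
    rw [this, Finset.sum_empty]
    refine (abs_zero_sub_mul_log_le (by omega)).trans ?_
    gcongr
    linarith
  · obtain ⟨m, rfl⟩ := Nat.exists_eq_add_of_le' hn
    have hsub : ∀ a ∈ Finset.range m, (((m + 1 - (a + 1) : ℕ)) : ℝ) = (m : ℝ) - a := fun a ha => by
      rw [Finset.mem_range] at ha
      rw [Nat.add_sub_add_right, Nat.cast_sub ha.le]
    have hs1 : _ = _ := (sum_polygonPairs m
      (fun a => 1 / (a : ℝ) + 1 / ((m + 1 - a : ℕ) : ℝ))).trans
      (Finset.sum_congr rfl fun a ha => by rw [hsub a ha, Nat.cast_add_one])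
    have hs2 : _ = _ := (sum_polygonPairs m
      (fun a => 1 / (a : ℝ) ^ 2 + 1 / ((m + 1 - a : ℕ) : ℝ) ^ 2)).trans
      (Finset.sum_congr rfl fun a ha => by rw [hsub a ha, Nat.cast_add_one])
    rw [sum_polygon_eq] at hs1
    have herr := hs2 ▸ sum_polygon_error_le m
    have hmain : |((m + 3 : ℕ) : ℝ) * (harmonic m : ℝ) - (m + 3 : ℕ) * Real.log (m + 3 : ℕ)|
        ≤ 4 * (m + 3 : ℕ) := by
      rw [← mul_sub, abs_mul, abs_of_nonneg hn0, mul_comm]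
      gcongr
      exact (abs_harmonic_sub_log_le (by omega) (by omega)).trans (by norm_num)
    -- Of the `m + 3` sides, removing the two chosen ones and the `a` between them leaves `m + 1 -
    -- a` outer sides; excluding the first-last pair makes this at least `1`.
    refine (abs_sum_sub_le_of_forall (fun p hp => h (m + 3) μ hμ p.1 p.2 (p.2 - p.1 - 1)
      (m + 1 - (p.2 - p.1 - 1)) ?_ (card_Ioo_eq _ _) ?_ ?_ ?_)
      (by positivity) two_div_pi_sq_le_one hC.le
      (hs1 ▸ hmain) herr).trans (le_of_eq (by ring))
    all_goals
      have h2 : (p.1 : ℕ) + 2 ≤ p.2 ∧ (p.2 : ℕ) + 1 ≠ p.1 + (m + 3) := by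
        simpa [walkPairs, polygonPairs] using hp
      have hlt := p.2.isLt
      have hkl : p.1 < p.2 := Fin.lt_def.2 (by omega)
    · exact hkl
    · have h3 := card_outerSides hkl
      rw [card_Ioo_eq] at h3
      omega
    · omega
    · omega

end PlanarWalk

end

theorem mainTheorem2 :
    (∀ᶠ n : ℕ in atTop,
      ∃ μ : ProbabilityMeasure (Fin (n + 1) → ℂ), PlanarWalk.IsPolygonLaw n μ) ∧
    ∃ C : ℝ, ∀ n : ℕ, 1 ≤ n →
      (∀ μ : ProbabilityMeasure (Fin (n + 1) → ℂ), PlanarWalk.IsPolygonLaw n μ →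
        Integrable (fun X => (PlanarWalk.polygonCrossings X : ℝ))
          (μ : Measure (Fin (n + 1) → ℂ)) ∧
        |(∫ X, (PlanarWalk.polygonCrossings X : ℝ) ∂(μ : Measure (Fin (n + 1) → ℂ)))
          - 2 / Real.pi ^ 2 * n * Real.log n| ≤ C * n) ∧
      (Integrable (fun X => (PlanarWalk.walkCrossings X : ℝ)) (PlanarWalk.walkLaw n) ∧
        |(∫ X, (PlanarWalk.walkCrossings X : ℝ) ∂(PlanarWalk.walkLaw n))
          - 2 / Real.pi ^ 2 * n * Real.log n| ≤ C * n) := by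
  obtain ⟨C, hC, hwalk⟩ := PlanarWalk.exists_abs_integral_walkCrossings_sub_le
  obtain ⟨C', hC', hpolygon⟩ := PlanarWalk.exists_abs_integral_polygonCrossings_sub_le
  refine ⟨PlanarWalk.eventually_exists_isPolygonLaw, C + C', fun n _ => ?_⟩
  have hn : (0 : ℝ) ≤ n := Nat.cast_nonneg n
  have e : C * n ≤ (C + C') * n := by gcongr; linarith
  have e' : C' * n ≤ (C + C') * n := by gcongr; linarith
  rw [mul_assoc]
  exact ⟨fun μ hμ => ⟨(hpolygon n μ hμ).1, (hpolygon n μ hμ).2.trans e'⟩,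
    (hwalk n).1, (hwalk n).2.trans e⟩
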